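/- **Setting.** Let $f(\cdot;\theta)$, $\theta\in\Theta\subset\mathbb R^d$, be lifetime densities on $(0,\infty)$ with distribution functions $F(\cdot;\theta)$. An observation is $x=(t,C,t_l)$ with observed time $t$, censoring indicator $C$ ($C=1$: right-censored, $C=0$: failure) and left-truncation time $0\le t_l\le t$; its log-likelihood is $$l(x,\theta)=(1-C)\log f(t;\theta)+C\log\{1-F(t;\theta)\}-\log\{1-F(t_l;\theta)\},$$ and almost surely, at every $\theta\in\Theta$, the arguments of the logarithms are positive and $l(x,\cdot)$ is twice continuously differentiable. Write $\dot l$ and $\ddot l$ for gradient and Hessian in $\theta$, and $v^2=vv^\top$ for a vector $v$. For each $n$ the data $\mathcal D_n=\{x_1,\dots,x_n\}$ are i.i.d.; the law of an individual, with expectation $\mathbb E_n$, may depend on $n$ (so that the censoring rate may tend to one). For a law not depending on $n$ every "uniformly in $n$" below is void. Let $n_0$ be the (random) number of uncensored individuals. The true value $\theta_0$ is an interior point of $\Theta$: for each $n$, either the observations are generated by the model with parameter $\theta_0$ (lifetime with density $f(\cdot;\theta_0)$, independent of the censoring and truncation times, observed only if it exceeds the truncation time), or, more generally, $\theta_0$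 maximizes $\theta\mapsto\mathbb E_n\,l(x,\theta)$ over $\Theta$. **Estimators.** $\hat\theta$ maximizes $\frac1n\sum_{i=1}^n l(x_i,\theta)$ over $\Theta$. Let $\tilde\pi_i>0$ ($C_i=1$) be subsampling probabilities, functions of $\mathcal D_n$ with $\sum_{C_i=1}\tilde\pi_i=1$. The censoring subsample of size $r=r_n$ consists of all uncensored individuals and of $r-n_0$ individuals drawn with replacement, independently given $\mathcal D_n$, from the censored ones with probabilities $\tilde\pi_i$. The estimator $\tilde\theta_c$ is a measurable maximizer over $\Theta$ of $$l_c^*(\theta)=\sum_{C_i=0}l(x_i,\theta)+\sum_{\text{draws }j}\frac{1}{(r-n_0)\tilde\pi_j^c}\,l(x_j^c,\theta).$$ **Assumptions.** (5) $\Theta$ is compact and convex; with probability tending to one $\hat\theta$ is the unique maximizer; for every $\theta\in\Theta$, $\mathbb E_n\{l^2(x,\theta)\}$ is finite, uniformly in $n$. (6) For every $\theta\in\Theta$, $-\mathbb E_n\{\ddot l(x,\theta)\}$ is positive definite (uniformly in $n$) and the second moments of the entries $\ddot l_{(jk)}(x,\theta)$ are finite (uniformly in $n$). There is $\psi$ with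 $\mathbb E_n\{\psi^2(x)\}<\infty$ (uniformly in $n$) and, almost surely, $|\ddot l_{(jk)}(x,\theta_1)-\ddot l_{(jk)}(x,\theta_2)|\le\psi(x)\|\theta_1-\theta_2\|$ for all $j,k$ and $\theta_1,\theta_2\in\Theta$. (7) $\Lambda(\theta_0)=\mathbb E_n\{\dot l(x,\theta_0)^2\}$ is positive definite (uniformly in $n$), $\|\dot l(x,\theta_0)\|^2$ is uniformly integrable along the laws, and there is $\delta>0$ such that for every $\theta\in\Theta$, on the event $\|\theta-\hat\theta\|<\delta$, $\frac1n\sum_{i=1}^n\|\dot l(x_i,\theta)\|^4=O_p(1)$. (8) $\max_{C_i=1}(n\tilde\pi_i)^{-1}=O_p(1)$. **Theorem.** Suppose that (5)–(8) hold and that, as $n\to\infty$, $r\to\infty$, $r/n\to\gamma\in[0,\infty)$, $n_0/r\to0$ in probability, and $$\Lambda_c(\theta_0)=\frac1{n^2}\sum_{C_i=1}\frac1{\tilde\pi_i}\dot l(x_i,\theta_0)^2-\Big[\frac1n\sum_{C_i=1}\dot l(x_i,\theta_0)\Big]^2\longrightarrow\Lambda_{1c}(\theta_0)$$ in probability, for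 a deterministic matrix $\Lambda_{1c}(\theta_0)$. Put $M_{0g}=\mathbb E_n\{\ddot l(x,\theta_0)\}$ and $V_{0c}=M_{0g}^{-1}\{\Lambda_{1c}(\theta_0)+\gamma\Lambda(\theta_0)\}M_{0g}^{-1}$ (these depend on $n$ only if the law of an individual does). Then $V_{0c}$ is positive definite and, unconditionally, $$\sqrt r\,V_{0c}^{-1/2}(\tilde\theta_c-\theta_0)\xrightarrow{d}N(0,I).$$ -/

import Mathlib

open MeasureTheory ProbabilityTheory Filter Topology
open scoped ENNReal MatrixOrder

noncomputable section

namespace CensSub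

/-- The parameter space `ℝ^d` with its Euclidean norm. -/
abbrev Param (d : ℕ) := EuclideanSpace ℝ (Fin d)

/-- An observation `x = (t, C, t_l)`: the observed time, the censoring indicator
(`true` = right-censored, `false` = failure observed), and the left-truncation time. -/
abbrev Obs := ℝ × Bool × ℝ

/-! ### The lifetime model and its log-likelihood -/

/-- The lifetime distribution on `(0, ∞)` with density `f θ`. -/
def lifetimeLaw {d : ℕ} (f : Param d → ℝ → ℝ) (θ : Param d) : Measure ℝ :=
  (volume.restrict (Set.Ioi 0)).withDensity fun s => ENNReal.ofReal (f θ s)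

/-- The lifetime distribution function `F(t; θ)`. -/
def lifetimeCDF {d : ℕ} (f : Param d → ℝ → ℝ) (θ : Param d) (t : ℝ) : ℝ :=
  (lifetimeLaw f θ).real (Set.Iic t)

/-- `f` is a parametric family of lifetime densities over `Θ`. -/
structure IsLifetimeModel {d : ℕ} (f : Param d → ℝ → ℝ) (Θ : Set (Param d)) : Prop where
  measurable : ∀ θ, Measurable (f θ)
  nonneg : ∀ θ ∈ Θ, ∀ s, 0 ≤ f θ s
  isProbabilityMeasure : ∀ θ ∈ Θ, IsProbabilityMeasure (lifetimeLaw f θ)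

/-- Log-likelihood of one observation,
`l(x, θ) = (1 - C) log f(t; θ) + C log (1 - F(t; θ)) - log (1 - F(t_l; θ))`. -/
def logLik {d : ℕ} (f : Param d → ℝ → ℝ) (x : Obs) (θ : Param d) : ℝ :=
  (if x.2.1 then Real.log (1 - lifetimeCDF f θ x.1) else Real.log (f θ x.1))
    - Real.log (1 - lifetimeCDF f θ x.2.2)

/-- The likelihood contribution of `x` at `θ` is positive, so that all logarithms in `logLik`
are logarithms of positive numbers. -/
def PosLik {d : ℕ} (f : Param d → ℝ → ℝ) (x : Obs) (θ : Param d) : Prop :=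
  (if x.2.1 then lifetimeCDF f θ x.1 < 1 else 0 < f θ x.1) ∧ lifetimeCDF f θ x.2.2 < 1

/-- The gradient of the log-likelihood in `θ`. -/
def score {d : ℕ} (f : Param d → ℝ → ℝ) (x : Obs) (θ : Param d) : Param d :=
  gradient (logLik f x) θ

/-- The Hessian of the log-likelihood in `θ`. -/
def hess {d : ℕ} (f : Param d → ℝ → ℝ) (x : Obs) (θ : Param d) : Matrix (Fin d) (Fin d) ℝ :=
  Matrix.of fun j k => fderiv ℝ (fun η => score f x η j) θ (EuclideanSpace.single k 1)

/-- `v vᵀ` for a column vector `v`. -/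
def outer {d : ℕ} (v : Param d) : Matrix (Fin d) (Fin d) ℝ :=
  Matrix.of fun j k => v j * v k

/-- The expected Hessian when an observation has law `μ`. -/
def meanHess {d : ℕ} (f : Param d → ℝ → ℝ) (μ : Measure Obs) (θ : Param d) :
    Matrix (Fin d) (Fin d) ℝ :=
  Matrix.of fun j k => ∫ x, hess f x θ j k ∂μ

/-- The expected squared score when an observation has law `μ`. -/
def meanSqScore {d : ℕ} (f : Param d → ℝ → ℝ) (μ : Measure Obs) (θ : Param d) :
    Matrix (Fin d) (Fin d) ℝ :=
  Matrix.of fun j k => ∫ x, outer (score f x θ) j k ∂μ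

/-- The law of an observation generated by the lifetime model at `θ`: the lifetime `T` has density
`f θ` and is independent of the pair (censoring time `c`, truncation time `τ`), which has law `ν`;
an individual is observed only if `T > τ`, and then one records
`(min T c, 1{T > c}, τ)`. -/
def modelLaw {d : ℕ} (f : Param d → ℝ → ℝ) (θ : Param d) (ν : Measure (ℝ × ℝ)) : Measure Obs :=
  (ProbabilityTheory.cond ((lifetimeLaw f θ).prod ν) {p | p.2.2 < p.1}).map
    fun p => (min p.1 p.2.1, decide (p.2.1 < p.1), p.2.2)

/-! ### Full data and censoring subsample

The data of size `n` are the first `n` entries of a sequence `x`. -/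

/-- The first `n` entries as a data vector. -/
def dataVec (n : ℕ) (x : ℕ → Obs) : Fin n → Obs := fun i => x i

/-- The number `n₀` of uncensored individuals. -/
def numFail {n : ℕ} (D : Fin n → Obs) : ℕ :=
  (Finset.univ.filter fun i => (D i).2.1 = false).card

/-- Full-data average log-likelihood. -/
def fullLogLik {d n : ℕ} (f : Param d → ℝ → ℝ) (D : Fin n → Obs) (θ : Param d) : ℝ :=
  (1 / (n : ℝ)) * ∑ i, logLik f (D i) θ

/-- The matrix `Λ_c(θ)`: with sums over the censored individuals,
`n⁻² ∑ π_i⁻¹ l̇_i l̇_iᵀ - (n⁻¹ ∑ l̇_i) (n⁻¹ ∑ l̇_i)ᵀ`. -/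
def lambdaC {d n : ℕ} (f : Param d → ℝ → ℝ) (D : Fin n → Obs) (π : ℕ → ℝ) (θ : Param d) :
    Matrix (Fin d) (Fin d) ℝ :=
  (1 / (n : ℝ) ^ 2) • (∑ i : Fin n,
      if (D i).2.1 then (1 / π i) • outer (score f (D i) θ) else 0)
    - outer ((1 / (n : ℝ)) • ∑ i : Fin n, if (D i).2.1 then score f (D i) θ else 0)

/-- The weighted log-likelihood of the censoring subsample of size `r`: all uncensored individuals
with weight one, and the individuals `K 0, …, K (r - n₀ - 1)` drawn (with replacement) from the
censored ones, with weights `1 / ((r - n₀) π)`. -/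
def subLogLik {d : ℕ} (f : Param d → ℝ → ℝ) (n r : ℕ) (x : ℕ → Obs) (π : ℕ → ℝ) (K : ℕ → ℕ)
    (θ : Param d) : ℝ :=
  (∑ i ∈ Finset.range n, if (x i).2.1 then 0 else logLik f (x i) θ)
    + ∑ j ∈ Finset.range (r - numFail (dataVec n x)),
        (1 / (((r - numFail (dataVec n x) : ℕ) : ℝ) * π (K j))) * logLik f (x (K j)) θ

/-- Subsampling probabilities: functions `π n D i` of the data `D` that are positive on the censored
individuals and sum to one over them, whenever there are censored individuals. -/
structure IsSubsamplingProb (π : (n : ℕ) → (Fin n → Obs) → ℕ → ℝ) : Prop where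
  measurable : ∀ n i, Measurable fun D => π n D i
  pos : ∀ n (D : Fin n → Obs) (i : Fin n), (D i).2.1 = true → 0 < π n D i
  sum_eq_one : ∀ n (D : Fin n → Obs), (∃ i, (D i).2.1 = true) →
    (∑ i : Fin n, if (D i).2.1 then π n D i else 0) = 1

/-- Conditionally on the data `D`, the indices `K 0, …, K (r - n₀ - 1)` are independent draws of
censored individuals, individual `i` having probability `π i`. The conditional law is spelled out
on every measurable set `A` of data on which some individual is censored and the number `r - n₀` of
draws is a constant `m`. -/
def IsCensoringDraw {Ω : Type*} [MeasurableSpace Ω] (P : Measure Ω) (n r : ℕ)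
    (X : ℕ → Ω → Obs) (π : (Fin n → Obs) → ℕ → ℝ) (K : ℕ → Ω → ℕ) : Prop :=
  ∀ (m : ℕ) (A : Set (Fin n → Obs)), MeasurableSet A →
    (∀ D ∈ A, (∃ i, (D i).2.1 = true) ∧ r - numFail D = m) →
    ∀ k : Fin m → Fin n,
      P {ω | dataVec n (fun i => X i ω) ∈ A ∧ ∀ j : Fin m, K j ω = k j} =
        ∫⁻ ω in {ω | dataVec n (fun i => X i ω) ∈ A},
          ∏ j : Fin m, (if (X (k j) ω).2.1
            then ENNReal.ofReal (π (dataVec n fun i => X i ω) (k j)) else 0) ∂P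

/-! ### Stochastic boundedness and uniform conditions -/

/-- `Z_n = O_p(1)`. -/
def BoundedInProb {Ω : Type*} [MeasurableSpace Ω] (P : Measure Ω) (Z : ℕ → Ω → ℝ) : Prop :=
  ∀ ε : ℝ, 0 < ε → ∃ M : ℝ, ∀ᶠ n in atTop, P {ω | M < |Z n ω|} ≤ ENNReal.ofReal ε

/-- Positive definiteness uniformly along a sequence of symmetric matrices; for a constant sequence
this is positive definiteness. -/
def UnifPosDef {d : ℕ} (A : ℕ → Matrix (Fin d) (Fin d) ℝ) : Prop :=
  ∃ c : ℝ, 0 < c ∧ ∀ n, (A n - c • (1 : Matrix (Fin d) (Fin d) ℝ)).PosSemidef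

/-- `g` has finite second moments, bounded along the sequence of laws `μ n`. -/
def BddSecondMoment (μ : ℕ → Measure Obs) (g : Obs → ℝ) : Prop :=
  ∃ B : ℝ, ∀ n, MemLp g 2 (μ n) ∧ ∫ x, (g x) ^ 2 ∂(μ n) ≤ B

/-! ### The assumptions

`μ n` is the law of one observation among data of size `n`; a constant sequence is the case of a
fixed population. -/

/-- Row-wise i.i.d. data: for each `n`, the individuals `X n 0, …, X n (n - 1)` are independent with
common law `μ n`. -/
structure IsIIDData {Ω : Type*} [MeasurableSpace Ω] (P : Measure Ω) (μ : ℕ → Measure Obs)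
    (X : ℕ → ℕ → Ω → Obs) : Prop where
  measurable : ∀ n i, Measurable (X n i)
  law : ∀ n, ∀ i < n, P.map (X n i) = μ n
  indep : ∀ n, iIndepFun (fun i : Fin n => X n i) P

/-- Almost sure regularity of the observations and of the log-likelihood on `Θ`. -/
def IsRegular {d : ℕ} (f : Param d → ℝ → ℝ) (Θ : Set (Param d)) (μ : ℕ → Measure Obs) : Prop :=
  ∀ n, ∀ᵐ x ∂(μ n), (0 ≤ x.2.2 ∧ x.2.2 ≤ x.1) ∧
    ∀ θ ∈ Θ, PosLik f x θ ∧ ContDiffAt ℝ 2 (logLik f x) θ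

/-- `θ₀` is the true value: for each `n` the observations are generated by the lifetime model at
`θ₀` with independent censoring and truncation, or, more generally, `θ₀` maximizes the expected
log-likelihood over `Θ`. -/
def IsTrueValue {d : ℕ} (f : Param d → ℝ → ℝ) (Θ : Set (Param d)) (μ : ℕ → Measure Obs)
    (θ₀ : Param d) : Prop :=
  ∀ n, (∃ ν : Measure (ℝ × ℝ), IsProbabilityMeasure ν ∧ μ n = modelLaw f θ₀ ν) ∨
    IsMaxOn (fun θ => ∫ x, logLik f x θ ∂(μ n)) Θ θ₀

/-- With probability tending to one, `θhat n` is the unique maximizer over `Θ` of the full-data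
log-likelihood. -/
def IsUniqueMLE {Ω : Type*} [MeasurableSpace Ω] {d : ℕ} (P : Measure Ω) (f : Param d → ℝ → ℝ)
    (Θ : Set (Param d)) (X : ℕ → ℕ → Ω → Obs) (θhat : ℕ → Ω → Param d) : Prop :=
  Tendsto (fun n => P {ω | ¬ (θhat n ω ∈ Θ ∧ ∀ θ ∈ Θ, θ ≠ θhat n ω →
      fullLogLik f (dataVec n fun i => X n i ω) θ
        < fullLogLik f (dataVec n fun i => X n i ω) (θhat n ω))}) atTop (𝓝 0)

/-- `Θ` is compact (and convex), and the log-likelihood has finite second moments on `Θ`. -/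
structure LikelihoodAssumption {d : ℕ} (f : Param d → ℝ → ℝ) (Θ : Set (Param d))
    (μ : ℕ → Measure Obs) : Prop where
  compact : IsCompact Θ
  convex : Convex ℝ Θ
  moment : ∀ θ ∈ Θ, BddSecondMoment μ fun x => logLik f x θ

/-- The expected negative Hessian is positive definite, its entries have finite second moments, and
they are Lipschitz on `Θ` with a square-integrable constant. -/
structure HessianAssumption {d : ℕ} (f : Param d → ℝ → ℝ) (Θ : Set (Param d))
    (μ : ℕ → Measure Obs) : Prop where
  posDef : ∀ θ ∈ Θ, UnifPosDef fun n => -meanHess f (μ n) θ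
  moment : ∀ θ ∈ Θ, ∀ j k, BddSecondMoment μ fun x => hess f x θ j k
  lipschitz : ∃ ψ : Obs → ℝ, BddSecondMoment μ ψ ∧
    ∀ n, ∀ᵐ x ∂(μ n), ∀ θ₁ ∈ Θ, ∀ θ₂ ∈ Θ, ∀ j k,
      |hess f x θ₁ j k - hess f x θ₂ j k| ≤ ψ x * ‖θ₁ - θ₂‖

open Classical in
/-- The expected squared score `Λ(θ₀)` is positive definite, the squared score is uniformly
integrable along `μ n` (nothing more than integrability for a constant sequence), and the empirical
fourth moments of the score at the points within `δ` of the maximum likelihood estimator are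
`O_p(1)`. -/
structure ScoreAssumption {Ω : Type*} [MeasurableSpace Ω] {d : ℕ} (P : Measure Ω)
    (f : Param d → ℝ → ℝ) (Θ : Set (Param d)) (μ : ℕ → Measure Obs) (θ₀ : Param d)
    (X : ℕ → ℕ → Ω → Obs) (θhat : ℕ → Ω → Param d) : Prop where
  posDef : UnifPosDef fun n => meanSqScore f (μ n) θ₀
  unifIntegrable : ∀ ε : ℝ, 0 < ε → ∃ B : ℝ, ∀ n,
    ∫⁻ x in {x | B < ‖score f x θ₀‖}, ENNReal.ofReal (‖score f x θ₀‖ ^ 2) ∂(μ n)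
      ≤ ENNReal.ofReal ε
  fourthMoment : ∃ δ : ℝ, 0 < δ ∧ ∀ θ ∈ Θ, BoundedInProb P fun n ω =>
    if ‖θ - θhat n ω‖ < δ
      then (1 / (n : ℝ)) * ∑ i ∈ Finset.range n, ‖score f (X n i ω) θ‖ ^ 4 else 0

/-- The maximum of `(n π_i)⁻¹` over the censored individuals is `O_p(1)`. -/
def WeightAssumption {Ω : Type*} [MeasurableSpace Ω] (P : Measure Ω)
    (X : ℕ → ℕ → Ω → Obs) (π : (n : ℕ) → (Fin n → Obs) → ℕ → ℝ) : Prop :=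
  BoundedInProb P fun n ω =>
    ⨆ i : {i : Fin n // (X n i ω).2.1 = true},
      ((n : ℝ) * π n (dataVec n fun i => X n i ω) i.1)⁻¹

/-- The asymptotic covariance `M⁻¹ (Λ₁ + γ Λ) M⁻¹`. -/
def asympCov {d : ℕ} (M Λ₁ Λ : Matrix (Fin d) (Fin d) ℝ) (γ : ℝ) : Matrix (Fin d) (Fin d) ℝ :=
  M⁻¹ * (Λ₁ + γ • Λ) * M⁻¹

/-- `V^{-1/2} v` for a positive definite matrix `V`. -/
def invSqrtMul {d : ℕ} (V : Matrix (Fin d) (Fin d) ℝ) (v : Param d) : Param d :=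
  Matrix.toEuclideanCLM (𝕜 := ℝ) (CFC.sqrt V)⁻¹ v

end CensSub

end

namespace CensSub

/-! ### Characteristic functions of sums of independent variables -/

/-! Draws are weighted by inverse drawing probabilities. Hence the weighted average `subMean` of a
function g is its full-data average plus a fluctuation `drawErr` that is centred given the data
(`subMean_eq`). With m = r - n₀ draws the fluctuation is a mean of m conditionally independent terms
of variance `condVar`; for g = ⟨u, score⟩ this variance is the quadratic form of Λ_c at u. As r/n →
γ, √r times the full-data average is nearly normal with variance γ E g²; as m/r → 1, √r times the
fluctuation is, given the data, nearly normal with variance ⟨u, Λ₁ u⟩. The conditional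
characteristic function is asymptotically a constant, so it factors out of the joint one and the two
variances add (`tendsto_charFun_sub_mul`, `tendsto_charFun`). The Lindeberg condition for the draws
follows from the one for the scores because the weights 1/(nπ) are O_p(1).

The estimator is reached through concavity. The mean Hessian is negative definite at each θ,
uniformly in n, the Hessian is Lipschitz and Θ is compact; so, with probability tending to one, the
subsample log-likelihood is strongly concave on all of Θ (`exists_whp_concave`). Its maximizer is
then within ‖subsample score‖/c = O_p(r^{-1/2}) of θ₀, which gives consistency and rate at once, and
a Taylor expansion makes the estimator linear in the score (`whp_norm_subScore_add_le`). The score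
at θ₀ has mean zero because θ₀ maximizes the expected log-likelihood. For data from the model this
is Gibbs' inequality: given the censoring and truncation times, the likelihood ratio has mean at
most one (`isMaxOn_of_modelLaw`).

Positive definiteness of Λ₁ is derived. Failures are asymptotically negligible, and Cauchy–Schwarz
under the drawing probabilities gives `condVar` ≥ (mean of |g|)² - (mean of g)² over the censored
individuals, where the second mean tends to zero and the first stays away from it
(`inner_limit_pos`).

The law of an individual may change with n, so the covariance V need not converge. For a fixed
argument t the directions u n = -M⁻¹V^{-1/2}t are used: the variance of ⟨u n, ·⟩ is exactly ‖t‖² for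
every n, and the u n are bounded because Λ₁ is positive definite. All limit theorems are therefore
stated for arrays, as differences tending to zero, and Lévy's theorem concludes. -/

lemma norm_exp_I_sub_taylor_le (y : ℝ) :
    ‖Complex.exp (y * Complex.I) - (1 + y * Complex.I - y ^ 2 / 2)‖ ≤ 4 * (y ^ 2 * min 1 |y|) := by
  rcases le_total |y| 1 with h | h
  · have hn : ‖(y * Complex.I : ℂ)‖ = |y| := by simp
    have := Complex.exp_bound (x := (y * Complex.I : ℂ)) (by rw [hn]; exact h) (n := 3) (by norm_num)
    rw [hn] at this
    have e : ∑ m ∈ Finset.range 3, (y * Complex.I : ℂ) ^ m / (m.factorial : ℂ)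
        = 1 + y * Complex.I - y ^ 2 / 2 := by
      simp [Finset.sum_range_succ, Nat.factorial, mul_pow]; ring
    rw [e] at this
    refine this.trans ?_
    have e3 : |y| ^ 3 = y ^ 2 * |y| := by rw [pow_succ, sq_abs]
    rw [min_eq_right h, e3]
    norm_num [Nat.factorial]
    nlinarith [mul_nonneg (sq_nonneg y) (abs_nonneg y)]
  -- Beyond |y| = 1 no cancellation is needed: 2 + |y| + y²/2 ≤ 4y².
  · rw [min_eq_left h]
    have h1 : ‖Complex.exp (y * Complex.I)‖ = 1 := Complex.norm_exp_ofReal_mul_I y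
    have h2 : ‖(1 + y * Complex.I - y ^ 2 / 2 : ℂ)‖ ≤ 1 + |y| + y ^ 2 / 2 := by
      refine (norm_sub_le _ _).trans (add_le_add ((norm_add_le _ _).trans ?_) ?_)
      · simp
      · simp
    refine (norm_sub_le _ _).trans ?_
    rw [h1]
    have := sq_abs y
    nlinarith

lemma norm_exp_I_sub_exp_I_le (a b : ℝ) :
    ‖Complex.exp (a * Complex.I) - Complex.exp (b * Complex.I)‖ ≤ |a - b| := by
  have e : Complex.exp (a * Complex.I) - Complex.exp (b * Complex.I)
      = Complex.exp (b * Complex.I) * (Complex.exp (Complex.I * ((a - b : ℝ) : ℂ)) - 1) := by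
    rw [mul_sub, ← Complex.exp_add]; push_cast; ring_nf
  rw [e, norm_mul, Complex.norm_exp_ofReal_mul_I, one_mul]
  simpa using Real.norm_exp_I_mul_ofReal_sub_one_le (x := a - b)

/-- The usual telescoping for characteristic functions: an error per factor is multiplied only by
the number of factors. -/
lemma norm_pow_sub_pow_le {a b : ℂ} (ha : ‖a‖ ≤ 1) (hb : ‖b‖ ≤ 1) (m : ℕ) :
    ‖a ^ m - b ^ m‖ ≤ m * ‖a - b‖ := by
  induction m with
  | zero => simp
  | succ m ih =>
    have e : a ^ (m + 1) - b ^ (m + 1) = a ^ m * (a - b) + (a ^ m - b ^ m) * b := by ring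
    rw [e]
    refine (norm_add_le _ _).trans ?_
    rw [norm_mul, norm_mul, norm_pow]
    have h1 : ‖a‖ ^ m ≤ 1 := pow_le_one₀ (norm_nonneg _) ha
    have h2 : ‖a ^ m - b ^ m‖ * ‖b‖ ≤ ‖a ^ m - b ^ m‖ := mul_le_of_le_one_right (norm_nonneg _) hb
    have h3 : ‖a‖ ^ m * ‖a - b‖ ≤ ‖a - b‖ := mul_le_of_le_one_left (norm_nonneg _) h1
    push_cast
    linarith

lemma abs_exp_neg_sub_le {x y : ℝ} (hx : 0 ≤ x) (hy : 0 ≤ y) :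
    |Real.exp (-x) - Real.exp (-y)| ≤ |x - y| := by
  wlog h : x ≤ y generalizing x y
  · rw [abs_sub_comm, abs_sub_comm x]; exact this hy hx (le_of_not_ge h)
  have h1 : Real.exp (-y) ≤ Real.exp (-x) := Real.exp_le_exp.2 (by linarith)
  rw [abs_of_nonneg (by linarith), abs_of_nonpos (by linarith)]
  have h2 : Real.exp (-y) = Real.exp (-x) * Real.exp (-(y - x)) := by
    rw [← Real.exp_add]; ring_nf
  have h3 : 1 - (y - x) ≤ Real.exp (-(y - x)) := by
    have := Real.add_one_le_exp (-(y - x)); linarith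
  have h4 : Real.exp (-x) ≤ 1 := Real.exp_le_one_iff.2 (by linarith)
  rw [h2]
  nlinarith [Real.exp_pos (-x)]

lemma abs_exp_neg_sub_one_add_le {x : ℝ} (hx : 0 ≤ x) : |Real.exp (-x) - (1 - x)| ≤ x ^ 2 := by
  rcases le_total x 1 with h | h
  · have := Real.abs_exp_sub_one_sub_id_le (x := -x) (by rw [abs_neg, abs_of_nonneg hx]; exact h)
    rw [show Real.exp (-x) - (1 - x) = Real.exp (-x) - 1 - -x by ring]
    simpa using this
  · have h1 : Real.exp (-x) ≤ 1 := Real.exp_le_one_iff.2 (by linarith)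
    have h2 := Real.exp_pos (-x)
    rw [abs_of_nonneg (by linarith)]
    nlinarith

/-- The characteristic function of a centred variable to second order, with a Lindeberg-type
remainder. -/
lemma norm_integral_exp_sub_le {α : Type*} [MeasurableSpace α] (ν : Measure α)
    [IsProbabilityMeasure ν] {Y : α → ℝ} (hY : MemLp Y 2 ν) (h0 : ∫ a, Y a ∂ν = 0)
    {s : ℝ} (hs : 0 ≤ s) :
    ‖(∫ a, Complex.exp ((s * Y a : ℝ) * Complex.I) ∂ν)
        - ((1 - s ^ 2 * (∫ a, Y a ^ 2 ∂ν) / 2 : ℝ) : ℂ)‖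
      ≤ 4 * (s ^ 2 * ∫ a, Y a ^ 2 * min 1 (s * |Y a|) ∂ν) := by
  have hY1 : Integrable Y ν := hY.integrable (by norm_num)
  have hY2 : Integrable (fun a => Y a ^ 2) ν := hY.integrable_sq
  have hm : AEStronglyMeasurable Y ν := hY.aestronglyMeasurable
  have hE : Integrable (fun a => Complex.exp ((s * Y a : ℝ) * Complex.I)) ν := by
    refine Integrable.of_bound (C := 1) ?_ (ae_of_all _ fun a => ?_)
    · exact (Complex.continuous_exp.comp
        ((Complex.continuous_ofReal.comp (continuous_const.mul continuous_id)).mul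
          continuous_const) : Continuous fun y : ℝ =>
          Complex.exp ((s * y : ℝ) * Complex.I)).comp_aestronglyMeasurable hm
    · rw [Complex.norm_exp_ofReal_mul_I]
  have hR : Integrable (fun a => Y a ^ 2 * min 1 (s * |Y a|)) ν := by
    refine hY2.mono' ?_ (ae_of_all _ fun a => ?_)
    · exact ((by fun_prop : Continuous fun y : ℝ => y ^ 2 * min 1 (s * |y|))).comp_aestronglyMeasurable
        hm
    · rw [Real.norm_of_nonneg (by positivity)]
      exact mul_le_of_le_one_right (sq_nonneg _) (min_le_left _ _)
  have hT : Integrable (fun a => (1 + ((s * Y a : ℝ) : ℂ) * Complex.I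
      - ((s * Y a : ℝ) : ℂ) ^ 2 / 2)) ν := by
    refine ((integrable_const _).add ((hY1.const_mul s).ofReal.mul_const _)).sub ?_
    have : Integrable (fun a => ((s ^ 2 * Y a ^ 2 / 2 : ℝ) : ℂ)) ν :=
      ((hY2.const_mul (s ^ 2)).div_const 2).ofReal
    refine this.congr (ae_of_all _ fun a => ?_)
    push_cast; ring
  have hTi : ∫ a, (1 + ((s * Y a : ℝ) : ℂ) * Complex.I - ((s * Y a : ℝ) : ℂ) ^ 2 / 2) ∂ν
      = ((1 - s ^ 2 * (∫ a, Y a ^ 2 ∂ν) / 2 : ℝ) : ℂ) := by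
    have e : (fun a => (1 + ((s * Y a : ℝ) : ℂ) * Complex.I - ((s * Y a : ℝ) : ℂ) ^ 2 / 2))
        = fun a => (((1 - s ^ 2 / 2 * Y a ^ 2 : ℝ) : ℂ) + ((s * Y a : ℝ) : ℂ) * Complex.I) := by
      funext a; push_cast; ring
    rw [e, integral_add (Integrable.ofReal ((integrable_const _).sub (hY2.const_mul _)))
      ((hY1.const_mul s).ofReal.mul_const _), integral_mul_const, integral_complex_ofReal, integral_complex_ofReal,
      integral_sub (integrable_const _) (hY2.const_mul _), integral_const_mul, integral_const_mul,
      h0]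
    simp
    ring
  rw [← hTi, ← integral_sub hE hT, ← integral_const_mul, ← integral_const_mul]
  refine norm_integral_le_of_norm_le ((hR.const_mul _).const_mul _) (ae_of_all _ fun a => ?_)
  refine (norm_exp_I_sub_taylor_le (s * Y a)).trans (le_of_eq ?_)
  rw [abs_mul, abs_of_nonneg hs]; ring

/-- Two errors per factor, Taylor expansion and 1 - x against e^{-x}, each taken m times. The bound
is explicit rather than asymptotic, because it serves both for the law `μ n` and for the random
conditional law of a draw. -/
lemma norm_integral_exp_pow_sub_le {α : Type*} [MeasurableSpace α] (ν : Measure α)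
    [IsProbabilityMeasure ν] {Y : α → ℝ} (hY : MemLp Y 2 ν) (h0 : ∫ a, Y a ∂ν = 0)
    {s : ℝ} (hs : 0 ≤ s) (m : ℕ) :
    ‖(∫ a, Complex.exp ((s * Y a : ℝ) * Complex.I) ∂ν) ^ m
        - (Real.exp (-(m * s ^ 2 * (∫ a, Y a ^ 2 ∂ν) / 2)) : ℂ)‖
      ≤ 4 * (m * s ^ 2 * ∫ a, Y a ^ 2 * min 1 (s * |Y a|) ∂ν)
        + m * (s ^ 2 * ∫ a, Y a ^ 2 ∂ν) ^ 2 := by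
  set σ := ∫ a, Y a ^ 2 ∂ν
  have hσ : 0 ≤ σ := integral_nonneg fun a => sq_nonneg _
  have h1 := norm_integral_exp_sub_le ν hY h0 hs
  have e : (Real.exp (-(m * s ^ 2 * σ / 2)) : ℂ) = ((Real.exp (-(s ^ 2 * σ / 2)) : ℝ) : ℂ) ^ m := by
    rw [← Complex.ofReal_pow, ← Real.exp_nat_mul]; congr 2; ring
  have h2 : ‖((1 - s ^ 2 * σ / 2 : ℝ) : ℂ) - ((Real.exp (-(s ^ 2 * σ / 2)) : ℝ) : ℂ)‖
      ≤ (s ^ 2 * σ / 2) ^ 2 := by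
    rw [← Complex.ofReal_sub, Complex.norm_real, Real.norm_eq_abs, abs_sub_comm]
    exact abs_exp_neg_sub_one_add_le (by positivity)
  have ha : ‖∫ a, Complex.exp ((s * Y a : ℝ) * Complex.I) ∂ν‖ ≤ 1 := by
    refine (norm_integral_le_of_norm_le_const (C := 1) (ae_of_all _ fun a => ?_)).trans (by simp)
    rw [Complex.norm_exp_ofReal_mul_I]
  have hb : ‖((Real.exp (-(s ^ 2 * σ / 2)) : ℝ) : ℂ)‖ ≤ 1 := by
    rw [Complex.norm_real, Real.norm_of_nonneg (Real.exp_pos _).le, Real.exp_le_one_iff]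
    have : 0 ≤ s ^ 2 * σ := by positivity
    linarith
  rw [e]
  refine (norm_pow_sub_pow_le ha hb m).trans ?_
  have h3 := (norm_sub_le_norm_sub_add_norm_sub _ _ _).trans (add_le_add h1 h2)
  refine (mul_le_mul_of_nonneg_left h3 (Nat.cast_nonneg m)).trans ?_
  have : (0 : ℝ) ≤ m * (s ^ 2 * σ) ^ 2 := by positivity
  nlinarith

/-! ### Events of probability tending to one -/

/-- `p n` holds with probability tending to one. -/
def Whp {Ω : Type*} [MeasurableSpace Ω] (P : Measure Ω) (p : ℕ → Ω → Prop) : Prop :=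
  Tendsto (fun n => P {ω | ¬ p n ω}) atTop (𝓝 0)

section Whp

variable {Ω : Type*} [MeasurableSpace Ω] {P : Measure Ω} {p q : ℕ → Ω → Prop}

lemma Whp.of_le {u : ℕ → ℝ≥0∞} (hu : Tendsto u atTop (𝓝 0))
    (h : ∀ᶠ n in atTop, P {ω | ¬ p n ω} ≤ u n) : Whp P p :=
  tendsto_of_tendsto_of_tendsto_of_le_of_le' tendsto_const_nhds hu
    (Eventually.of_forall fun _ => zero_le) h

lemma Whp.mono_ae (hp : Whp P p) (h : ∀ᶠ n in atTop, ∀ᵐ ω ∂P, p n ω → q n ω) : Whp P q := by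
  refine Whp.of_le hp (h.mono fun n hn => measure_mono_ae ?_)
  filter_upwards [hn] with ω hω hq hp' using hq (hω hp')

lemma Whp.mono_eventually (hp : Whp P p) (h : ∀ᶠ n in atTop, ∀ ω, p n ω → q n ω) : Whp P q :=
  hp.mono_ae (h.mono fun _ hn => ae_of_all _ hn)

lemma Whp.mono (hp : Whp P p) (h : ∀ n ω, p n ω → q n ω) : Whp P q :=
  hp.mono_eventually (Eventually.of_forall h)

lemma Whp.of_ae (h : ∀ᶠ n in atTop, ∀ᵐ ω ∂P, p n ω) : Whp P p := by
  have : Whp P (fun (_ : ℕ) (_ : Ω) => True) := by simp [Whp]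
  exact this.mono_ae (h.mono fun n hn => hn.mono fun ω hω _ => hω)

lemma Whp.of_forall (h : ∀ᶠ n in atTop, ∀ ω, p n ω) : Whp P p :=
  Whp.of_ae (h.mono fun _ hn => ae_of_all _ hn)

lemma Whp.and (hp : Whp P p) (hq : Whp P q) : Whp P fun n ω => p n ω ∧ q n ω := by
  have h := hp.add hq
  rw [add_zero] at h
  refine Whp.of_le h (Eventually.of_forall fun n => (measure_mono ?_).trans (measure_union_le _ _))
  intro ω hω
  by_contra hc
  exact hω (by simpa [not_or] using hc)

lemma Whp.finset_forall {ι : Type*} (s : Finset ι) {p : ι → ℕ → Ω → Prop}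
    (h : ∀ i ∈ s, Whp P (p i)) : Whp P fun n ω => ∀ i ∈ s, p i n ω := by
  classical
  induction s using Finset.induction_on with
  | empty => exact Whp.of_forall (by simp)
  | insert a s _ ih =>
    refine ((h a (Finset.mem_insert_self _ _)).and
      (ih fun i hi => h i (Finset.mem_insert_of_mem hi))).mono fun n ω hω i hi => ?_
    rcases Finset.mem_insert.1 hi with rfl | hi
    exacts [hω.1, hω.2 i hi]

lemma Whp.forall {ι : Type*} [Fintype ι] {p : ι → ℕ → Ω → Prop}
    (h : ∀ i, Whp P (p i)) : Whp P fun n ω => ∀ i, p i n ω :=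
  (Whp.finset_forall Finset.univ fun i _ => h i).mono fun _ _ hω i => hω i (Finset.mem_univ i)

lemma whp_iff_forall_eps :
    Whp P p ↔ ∀ ε : ℝ, 0 < ε → ∀ᶠ n in atTop, P {ω | ¬ p n ω} ≤ ENNReal.ofReal ε := by
  constructor
  · intro h ε hε
    exact (ENNReal.tendsto_nhds_zero.1 h) _ (by simpa using hε)
  · intro h
    refine ENNReal.tendsto_nhds_zero.2 fun ε hε => ?_
    by_cases ht : ε = ∞
    · exact Eventually.of_forall fun n => by simp [ht]
    · filter_upwards [h ε.toReal (ENNReal.toReal_pos hε.ne' ht)] with n hn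
      rwa [ENNReal.ofReal_toReal ht] at hn

/-- A conclusion that does not involve ω may be proved at a single sample point; facts on Λ₁ and on
the failure probability are obtained this way. -/
lemma Whp.frequently [IsProbabilityMeasure P] (hp : Whp P p) : ∀ᶠ n in atTop, ∃ ω, p n ω := by
  filter_upwards [whp_iff_forall_eps.1 hp (1 / 2) (by norm_num)] with n hn
  by_contra hc
  push Not at hc
  have : {ω | ¬ p n ω} = Set.univ := Set.eq_univ_of_forall hc
  rw [this, measure_univ, ENNReal.one_le_ofReal] at hn
  norm_num at hn

/-- Permits treating an O_p(1) sequence as bounded by a fixed, though arbitrary, constant. -/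
lemma BoundedInProb.whp {Z : ℕ → Ω → ℝ} (hZ : BoundedInProb P Z)
    (h : ∀ M : ℝ, 0 < M → Whp P fun n ω => |Z n ω| ≤ M → p n ω) : Whp P p := by
  refine whp_iff_forall_eps.2 fun ε hε => ?_
  obtain ⟨M, hM⟩ := hZ (ε / 2) (by linarith)
  filter_upwards [hM, whp_iff_forall_eps.1 (h (max M 1) (by positivity)) (ε / 2) (by linarith)]
    with n h1 h2
  rw [show ε = ε / 2 + ε / 2 by ring, ENNReal.ofReal_add (by linarith) (by linarith)]
  refine (measure_mono ?_).trans ((measure_union_le _ _).trans (add_le_add h1 h2))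
  intro ω hω
  by_contra hc
  simp only [Set.mem_union, Set.mem_ofPred_eq, not_or, not_lt, not_not] at hc
  exact hω (hc.2 (hc.1.trans (le_max_left _ _)))

lemma BoundedInProb.whp_mul_le {Z : ℕ → Ω → ℝ} (hZ : BoundedInProb P Z) {a : ℕ → ℝ}
    (ha : Tendsto a atTop (𝓝 0)) {ε : ℝ} (hε : 0 < ε) :
    Whp P fun n ω => |a n * Z n ω| ≤ ε := by
  refine hZ.whp fun M hM => Whp.of_forall ?_
  have h : Tendsto (fun n => |a n| * M) atTop (𝓝 0) := by
    simpa using (ha.abs.mul_const M)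
  filter_upwards [h.eventually_le_const hε] with n hn ω hω
  rw [abs_mul]
  exact (mul_le_mul_of_nonneg_left hω (abs_nonneg _)).trans hn

lemma _root_.MeasureTheory.TendstoInMeasure.whp {Z : ℕ → Ω → ℝ} {c : ℝ}
    (h : TendstoInMeasure P Z atTop fun _ => c) {ε : ℝ} (hε : 0 < ε) :
    Whp P fun n ω => |Z n ω - c| ≤ ε := by
  rw [tendstoInMeasure_iff_norm] at h
  refine Whp.of_le (h ε hε) (Eventually.of_forall fun n => measure_mono fun ω hω => ?_)
  simp only [Set.mem_ofPred_eq, not_le] at hω ⊢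
  exact hω.le

/-- Markov's inequality for a nonnegative real function. -/
lemma measure_lt_le_of_lintegral_le {Z : Ω → ℝ} (hZ : AEMeasurable Z P) {C c : ℝ}
    (hc : 0 < c) (h : ∫⁻ ω, ENNReal.ofReal (Z ω) ∂P ≤ ENNReal.ofReal C) :
    P {ω | c < Z ω} ≤ ENNReal.ofReal (C / c) := by
  have h1 : P {ω | c < Z ω} ≤ P {ω | ENNReal.ofReal c ≤ ENNReal.ofReal (Z ω)} :=
    measure_mono fun ω hω => ENNReal.ofReal_le_ofReal (le_of_lt hω)
  refine h1.trans ((meas_ge_le_lintegral_div hZ.ennreal_ofReal (by simpa using hc)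
    ENNReal.ofReal_ne_top).trans ?_)
  rw [ENNReal.ofReal_div_of_pos hc]
  gcongr

lemma boundedInProb_of_lintegral_sq_le {Z : ℕ → Ω → ℝ} (hZ : ∀ n, AEMeasurable (Z n) P) {C : ℝ}
    (h : ∀ᶠ n in atTop, ∫⁻ ω, ENNReal.ofReal (Z n ω ^ 2) ∂P ≤ ENNReal.ofReal C) :
    BoundedInProb P Z := by
  intro ε hε
  have hC : 0 ≤ max C 0 := le_max_right _ _
  refine ⟨√((max C 0 + 1) / ε), h.mono fun n hn => ?_⟩
  have hpos : 0 < (max C 0 + 1) / ε := by positivity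
  have h1 : {ω | √((max C 0 + 1) / ε) < |Z n ω|} ⊆ {ω | (max C 0 + 1) / ε < Z n ω ^ 2} := by
    intro ω hω
    have := Real.lt_sq_of_sqrt_lt hω
    rwa [sq_abs] at this
  refine (measure_mono h1).trans ((measure_lt_le_of_lintegral_le ((hZ n).pow_const 2) hpos
    (hn.trans (ENNReal.ofReal_le_ofReal (le_max_left C 0)))).trans (ENNReal.ofReal_le_ofReal ?_))
  rw [div_div_eq_mul_div, div_le_iff₀ (by positivity)]
  nlinarith

end Whp

/-! ### Row averages of independent data -/

/-- The average of `g` over the first `n` entries. -/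
noncomputable def fullMean (g : Obs → ℝ) (n : ℕ) (x : ℕ → Obs) : ℝ :=
  (1 / (n : ℝ)) * ∑ i ∈ Finset.range n, g (x i)

section IID

variable {Ω : Type*} [MeasurableSpace Ω] {P : Measure Ω} {μ : ℕ → Measure Obs} {X : ℕ → ℕ → Ω → Obs}

lemma measurable_fullMean {g : Obs → ℝ} (hg : Measurable g) (hX : IsIIDData P μ X) (n : ℕ) :
    Measurable fun ω => fullMean g n fun i => X n i ω :=
  (Finset.measurable_sum _ fun i _ => hg.comp (hX.measurable n i)).const_mul _

lemma IsIIDData.ae_forall (hX : IsIIDData P μ X) {n : ℕ} {p : Obs → Prop}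
    (hp : ∀ᵐ x ∂(μ n), p x) : ∀ᵐ ω ∂P, ∀ i < n, p (X n i ω) := by
  have : ∀ i : Fin n, ∀ᵐ ω ∂P, p (X n i ω) := fun i =>
    ae_of_ae_map (hX.measurable n i).aemeasurable (by rwa [hX.law n i i.2])
  filter_upwards [ae_all_iff.2 this] with ω hω i hi using hω ⟨i, hi⟩

lemma IsIIDData.integral_exp_sum (hX : IsIIDData P μ X) (n : ℕ) {g : Obs → ℝ} (hg : Measurable g)
    (t : ℝ) :
    ∫ ω, Complex.exp ((t * ∑ i ∈ Finset.range n, g (X n i ω) : ℝ) * Complex.I) ∂P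
      = (∫ x, Complex.exp ((t * g x : ℝ) * Complex.I) ∂(μ n)) ^ n := by
  have hm : ∀ i : Fin n, Measurable fun ω => g (X n i ω) := fun i =>
    hg.comp (hX.measurable n i)
  have hI : iIndepFun (fun (i : Fin n) ω => g (X n i ω)) P :=
    (hX.indep n).comp (fun _ => g) fun _ => hg
  have h := congrFun (hI.charFun_map_fun_sum_eq_prod fun i => (hm i).aemeasurable) t
  have hc : Continuous fun y : ℝ => Complex.exp (t * y * Complex.I) := by fun_prop
  rw [charFun_apply_real, integral_map (Finset.measurable_sum _ fun i _ => hm i).aemeasurable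
    hc.aestronglyMeasurable, Finset.prod_apply] at h
  have h2 : ∀ i : Fin n, charFun (P.map fun ω => g (X n i ω)) t
      = ∫ x, Complex.exp ((t * g x : ℝ) * Complex.I) ∂(μ n) := by
    intro i
    rw [← hX.law n i i.2, integral_map (hX.measurable n i).aemeasurable, charFun_apply_real,
      integral_map (hm i).aemeasurable hc.aestronglyMeasurable]
    · simp
    · have : Measurable fun x => Complex.exp ((t * g x : ℝ) * Complex.I) := by fun_prop
      exact this.aestronglyMeasurable
  rw [Finset.prod_congr rfl fun i _ => h2 i, Finset.prod_const, Finset.card_univ,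
    Fintype.card_fin] at h
  rw [← h]
  refine integral_congr_ae (ae_of_all _ fun ω => ?_)
  simp [Finset.sum_range]

lemma IsIIDData.lintegral_comp (hX : IsIIDData P μ X) {n i : ℕ} (hi : i < n) {h : Obs → ℝ≥0∞}
    (hh : Measurable h) : ∫⁻ ω, h (X n i ω) ∂P = ∫⁻ x, h x ∂(μ n) := by
  rw [← hX.law n i hi, lintegral_map hh (hX.measurable n i)]

lemma IsIIDData.lintegral_fullMean_le (hX : IsIIDData P μ X) (n : ℕ) {h : Obs → ℝ}
    (hh : Measurable h) (h0 : ∀ x, 0 ≤ h x) :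
    ∫⁻ ω, ENNReal.ofReal (fullMean h n fun i => X n i ω) ∂P
      ≤ ∫⁻ x, ENNReal.ofReal (h x) ∂(μ n) := by
  -- For n = 0 the average is 0; this is the only reason for an inequality instead of an equality.
  rcases Nat.eq_zero_or_pos n with rfl | hn
  · simp [fullMean]
  have hn' : (0 : ℝ) < n := by exact_mod_cast hn
  have e : ∀ ω, ENNReal.ofReal (fullMean h n fun i => X n i ω)
      = ENNReal.ofReal (1 / n) * ∑ i ∈ Finset.range n, ENNReal.ofReal (h (X n i ω)) := by
    intro ω
    rw [fullMean, ENNReal.ofReal_mul (by positivity), ENNReal.ofReal_sum_of_nonneg fun i _ => h0 _]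
  have hm : ∀ i, Measurable fun ω => ENNReal.ofReal (h (X n i ω)) := fun i =>
    (hh.comp (hX.measurable n i)).ennreal_ofReal
  simp_rw [e]
  rw [lintegral_const_mul _ (Finset.measurable_sum _ fun i _ => hm i),
    lintegral_finsetSum _ fun i _ => hm i,
    Finset.sum_congr rfl fun i hi => hX.lintegral_comp (Finset.mem_range.1 hi) hh.ennreal_ofReal,
    Finset.sum_const, Finset.card_range, nsmul_eq_mul, ← mul_assoc, ← ENNReal.ofReal_natCast,
    ← ENNReal.ofReal_mul (by positivity), one_div, inv_mul_cancel₀ hn'.ne', ENNReal.ofReal_one,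
    one_mul]

lemma IsIIDData.lintegral_sq_fullMean_sub_le [IsProbabilityMeasure P] (hX : IsIIDData P μ X)
    [∀ n, IsProbabilityMeasure (μ n)] {n : ℕ} (hn : 0 < n)
    {g : Obs → ℝ} (hg : Measurable g) (hg2 : MemLp g 2 (μ n)) :
    ∫⁻ ω, ENNReal.ofReal ((fullMean g n (fun i => X n i ω) - ∫ x, g x ∂(μ n)) ^ 2) ∂P
      ≤ ENNReal.ofReal ((∫ x, g x ^ 2 ∂(μ n)) / n) := by
  have hn' : (0 : ℝ) < n := by exact_mod_cast hn
  have hL : ∀ i : Fin n, MemLp (fun ω => g (X n i ω)) 2 P := fun i => by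
    have := hg2
    rw [← hX.law n i i.2] at this
    exact this.comp_of_map (hX.measurable n i).aemeasurable
  have hI : iIndepFun (fun (i : Fin n) ω => g (X n i ω)) P :=
    (hX.indep n).comp (fun _ => g) fun _ => hg
  have hmean : ∀ i : Fin n, ∫ ω, g (X n i ω) ∂P = ∫ x, g x ∂(μ n) := fun i => by
    rw [← hX.law n i i.2, integral_map (hX.measurable n i).aemeasurable hg.aestronglyMeasurable]
  have hvar : ∀ i : Fin n, Var[fun ω => g (X n i ω); P] = Var[g; μ n] := fun i => by
    rw [← hX.law n i i.2, variance_map hg.aemeasurable (hX.measurable n i).aemeasurable]; rfl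
  set Z : Ω → ℝ := fun ω => ∑ i : Fin n, g (X n i ω) with hZ
  have hZL : MemLp Z 2 P := memLp_finsetSum _ fun i _ => hL i
  have hS : Var[Z; P] = n * Var[g; μ n] := by
    have := IndepFun.variance_sum (X := fun (i : Fin n) ω => g (X n i ω)) (s := Finset.univ)
      (fun i _ => hL i) (fun i _ j _ hij => hI.indepFun hij)
    rw [Finset.sum_congr rfl fun i _ => hvar i] at this
    simp only [Finset.sum_const, Finset.card_univ, Fintype.card_fin, nsmul_eq_mul] at this
    rw [← this]; congr 1; ext ω; simp [hZ]
  have hE : ∫ ω, (1 / (n : ℝ)) * Z ω ∂P = ∫ x, g x ∂(μ n) := by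
    rw [integral_const_mul, integral_finsetSum _ fun i _ => (hL i).integrable (by norm_num),
      Finset.sum_congr rfl fun i _ => hmean i]
    simp; field_simp
  have hV : Var[fun ω => (1 / (n : ℝ)) * Z ω; P] = Var[g; μ n] / n := by
    rw [variance_const_mul, hS]; field_simp
  have hL' : MemLp (fun ω => (1 / (n : ℝ)) * Z ω) 2 P := hZL.const_mul _
  have h1 := ofReal_variance hL'
  rw [hV, evariance_eq_lintegral_ofReal, hE] at h1
  have h2 : ∀ ω, fullMean g n (fun i => X n i ω) = (1 / (n : ℝ)) * Z ω := fun ω => by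
    simp [fullMean, hZ, Finset.sum_range]
  simp_rw [h2]
  rw [← h1]
  refine ENNReal.ofReal_le_ofReal (div_le_div_of_nonneg_right ?_ hn'.le)
  exact variance_le_expectation_sq hg.aestronglyMeasurable

end IID

/-! ### The censoring draws -/

/-- Independence of m identical draws, written as a finite sum over all outcomes of the draws. -/
lemma sum_prod_mul_prod {ι R : Type*} [Fintype ι] [CommRing R] (m : ℕ) (w φ : ι → R) :
    ∑ k : Fin m → ι, (∏ j, w (k j)) * ∏ j, φ (k j) = (∑ i, w i * φ i) ^ m := by
  classical
  have := Finset.prod_univ_sum (fun _ : Fin m => (Finset.univ : Finset ι))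
    (fun _ i => w i * φ i)
  simp only [Finset.prod_const, Finset.card_univ, Fintype.card_fin, Fintype.piFinset_univ] at this
  rw [this]
  exact Finset.sum_congr rfl fun k _ => Finset.prod_mul_distrib.symm

/-- Variance of a sum of m independent centred draws: a mixed term contains the factor Σ w y = 0,
and in a diagonal term all other coordinates sum to one. -/
lemma sum_prod_mul_sq {ι : Type*} [Fintype ι] (m : ℕ) {w y : ι → ℝ} (hw : ∑ i, w i = 1)
    (hy : ∑ i, w i * y i = 0) :
    ∑ k : Fin m → ι, (∏ j, w (k j)) * (∑ j, y (k j)) ^ 2 = m * ∑ i, w i * y i ^ 2 := by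
  classical
  have key : ∀ a b : Fin m, ∑ k : Fin m → ι, (∏ j, w (k j)) * (y (k a) * y (k b))
      = if a = b then ∑ i, w i * y i ^ 2 else 0 := by
    intro a b
    have h1 : ∀ k : Fin m → ι, (∏ j, w (k j)) * (y (k a) * y (k b))
        = ∏ j, (w (k j) * ((if j = a then y (k j) else 1) * (if j = b then y (k j) else 1))) := by
      intro k
      rw [Finset.prod_mul_distrib, Finset.prod_mul_distrib]
      simp
    rw [Finset.sum_congr rfl fun k _ => h1 k]
    have := Finset.prod_univ_sum (fun _ : Fin m => (Finset.univ : Finset ι))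
      (fun j i => w i * ((if j = a then y i else 1) * (if j = b then y i else 1)))
    rw [Fintype.piFinset_univ] at this
    rw [← this]
    split_ifs with hab
    · subst hab
      rw [Finset.prod_eq_single a]
      · simp [pow_two]
      · intro j _ hj; simp [hj, hw]
      · simp
    · refine Finset.prod_eq_zero (Finset.mem_univ a) ?_
      simp [hab, hy]
  have h2 : ∀ k : Fin m → ι, (∏ j, w (k j)) * (∑ j, y (k j)) ^ 2
      = ∑ a, ∑ b, (∏ j, w (k j)) * (y (k a) * y (k b)) := by
    intro k
    rw [pow_two, Finset.sum_mul_sum, Finset.mul_sum]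
    exact Finset.sum_congr rfl fun a _ => Finset.mul_sum _ _ _
  rw [Finset.sum_congr rfl fun k _ => h2 k, Finset.sum_comm]
  rw [Finset.sum_congr rfl fun a _ => Finset.sum_comm]
  simp_rw [key]
  simp

/-- The conditional probability of drawing individual `i`. -/
def drawProb {n : ℕ} (π : ℕ → ℝ) (D : Fin n → Obs) (i : Fin n) : ℝ :=
  if (D i).2.1 then π i else 0

/-- A selection of the draws that are individuals of the sample and censored. -/
def ValidDraws (n m : ℕ) (x : ℕ → Obs) (K : ℕ → ℕ) : Prop :=
  ∀ j < m, K j < n ∧ (x (K j)).2.1 = true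

lemma measurable_dataVec {Ω : Type*} [MeasurableSpace Ω] (n : ℕ) {X : ℕ → Ω → Obs}
    (hX : ∀ i, Measurable (X i)) : Measurable fun ω => dataVec n fun i => X i ω :=
  measurable_pi_lambda _ fun i => hX i

lemma measurable_censored {n : ℕ} (i : Fin n) :
    Measurable fun D : Fin n → Obs => (D i).2.1 :=
  measurable_fst.comp (measurable_snd.comp (measurable_pi_apply i))

lemma measurableSet_censored {n : ℕ} (i : Fin n) :
    MeasurableSet {D : Fin n → Obs | (D i).2.1 = true} :=
  measurableSet_eq_fun (measurable_censored i) measurable_const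

lemma measurable_numFail (n : ℕ) : Measurable fun D : Fin n → Obs => numFail D := by
  simp only [numFail, Finset.card_filter]
  refine Finset.measurable_sum _ fun i _ => Measurable.ite ?_ measurable_const measurable_const
  exact measurableSet_eq_fun (measurable_censored i) measurable_const

lemma measurable_drawProb {n : ℕ} {π : (Fin n → Obs) → ℕ → ℝ}
    (hπ : ∀ i, Measurable fun D => π D i) (i : Fin n) :
    Measurable fun D => drawProb (π D) D i :=
  Measurable.ite (measurableSet_censored i) (hπ i) measurable_const

/-- The hypotheses on the draws for one sample size. -/
structure DrawSetup {Ω : Type*} [MeasurableSpace Ω] (P : Measure Ω) (n r : ℕ)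
    (X : ℕ → Ω → Obs) (π : (Fin n → Obs) → ℕ → ℝ) (K : ℕ → Ω → ℕ) : Prop where
  measX : ∀ i, Measurable (X i)
  measπ : ∀ i, Measurable fun D => π D i
  measK : ∀ j, Measurable (K j)
  pos : ∀ (D : Fin n → Obs) (i : Fin n), (D i).2.1 = true → 0 < π D i
  sum_eq_one : ∀ D : Fin n → Obs, (∃ i, (D i).2.1 = true) → ∑ i, drawProb (π D) D i = 1
  draw : IsCensoringDraw P n r X π K

/-! ### Conditional expectations given the data -/

namespace DrawSetup

variable {Ω : Type*} [MeasurableSpace Ω] {P : Measure Ω} {n r : ℕ}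
  {X : ℕ → Ω → Obs} {π : (Fin n → Obs) → ℕ → ℝ} {K : ℕ → Ω → ℕ}

lemma drawProb_nonneg (S : DrawSetup P n r X π K) (D : Fin n → Obs) (i : Fin n) :
    0 ≤ drawProb (π D) D i := by
  unfold drawProb
  split_ifs with h
  exacts [(S.pos D i h).le, le_rfl]

lemma measurableSet_fiber (S : DrawSetup P n r X π K) {m : ℕ} {A : Set (Fin n → Obs)}
    (hA : MeasurableSet A) (k : Fin m → Fin n) :
    MeasurableSet {ω | dataVec n (fun i => X i ω) ∈ A ∧ ∀ j : Fin m, K j ω = k j} := by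
  refine (measurable_dataVec n S.measX hA).inter ?_
  have : {ω | ∀ j : Fin m, K j ω = k j} = ⋂ j : Fin m, K j ⁻¹' {((k j : Fin n) : ℕ)} := by
    ext ω; simp
  show MeasurableSet {ω | ∀ j : Fin m, K j ω = k j}
  rw [this]
  exact MeasurableSet.iInter fun j => S.measK j (measurableSet_singleton _)

lemma measurableSet_data (S : DrawSetup P n r X π K) {A : Set (Fin n → Obs)}
    (hA : MeasurableSet A) : MeasurableSet {ω | dataVec n (fun i => X i ω) ∈ A} :=
  measurable_dataVec n S.measX hA

/-- The draw hypothesis for all data sets B ∩ A determines the law of the data on the event that the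
draws equal k: its density is the probability of k. This is the disintegration behind all later
conditional computations. -/
lemma map_fiber (S : DrawSetup P n r X π K) {m : ℕ} {A : Set (Fin n → Obs)}
    (hA : MeasurableSet A) (hAm : ∀ D ∈ A, (∃ i, (D i).2.1 = true) ∧ r - numFail D = m)
    (k : Fin m → Fin n) :
    (P.restrict {ω | dataVec n (fun i => X i ω) ∈ A ∧ ∀ j : Fin m, K j ω = k j}).map
        (fun ω => dataVec n fun i => X i ω)
      = ((P.map fun ω => dataVec n fun i => X i ω).restrict A).withDensity
          fun D => ENNReal.ofReal (∏ j, drawProb (π D) D (k j)) := by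
  have hD := measurable_dataVec n S.measX
  have hw : Measurable fun D => ENNReal.ofReal (∏ j, drawProb (π D) D (k j)) :=
    (Finset.measurable_prod _ fun j _ => measurable_drawProb S.measπ (k j)).ennreal_ofReal
  ext B hB
  rw [Measure.map_apply hD hB, Measure.restrict_apply (hD hB), withDensity_apply _ hB,
    Measure.restrict_restrict hB, setLIntegral_map (hB.inter hA) hw hD]
  have h := S.draw m (B ∩ A) (hB.inter hA) (fun D hD => hAm D hD.2) k
  have e1 : (fun ω => dataVec n fun i => X i ω) ⁻¹' B ∩
      {ω | dataVec n (fun i => X i ω) ∈ A ∧ ∀ j : Fin m, K j ω = k j}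
      = {ω | dataVec n (fun i => X i ω) ∈ B ∩ A ∧ ∀ j : Fin m, K j ω = k j} := by
    ext ω; simp [and_assoc]
  rw [e1, h]
  refine lintegral_congr fun ω => ?_
  rw [ENNReal.ofReal_prod_of_nonneg fun j _ => S.drawProb_nonneg _ _]
  refine Finset.prod_congr rfl fun j _ => ?_
  by_cases hc : (X (k j) ω).2.1 = true
  · rw [if_pos hc, drawProb, if_pos (show (dataVec n (fun i => X i ω) (k j)).2.1 = true from hc)]
  · rw [if_neg hc, drawProb, if_neg (show ¬ (dataVec n (fun i => X i ω) (k j)).2.1 = true from hc),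
      ENNReal.ofReal_zero]

lemma lintegral_fiber (S : DrawSetup P n r X π K) {m : ℕ} {A : Set (Fin n → Obs)}
    (hA : MeasurableSet A) (hAm : ∀ D ∈ A, (∃ i, (D i).2.1 = true) ∧ r - numFail D = m)
    (k : Fin m → Fin n) {h : (Fin n → Obs) → ℝ≥0∞} (hh : Measurable h) :
    ∫⁻ ω in {ω | dataVec n (fun i => X i ω) ∈ A ∧ ∀ j : Fin m, K j ω = k j},
        h (dataVec n fun i => X i ω) ∂P
      = ∫⁻ ω in {ω | dataVec n (fun i => X i ω) ∈ A},
          ENNReal.ofReal (∏ j, drawProb (π (dataVec n fun i => X i ω))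
            (dataVec n fun i => X i ω) (k j)) * h (dataVec n fun i => X i ω) ∂P := by
  have hD := measurable_dataVec n S.measX
  have hw : Measurable fun D => ENNReal.ofReal (∏ j, drawProb (π D) D (k j)) :=
    (Finset.measurable_prod _ fun j _ => measurable_drawProb S.measπ (k j)).ennreal_ofReal
  rw [← lintegral_map hh hD, S.map_fiber hA hAm k, lintegral_withDensity_eq_lintegral_mul _ hw hh,
    setLIntegral_map hA (hw.mul hh) hD]
  rfl

lemma integral_fiber (S : DrawSetup P n r X π K) {m : ℕ} {A : Set (Fin n → Obs)}
    (hA : MeasurableSet A) (hAm : ∀ D ∈ A, (∃ i, (D i).2.1 = true) ∧ r - numFail D = m)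
    (k : Fin m → Fin n) {h : (Fin n → Obs) → ℂ} (hh : Measurable h) :
    ∫ ω in {ω | dataVec n (fun i => X i ω) ∈ A ∧ ∀ j : Fin m, K j ω = k j},
        h (dataVec n fun i => X i ω) ∂P
      = ∫ ω in {ω | dataVec n (fun i => X i ω) ∈ A},
          ((∏ j, drawProb (π (dataVec n fun i => X i ω))
            (dataVec n fun i => X i ω) (k j) : ℝ) : ℂ) * h (dataVec n fun i => X i ω) ∂P := by
  have hD := measurable_dataVec n S.measX
  have hw' : Measurable fun D => ∏ j, drawProb (π D) D (k j) :=
    Finset.measurable_prod _ fun j _ => measurable_drawProb S.measπ (k j)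
  rw [← integral_map hD.aemeasurable hh.aestronglyMeasurable, S.map_fiber hA hAm k,
    integral_withDensity_eq_integral_toReal_smul hw'.ennreal_ofReal
      (ae_of_all _ fun _ => ENNReal.ofReal_lt_top),
    setIntegral_map hA ?_ hD.aemeasurable]
  · refine integral_congr_ae (ae_of_all _ fun ω => ?_)
    simp only []
    rw [ENNReal.toReal_ofReal (Finset.prod_nonneg fun j _ => S.drawProb_nonneg _ _),
      Complex.real_smul]
  · exact (hw'.ennreal_ofReal.ennreal_toReal.smul hh).aestronglyMeasurable

omit [MeasurableSpace Ω] in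
lemma pairwise_disjoint_fiber {m : ℕ} (A : Set (Fin n → Obs)) :
    Pairwise (Function.onFun Disjoint fun k : Fin m → Fin n =>
      {ω | dataVec n (fun i => X i ω) ∈ A ∧ ∀ j : Fin m, K j ω = k j}) := by
  intro k k' hkk
  refine Set.disjoint_left.2 fun ω h1 h2 => hkk ?_
  funext j
  exact Fin.ext ((h1.2 j).symm.trans (h2.2 j))

variable [IsProbabilityMeasure P]

/-- The indices `K j` are arbitrary naturals, but the outcomes inside the sample already have total
probability (Σ `drawProb`)^m = 1 on A, so nothing else occurs up to a null set. -/
lemma ae_eq_iUnion_fiber (S : DrawSetup P n r X π K) {m : ℕ} {A : Set (Fin n → Obs)}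
    (hA : MeasurableSet A) (hAm : ∀ D ∈ A, (∃ i, (D i).2.1 = true) ∧ r - numFail D = m) :
    (⋃ k : Fin m → Fin n,
        {ω | dataVec n (fun i => X i ω) ∈ A ∧ ∀ j : Fin m, K j ω = k j})
      =ᵐ[P] {ω | dataVec n (fun i => X i ω) ∈ A} := by
  have hD := measurable_dataVec n S.measX
  refine ae_eq_of_subset_of_measure_ge ?_ ?_ ?_ (measure_ne_top _ _)
  · exact Set.iUnion_subset fun k ω hω => hω.1
  · rw [measure_iUnion (pairwise_disjoint_fiber A) fun k => S.measurableSet_fiber hA k,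
      tsum_fintype]
    have h1 : ∀ k : Fin m → Fin n,
        P {ω | dataVec n (fun i => X i ω) ∈ A ∧ ∀ j : Fin m, K j ω = k j}
        = ∫⁻ ω in {ω | dataVec n (fun i => X i ω) ∈ A},
          ENNReal.ofReal (∏ j, drawProb (π (dataVec n fun i => X i ω))
            (dataVec n fun i => X i ω) (k j)) ∂P := by
      intro k
      have := S.lintegral_fiber hA hAm k (h := fun _ => 1) measurable_const
      simpa using this
    rw [Finset.sum_congr rfl fun k _ => h1 k, ← lintegral_finsetSum]
    · rw [← setLIntegral_one]
      refine le_of_eq (setLIntegral_congr_fun (S.measurableSet_data hA) fun ω hω => ?_)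
      rw [← ENNReal.ofReal_sum_of_nonneg fun k _ =>
        Finset.prod_nonneg fun j _ => S.drawProb_nonneg _ _]
      have := sum_prod_mul_prod m (drawProb (π (dataVec n fun i => X i ω))
        (dataVec n fun i => X i ω)) (fun _ => (1 : ℝ))
      simp only [Finset.prod_const_one, mul_one] at this
      rw [this, S.sum_eq_one _ (hAm _ hω).1]
      simp
    · intro k _
      exact ((Finset.measurable_prod _ fun j _ =>
        (measurable_drawProb S.measπ (k j)).comp hD)).ennreal_ofReal
  · exact (MeasurableSet.iUnion fun k => S.measurableSet_fiber hA k).nullMeasurableSet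

/-- Tower property: a function of data and draws may be averaged over the draws first, outcome by
outcome. -/
lemma lintegral_eq_sum (S : DrawSetup P n r X π K) {m : ℕ} {A : Set (Fin n → Obs)}
    (hA : MeasurableSet A) (hAm : ∀ D ∈ A, (∃ i, (D i).2.1 = true) ∧ r - numFail D = m)
    {F : Ω → ℝ≥0∞} {h : (Fin n → Obs) → (Fin m → Fin n) → ℝ≥0∞} (hh : ∀ k, Measurable fun D => h D k)
    (hF : ∀ k ω, dataVec n (fun i => X i ω) ∈ A → (∀ j : Fin m, K j ω = k j) →
      F ω = h (dataVec n fun i => X i ω) k) :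
    ∫⁻ ω in {ω | dataVec n (fun i => X i ω) ∈ A}, F ω ∂P
      = ∫⁻ ω in {ω | dataVec n (fun i => X i ω) ∈ A},
          ∑ k : Fin m → Fin n, ENNReal.ofReal (∏ j, drawProb (π (dataVec n fun i => X i ω))
            (dataVec n fun i => X i ω) (k j)) * h (dataVec n fun i => X i ω) k ∂P := by
  have hD := measurable_dataVec n S.measX
  rw [← setLIntegral_congr (S.ae_eq_iUnion_fiber hA hAm),
    lintegral_iUnion (fun k => S.measurableSet_fiber hA k) (pairwise_disjoint_fiber A), tsum_fintype,
    lintegral_finsetSum]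
  · refine Finset.sum_congr rfl fun k _ => ?_
    rw [← S.lintegral_fiber hA hAm k (hh k)]
    exact setLIntegral_congr_fun (S.measurableSet_fiber hA k) fun ω hω => hF k ω hω.1 hω.2
  · intro k _
    exact (((Finset.measurable_prod _ fun j _ =>
        measurable_drawProb S.measπ (k j))).ennreal_ofReal.mul (hh k)).comp hD

lemma integral_eq_sum (S : DrawSetup P n r X π K) {m : ℕ} {A : Set (Fin n → Obs)}
    (hA : MeasurableSet A) (hAm : ∀ D ∈ A, (∃ i, (D i).2.1 = true) ∧ r - numFail D = m)
    {F : Ω → ℂ} {h : (Fin n → Obs) → (Fin m → Fin n) → ℂ} (hh : ∀ k, Measurable fun D => h D k)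
    (hb : ∀ D k, ‖h D k‖ ≤ 1)
    (hF : ∀ k ω, dataVec n (fun i => X i ω) ∈ A → (∀ j : Fin m, K j ω = k j) →
      F ω = h (dataVec n fun i => X i ω) k) :
    ∫ ω in {ω | dataVec n (fun i => X i ω) ∈ A}, F ω ∂P
      = ∫ ω in {ω | dataVec n (fun i => X i ω) ∈ A},
          ∑ k : Fin m → Fin n, ((∏ j, drawProb (π (dataVec n fun i => X i ω))
            (dataVec n fun i => X i ω) (k j) : ℝ) : ℂ) * h (dataVec n fun i => X i ω) k ∂P := by
  have hD := measurable_dataVec n S.measX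
  have hle : ∀ D ∈ A, ∀ i, drawProb (π D) D i ≤ 1 := fun D hDA i => by
    rw [← S.sum_eq_one D (hAm D hDA).1]
    exact Finset.single_le_sum (fun i _ => S.drawProb_nonneg D i) (Finset.mem_univ i)
  rw [← setIntegral_congr_set (S.ae_eq_iUnion_fiber hA hAm),
    integral_iUnion_fintype (fun k => S.measurableSet_fiber hA k) (pairwise_disjoint_fiber A),
    integral_finsetSum]
  · refine Finset.sum_congr rfl fun k _ => ?_
    rw [← S.integral_fiber hA hAm k (hh k)]
    exact setIntegral_congr_fun (S.measurableSet_fiber hA k) fun ω hω => hF k ω hω.1 hω.2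
  · intro k _
    refine Integrable.of_bound (C := 1) (Measurable.aestronglyMeasurable ?_) ?_
    · exact ((Complex.measurable_ofReal.comp (Finset.measurable_prod _ fun j _ =>
        measurable_drawProb S.measπ (k j))).mul (hh k)).comp hD
    · refine (ae_restrict_iff' (S.measurableSet_data hA)).2 (ae_of_all _ fun ω hω => ?_)
      rw [norm_mul, Complex.norm_real, Real.norm_of_nonneg
        (Finset.prod_nonneg fun j _ => S.drawProb_nonneg _ _)]
      exact mul_le_one₀ (Finset.prod_le_one (fun j _ => S.drawProb_nonneg _ _)
        fun j _ => hle _ hω _) (norm_nonneg _) (hb _ _)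
  · intro k
    refine IntegrableOn.congr_fun (f := fun ω => h (dataVec n fun i => X i ω) k) ?_
      (fun ω hω => (hF k ω hω.1 hω.2).symm) (S.measurableSet_fiber hA k)
    exact Integrable.of_bound (C := 1) ((hh k).comp hD).aestronglyMeasurable
      (ae_of_all _ fun ω => hb _ _)

/-- By `ae_eq_iUnion_fiber` the draws lie in the sample; an outcome containing an uncensored
individual has a vanishing factor `drawProb` and is null. -/
lemma ae_valid (S : DrawSetup P n r X π K) :
    ∀ᵐ ω ∂P, (∃ i < n, (X i ω).2.1 = true) →
      ValidDraws n (r - numFail (dataVec n fun i => X i ω)) (fun i => X i ω) fun j => K j ω := by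
  have key : ∀ m : ℕ, ∀ᵐ ω ∂P, (∃ i : Fin n, (X i ω).2.1 = true) →
      r - numFail (dataVec n fun i => X i ω) = m → ValidDraws n m (fun i => X i ω) fun j => K j ω := by
    intro m
    set A : Set (Fin n → Obs) := {D | (∃ i, (D i).2.1 = true) ∧ r - numFail D = m} with hAdef
    have hA : MeasurableSet A := by
      refine MeasurableSet.inter ?_ ?_
      · have : {D : Fin n → Obs | ∃ i, (D i).2.1 = true}
            = ⋃ i, {D : Fin n → Obs | (D i).2.1 = true} := by ext D; simp
        show MeasurableSet {D : Fin n → Obs | ∃ i, (D i).2.1 = true}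
        rw [this]
        exact MeasurableSet.iUnion fun i => measurableSet_censored i
      · exact measurableSet_eq_fun (measurable_const.sub (measurable_numFail n)) measurable_const
    have hAm : ∀ D ∈ A, (∃ i, (D i).2.1 = true) ∧ r - numFail D = m := fun D hD => hD
    have hz : ∀ k : Fin m → Fin n, ∀ᵐ ω ∂P, dataVec n (fun i => X i ω) ∈ A →
        (∀ j : Fin m, K j ω = k j) → ∀ j, (X (k j) ω).2.1 = true := by
      intro k
      set B : Set (Fin n → Obs) := {D | ∃ j, ¬ (D (k j)).2.1 = true} with hB
      have hBm : MeasurableSet B := by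
        have : B = ⋃ j, {D : Fin n → Obs | (D (k j)).2.1 = true}ᶜ := by ext D; simp [hB]
        rw [this]
        exact MeasurableSet.iUnion fun j => (measurableSet_censored (k j)).compl
      have h := S.lintegral_fiber (hA.inter hBm) (fun D hD => hAm D hD.1) k
        (h := fun _ => 1) measurable_const
      have h0 : ∫⁻ ω in {ω | dataVec n (fun i => X i ω) ∈ A ∩ B},
          ENNReal.ofReal (∏ j, drawProb (π (dataVec n fun i => X i ω))
            (dataVec n fun i => X i ω) (k j)) * 1 ∂P = 0 := by
        rw [setLIntegral_congr_fun (g := fun _ => 0)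
          (S.measurableSet_data (hA.inter hBm))]
        · simp
        · intro ω hω
          obtain ⟨j, hj⟩ := hω.2
          have : drawProb (π (dataVec n fun i => X i ω)) (dataVec n fun i => X i ω) (k j) = 0 := by
            simp only [drawProb, if_neg hj]
          have h2 : ∏ j, drawProb (π (dataVec n fun i => X i ω)) (dataVec n fun i => X i ω) (k j) = 0 :=
            Finset.prod_eq_zero (Finset.mem_univ j) this
          beta_reduce
          rw [h2, ENNReal.ofReal_zero, zero_mul]
      rw [h0, setLIntegral_one] at h
      refine measure_mono_null ?_ h
      intro ω hω
      simp only [Set.mem_compl_iff, Set.mem_ofPred_eq, Classical.not_imp, not_forall] at hω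
      obtain ⟨h1, h2, j, h3⟩ := hω
      exact ⟨⟨h1, ⟨j, h3⟩⟩, h2⟩
    filter_upwards [ae_all_iff.2 hz, (S.ae_eq_iUnion_fiber hA hAm).mem_iff] with ω h1 h2 h3 h4
    have hmem : dataVec n (fun i => X i ω) ∈ A := ⟨h3, h4⟩
    obtain ⟨k, hk⟩ := Set.mem_iUnion.1 (h2.2 hmem)
    intro j hj
    have hkj := hk.2 ⟨j, hj⟩
    show K j ω < n ∧ (X (K j ω) ω).2.1 = true
    rw [show K j ω = k ⟨j, hj⟩ from hkj]
    exact ⟨(k ⟨j, hj⟩).2, h1 k hmem hk.2 ⟨j, hj⟩⟩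
  filter_upwards [ae_all_iff.2 key] with ω hω ⟨i, hi, hc⟩
  exact hω _ ⟨⟨i, hi⟩, hc⟩ rfl

/-- The weighted mean of `u` under the conditional law of one draw. -/
lemma lintegral_sq_sum_draws (S : DrawSetup P n r X π K) {A : Set (Fin n → Obs)}
    (hA : MeasurableSet A) (hAc : ∀ D ∈ A, ∃ i, (D i).2.1 = true)
    {y : (Fin n → Obs) → ℕ → ℝ} (hy : ∀ i, Measurable fun D => y D i)
    (hy0 : ∀ D ∈ A, ∑ i : Fin n, drawProb (π D) D i * y D i = 0) :
    ∫⁻ ω in {ω | dataVec n (fun i => X i ω) ∈ A},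
        ENNReal.ofReal ((∑ j ∈ Finset.range (r - numFail (dataVec n fun i => X i ω)),
          y (dataVec n fun i => X i ω) (K j ω)) ^ 2) ∂P
      = ∫⁻ ω in {ω | dataVec n (fun i => X i ω) ∈ A},
          ENNReal.ofReal ((r - numFail (dataVec n fun i => X i ω) : ℕ) *
            ∑ i : Fin n, drawProb (π (dataVec n fun i => X i ω)) (dataVec n fun i => X i ω) i
              * y (dataVec n fun i => X i ω) i ^ 2) ∂P := by
  have hD := measurable_dataVec n S.measX
  have hAm : ∀ m, MeasurableSet (A ∩ {D | r - numFail D = m}) := fun m =>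
    hA.inter (measurableSet_eq_fun (measurable_const.sub (measurable_numFail n)) measurable_const)
  -- The draw hypothesis concerns a fixed number of draws, so the event is split according to the
  -- value m of r - n₀.
  have hU : {ω | dataVec n (fun i => X i ω) ∈ A}
      = ⋃ m : ℕ, {ω | dataVec n (fun i => X i ω) ∈ A ∩ {D | r - numFail D = m}} := by
    ext ω; simp
  have hdisj : Pairwise (Function.onFun Disjoint fun m : ℕ =>
      {ω | dataVec n (fun i => X i ω) ∈ A ∩ {D | r - numFail D = m}}) := by
    intro m m' hmm
    exact Set.disjoint_left.2 fun ω h1 h2 => hmm (h1.2.symm.trans h2.2)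
  rw [hU, lintegral_iUnion (fun m => S.measurableSet_data (hAm m)) hdisj, lintegral_iUnion (fun m => S.measurableSet_data (hAm m)) hdisj]
  refine tsum_congr fun m => ?_
  rw [S.lintegral_eq_sum (m := m) (hAm m) (fun D hD => ⟨hAc D hD.1, hD.2⟩)
    (h := fun D k => ENNReal.ofReal ((∑ j, y D (k j)) ^ 2))]
  · refine setLIntegral_congr_fun (S.measurableSet_data (hAm m)) fun ω hω => ?_
    have hm : r - numFail (dataVec n fun i => X i ω) = m := hω.2
    simp only [hm]
    rw [← sum_prod_mul_sq m (S.sum_eq_one _ (hAc _ hω.1)) (hy0 _ hω.1),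
      ENNReal.ofReal_sum_of_nonneg fun k _ => mul_nonneg
        (Finset.prod_nonneg fun j _ => S.drawProb_nonneg _ _) (sq_nonneg _)]
    refine Finset.sum_congr rfl fun k _ => ?_
    rw [ENNReal.ofReal_mul (Finset.prod_nonneg fun j _ => S.drawProb_nonneg _ _)]
  · intro k
    exact ((Finset.measurable_sum _ fun j _ => hy _).pow_const 2).ennreal_ofReal
  · intro k ω hω hk
    have hm : r - numFail (dataVec n fun i => X i ω) = m := hω.2
    rw [hm, Finset.sum_range]
    simp only [hk]

end DrawSetup

lemma measurable_pow_numFail {n r : ℕ} {φ : (Fin n → Obs) → ℂ}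
    (hφ : Measurable φ) : Measurable fun D : Fin n → Obs => φ D ^ (r - numFail D) := by
  have h : Measurable fun p : ℂ × ℕ => p.1 ^ p.2 :=
    measurable_from_prod_countable_left fun m => measurable_id.pow_const m
  exact h.comp (hφ.prodMk (measurable_const.sub (measurable_numFail n)))

namespace DrawSetup

variable {Ω : Type*} [MeasurableSpace Ω] {P : Measure Ω} {n r : ℕ}
  {X : ℕ → Ω → Obs} {π : (Fin n → Obs) → ℕ → ℝ} {K : ℕ → Ω → ℕ}

variable [IsProbabilityMeasure P]

/-- Conditioning on the data: `c` is data-measurable and stays, each draw contributes the same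
conditional mean of φ, and conditional independence turns the product into a power with random
exponent. -/
lemma integral_prod_draws (S : DrawSetup P n r X π K) {A : Set (Fin n → Obs)}
    (hA : MeasurableSet A) (hAc : ∀ D ∈ A, ∃ i, (D i).2.1 = true)
    {c : (Fin n → Obs) → ℂ} (hc : Measurable c) (hc1 : ∀ D, ‖c D‖ ≤ 1)
    {φ : (Fin n → Obs) → ℕ → ℂ} (hφ : ∀ i, Measurable fun D => φ D i) (hφ1 : ∀ D i, ‖φ D i‖ ≤ 1)
    (hm1 : Measurable fun ω => ∏ j ∈ Finset.range (r - numFail (dataVec n fun i => X i ω)),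
          φ (dataVec n fun i => X i ω) (K j ω)) :
    ∫ ω in {ω | dataVec n (fun i => X i ω) ∈ A}, c (dataVec n fun i => X i ω) *
        ∏ j ∈ Finset.range (r - numFail (dataVec n fun i => X i ω)),
          φ (dataVec n fun i => X i ω) (K j ω) ∂P
      = ∫ ω in {ω | dataVec n (fun i => X i ω) ∈ A}, c (dataVec n fun i => X i ω) *
          (∑ i : Fin n, (drawProb (π (dataVec n fun i => X i ω)) (dataVec n fun i => X i ω) i : ℂ)
              * φ (dataVec n fun i => X i ω) i) ^ (r - numFail (dataVec n fun i => X i ω)) ∂P := by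
  have hD := measurable_dataVec n S.measX
  have hAm : ∀ m, MeasurableSet (A ∩ {D | r - numFail D = m}) := fun m =>
    hA.inter (measurableSet_eq_fun (measurable_const.sub (measurable_numFail n)) measurable_const)
  have hU : {ω | dataVec n (fun i => X i ω) ∈ A}
      = ⋃ m : ℕ, {ω | dataVec n (fun i => X i ω) ∈ A ∩ {D | r - numFail D = m}} := by
    ext ω; simp
  have hdisj : Pairwise (Function.onFun Disjoint fun m : ℕ =>
      {ω | dataVec n (fun i => X i ω) ∈ A ∩ {D | r - numFail D = m}}) := by
    intro m m' hmm
    exact Set.disjoint_left.2 fun ω h1 h2 => hmm (h1.2.symm.trans h2.2)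
  have hpm := measurable_pow_numFail (r := r) (Finset.measurable_sum (Finset.univ : Finset (Fin n)) fun i _ =>
      (Complex.measurable_ofReal.comp (measurable_drawProb S.measπ i)).mul (hφ i))
  have hi1 : IntegrableOn (fun ω => c (dataVec n fun i => X i ω) *
        ∏ j ∈ Finset.range (r - numFail (dataVec n fun i => X i ω)),
          φ (dataVec n fun i => X i ω) (K j ω)) {ω | dataVec n (fun i => X i ω) ∈ A} P := by
    refine Integrable.of_bound (C := 1) ((hc.comp hD).mul hm1).aestronglyMeasurable
      (ae_of_all _ fun ω => ?_)
    rw [norm_mul, norm_prod]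
    exact mul_le_one₀ (hc1 _) (Finset.prod_nonneg fun j _ => norm_nonneg _)
      (Finset.prod_le_one (fun j _ => norm_nonneg _) fun j _ => hφ1 _ _)
  have hi2 : IntegrableOn (fun ω => c (dataVec n fun i => X i ω) *
          (∑ i : Fin n, (drawProb (π (dataVec n fun i => X i ω)) (dataVec n fun i => X i ω) i : ℂ)
              * φ (dataVec n fun i => X i ω) i) ^ (r - numFail (dataVec n fun i => X i ω)))
      {ω | dataVec n (fun i => X i ω) ∈ A} P := by
    refine Integrable.of_bound (C := 1) ((hc.mul hpm).comp hD).aestronglyMeasurable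
      ((ae_restrict_iff' (S.measurableSet_data hA)).2 (ae_of_all _ fun ω hω => ?_))
    rw [norm_mul, norm_pow]
    refine mul_le_one₀ (hc1 _) (pow_nonneg (norm_nonneg _) _)
      (pow_le_one₀ (norm_nonneg _) ((norm_sum_le _ _).trans ?_))
    rw [← S.sum_eq_one _ (hAc _ hω)]
    refine Finset.sum_le_sum fun i _ => ?_
    rw [norm_mul, Complex.norm_real, Real.norm_of_nonneg (S.drawProb_nonneg _ _)]
    exact mul_le_of_le_one_right (S.drawProb_nonneg _ _) (hφ1 _ _)
  rw [hU] at hi1 hi2 ⊢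
  rw [integral_iUnion (fun m => S.measurableSet_data (hAm m)) hdisj hi1,
    integral_iUnion (fun m => S.measurableSet_data (hAm m)) hdisj hi2]
  refine tsum_congr fun m => ?_
  rw [S.integral_eq_sum (m := m) (hAm m) (fun D hD => ⟨hAc D hD.1, hD.2⟩)
    (h := fun D k => c D * ∏ j, φ D (k j))]
  · refine setIntegral_congr_fun (S.measurableSet_data (hAm m)) fun ω hω => ?_
    have hm : r - numFail (dataVec n fun i => X i ω) = m := hω.2
    simp only [hm]
    rw [← sum_prod_mul_prod m, Finset.mul_sum]
    refine Finset.sum_congr rfl fun k _ => ?_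
    push_cast
    ring
  · intro k
    exact hc.mul (Finset.measurable_prod _ fun j _ => hφ _)
  · intro D k
    rw [norm_mul, norm_prod]
    exact mul_le_one₀ (hc1 _) (Finset.prod_nonneg fun j _ => norm_nonneg _)
      (Finset.prod_le_one (fun j _ => norm_nonneg _) fun j _ => hφ1 _ _)
  · intro k ω hω hk
    have hm : r - numFail (dataVec n fun i => X i ω) = m := hω.2
    rw [hm, Finset.prod_range]
    simp only [hk]

end DrawSetup

/-! ### Subsample averages -/

/-- The weighted average of `g` over the censoring subsample. -/
noncomputable def subMean (g : Obs → ℝ) (n r : ℕ) (x : ℕ → Obs) (π : ℕ → ℝ) (K : ℕ → ℕ) : ℝ :=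
  (1 / (n : ℝ)) * ((∑ i ∈ Finset.range n, if (x i).2.1 then 0 else g (x i))
    + ∑ j ∈ Finset.range (r - numFail (dataVec n x)),
        (1 / (((r - numFail (dataVec n x) : ℕ) : ℝ) * π (K j))) * g (x (K j)))

/-- The contribution of the censored individuals to the average of `g`. -/
noncomputable def censMean {n : ℕ} (g : Obs → ℝ) (D : Fin n → Obs) : ℝ :=
  (1 / (n : ℝ)) * ∑ i, if (D i).2.1 then g (D i) else 0

/-- The conditional variance of the contribution of one draw. -/
noncomputable def condVar {n : ℕ} (g : Obs → ℝ) (π : ℕ → ℝ) (D : Fin n → Obs) : ℝ :=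
  (1 / (n : ℝ) ^ 2) * (∑ i : Fin n, if (D i).2.1 then (1 / π i) * g (D i) ^ 2 else 0)
    - censMean g D ^ 2

/-- The contribution of drawing individual `i`. -/
noncomputable def drawVal {n : ℕ} (g : Obs → ℝ) (π : ℕ → ℝ) (D : Fin n → Obs) (i : ℕ) : ℝ :=
  if h : i < n then g (D ⟨i, h⟩) / (n * π i) else 0

/-- The centred contribution of drawing individual `i`. -/
noncomputable def drawDev {n : ℕ} (g : Obs → ℝ) (π : ℕ → ℝ) (D : Fin n → Obs) (i : ℕ) : ℝ :=
  drawVal g π D i - censMean g D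

/-- The average of the centred contributions of the draws. -/
noncomputable def drawErr (g : Obs → ℝ) (n r : ℕ) (x : ℕ → Obs) (π : ℕ → ℝ) (K : ℕ → ℕ) : ℝ :=
  (1 / ((r - numFail (dataVec n x) : ℕ) : ℝ)) *
    ∑ j ∈ Finset.range (r - numFail (dataVec n x)), drawDev g π (dataVec n x) (K j)

/-- Failures have weight one in both averages and cancel; what remains compares the draws with the
censored part of the full average. At least one draw is needed, since otherwise `drawErr` would not
subtract `censMean`. -/
lemma subMean_eq {g : Obs → ℝ} {n r : ℕ} {x : ℕ → Obs} {π : ℕ → ℝ} {K : ℕ → ℕ}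
    (hm : 0 < r - numFail (dataVec n x))
    (hK : ValidDraws n (r - numFail (dataVec n x)) x K) :
    subMean g n r x π K = fullMean g n x + drawErr g n r x π K := by
  set m := r - numFail (dataVec n x) with hmdef
  have hm' : (0 : ℝ) < m := by exact_mod_cast hm
  have h1 : drawErr g n r x π K
      = (1 / (n : ℝ)) * (∑ j ∈ Finset.range m, (1 / ((m : ℝ) * π (K j))) * g (x (K j)))
        - censMean g (dataVec n x) := by
    have e : ∀ j ∈ Finset.range m, drawDev g π (dataVec n x) (K j)
        = (1 / n * (1 / π (K j)) * g (x (K j))) - censMean g (dataVec n x) := by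
      intro j hj
      have hj' := (hK j (Finset.mem_range.1 hj)).1
      rw [drawDev, drawVal, dif_pos hj']
      simp only [dataVec]
      ring
    rw [drawErr, ← hmdef, Finset.sum_congr rfl e, Finset.sum_sub_distrib, mul_sub,
      Finset.sum_const, Finset.card_range, nsmul_eq_mul, ← mul_assoc (1 / (m : ℝ)),
      one_div_mul_cancel hm'.ne', one_mul, Finset.mul_sum, Finset.mul_sum]
    congr 1
    refine Finset.sum_congr rfl fun j _ => ?_
    ring
  have h2 : fullMean g n x = (1 / (n : ℝ)) *
      (∑ i ∈ Finset.range n, if (x i).2.1 then 0 else g (x i)) + censMean g (dataVec n x) := by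
    rw [fullMean, censMean, ← mul_add, Finset.sum_range, Finset.sum_range,
      ← Finset.sum_add_distrib]
    congr 1
    refine Finset.sum_congr rfl fun i _ => ?_
    simp only [dataVec]
    by_cases hc : (x i).2.1 = true <;> simp [hc]
  rw [subMean, ← hmdef, h1, h2]
  ring

/-! ### Conditional moments of a single draw -/

section Deterministic

variable {n : ℕ} {g : Obs → ℝ} {π : ℕ → ℝ} {D : Fin n → Obs}

/-- Inverse-probability weighting: `π i` cancels, which is why a draw is conditionally unbiased for
`censMean`. -/
lemma drawProb_mul_drawVal (hpos : ∀ i : Fin n, (D i).2.1 = true → 0 < π i) (i : Fin n) :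
    drawProb π D i * drawVal g π D i = (1 / n) * if (D i).2.1 then g (D i) else 0 := by
  rw [drawProb, drawVal, dif_pos i.2]
  by_cases hc : (D i).2.1 = true
  · have := (hpos i hc).ne'
    have hn : (n : ℝ) ≠ 0 := by
      have : 0 < n := i.pos
      positivity
    rw [if_pos hc, if_pos hc]
    field_simp
  · rw [if_neg hc, if_neg hc]; simp

lemma sum_drawProb_mul_drawDev (hpos : ∀ i : Fin n, (D i).2.1 = true → 0 < π i)
    (hsum : ∑ i, drawProb π D i = 1) :
    ∑ i : Fin n, drawProb π D i * drawDev g π D i = 0 := by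
  simp_rw [drawDev, mul_sub, Finset.sum_sub_distrib, drawProb_mul_drawVal hpos]
  rw [← Finset.mul_sum, ← Finset.sum_mul, hsum, one_mul, censMean, sub_self]

lemma drawProb_mul_drawVal_sq (hpos : ∀ i : Fin n, (D i).2.1 = true → 0 < π i) (i : Fin n) :
    drawProb π D i * drawVal g π D i ^ 2
      = (1 / (n : ℝ) ^ 2) * if (D i).2.1 then (1 / π i) * g (D i) ^ 2 else 0 := by
  rw [drawProb, drawVal, dif_pos i.2]
  by_cases hc : (D i).2.1 = true
  · have := (hpos i hc).ne'
    have hn : (n : ℝ) ≠ 0 := by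
      have : 0 < n := i.pos
      positivity
    rw [if_pos hc, if_pos hc]
    field_simp
  · rw [if_neg hc, if_neg hc]; simp

lemma sum_drawProb_mul_drawDev_sq (hpos : ∀ i : Fin n, (D i).2.1 = true → 0 < π i)
    (hsum : ∑ i, drawProb π D i = 1) :
    ∑ i : Fin n, drawProb π D i * drawDev g π D i ^ 2 = condVar g π D := by
  have e : ∀ i : Fin n, drawProb π D i * drawDev g π D i ^ 2
      = drawProb π D i * drawVal g π D i ^ 2
        - 2 * censMean g D * (drawProb π D i * drawVal g π D i)
        + drawProb π D i * censMean g D ^ 2 := fun i => by rw [drawDev]; ring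
  rw [Finset.sum_congr rfl fun i _ => e i, Finset.sum_add_distrib, Finset.sum_sub_distrib,
    ← Finset.mul_sum, ← Finset.sum_mul, hsum, Finset.sum_congr rfl fun i _ =>
      drawProb_mul_drawVal_sq hpos i, Finset.sum_congr rfl fun i _ => drawProb_mul_drawVal hpos i,
    ← Finset.mul_sum, ← Finset.mul_sum, condVar, ← censMean]
  ring

/-- One factor 1/(nπ) is bounded by M, leaving an ordinary average of g²; the subtracted square is
dropped. -/
lemma condVar_le {M : ℝ} (hM : ∀ i : Fin n, (D i).2.1 = true → ((n : ℝ) * π i)⁻¹ ≤ M)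
    (hM0 : 0 ≤ M) :
    condVar g π D ≤ M * ((1 / (n : ℝ)) * ∑ i, g (D i) ^ 2) := by
  refine (sub_le_self _ (sq_nonneg _)).trans ?_
  rw [Finset.mul_sum, Finset.mul_sum, Finset.mul_sum]
  refine Finset.sum_le_sum fun i _ => ?_
  split_ifs with hc
  · have := hM i hc
    have e : 1 / (n : ℝ) ^ 2 * (1 / π i * g (D i) ^ 2)
        = ((n : ℝ) * π i)⁻¹ * (1 / n * g (D i) ^ 2) := by
      rw [mul_inv]; ring
    rw [e]
    exact mul_le_mul_of_nonneg_right this (by positivity)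
  · rw [mul_zero]; positivity

lemma condVar_nonneg (hpos : ∀ i : Fin n, (D i).2.1 = true → 0 < π i)
    (hsum : ∑ i, drawProb π D i = 1) : 0 ≤ condVar g π D := by
  rw [← sum_drawProb_mul_drawDev_sq hpos hsum]
  refine Finset.sum_nonneg fun i _ => mul_nonneg ?_ (sq_nonneg _)
  rw [drawProb]
  split_ifs with h
  exacts [(hpos i h).le, le_rfl]

end Deterministic

/-- Data with censored individuals, few failures, and moderate weights. -/
def goodData (n r : ℕ) (π : (Fin n → Obs) → ℕ → ℝ) (δ M : ℝ) : Set (Fin n → Obs) :=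
  {D | (∃ i, (D i).2.1 = true) ∧ (numFail D : ℝ) ≤ δ * r ∧
    ∀ i : Fin n, (D i).2.1 = true → ((n : ℝ) * π D i)⁻¹ ≤ M}

lemma measurableSet_goodData {n r : ℕ} {π : (Fin n → Obs) → ℕ → ℝ}
    (hπ : ∀ i, Measurable fun D => π D i) (δ M : ℝ) : MeasurableSet (goodData n r π δ M) := by
  have e : goodData n r π δ M = (⋃ i, {D : Fin n → Obs | (D i).2.1 = true}) ∩
      ({D | (numFail D : ℝ) ≤ δ * r} ∩
        ⋂ i : Fin n, ({D : Fin n → Obs | (D i).2.1 = true}ᶜ ∪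
          {D | ((n : ℝ) * π D i)⁻¹ ≤ M})) := by
    ext D
    simp [goodData, imp_iff_not_or]
  rw [e]
  refine (MeasurableSet.iUnion fun i => measurableSet_censored i).inter (MeasurableSet.inter ?_
    (MeasurableSet.iInter fun i => (measurableSet_censored i).compl.union ?_))
  · exact measurableSet_le (measurable_from_nat.comp (measurable_numFail n)) measurable_const
  · exact measurableSet_le ((hπ i).const_mul _).inv measurable_const

lemma le_sub_of_goodData {n r : ℕ} {π : (Fin n → Obs) → ℕ → ℝ} {δ M : ℝ} {D : Fin n → Obs}
    (hD : D ∈ goodData n r π δ M) : (1 - δ) * r ≤ ((r - numFail D : ℕ) : ℝ) := by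
  have h1 := hD.2.1
  have h2 : (r : ℝ) ≤ ((r - numFail D : ℕ) : ℝ) + numFail D := by exact_mod_cast le_tsub_add
  linarith

lemma measurable_sum_range {α : Type*} [MeasurableSpace α] {N : α → ℕ} (hN : Measurable N)
    {F : ℕ → α → ℝ} (hF : ∀ j, Measurable (F j)) :
    Measurable fun a => ∑ j ∈ Finset.range (N a), F j a := by
  have h : Measurable fun p : α × ℕ => ∑ j ∈ Finset.range p.2, F j p.1 :=
    measurable_from_prod_countable_left fun m =>
      Finset.measurable_sum (Finset.range m) fun j _ => hF j
  exact h.comp (measurable_id.prodMk hN)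

lemma measurable_nat_eval {α : Type*} [MeasurableSpace α] {k : α → ℕ} (hk : Measurable k)
    {F : ℕ → α → ℝ} (hF : ∀ j, Measurable (F j)) : Measurable fun a => F (k a) a := by
  have h : Measurable fun p : α × ℕ => F p.2 p.1 :=
    measurable_from_prod_countable_left fun m => hF m
  exact h.comp (measurable_id.prodMk hk)

section Meas

variable {n : ℕ} {π : (Fin n → Obs) → ℕ → ℝ}

lemma measurable_censMean {g : Obs → ℝ} (hg : Measurable g) :
    Measurable fun D : Fin n → Obs => censMean g D :=
  (Finset.measurable_sum _ fun i _ => Measurable.ite (measurableSet_censored i)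
    (hg.comp (measurable_pi_apply i)) measurable_const).const_mul _

lemma measurable_drawVal (hπ : ∀ i, Measurable fun D => π D i) {g : Obs → ℝ}
    (hg : Measurable g) (i : ℕ) : Measurable fun D => drawVal g (π D) D i := by
  unfold drawVal
  split_ifs with h
  · exact (hg.comp (measurable_pi_apply _)).div ((hπ i).const_mul _)
  · exact measurable_const

lemma measurable_drawDev (hπ : ∀ i, Measurable fun D => π D i) {g : Obs → ℝ}
    (hg : Measurable g) (i : ℕ) : Measurable fun D => drawDev g (π D) D i :=
  (measurable_drawVal hπ hg i).sub (measurable_censMean hg)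

lemma measurable_condVar (hπ : ∀ i, Measurable fun D => π D i) {g : Obs → ℝ}
    (hg : Measurable g) : Measurable fun D => condVar g (π D) D := by
  refine ((Finset.measurable_sum _ fun i _ => Measurable.ite (measurableSet_censored i)
    (((hπ i).const_div 1).mul ((hg.comp (measurable_pi_apply i)).pow_const 2))
    measurable_const).const_mul _).sub ((measurable_censMean hg).pow_const 2)

end Meas

namespace DrawSetup

variable {Ω : Type*} [MeasurableSpace Ω] {P : Measure Ω} {n r : ℕ}
  {X : ℕ → Ω → Obs} {π : (Fin n → Obs) → ℕ → ℝ} {K : ℕ → Ω → ℕ}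

lemma measurable_drawErr (S : DrawSetup P n r X π K) {g : Obs → ℝ} (hg : Measurable g) :
    Measurable fun ω => drawErr g n r (fun i => X i ω) (π (dataVec n fun i => X i ω))
      fun j => K j ω := by
  have hD := measurable_dataVec n S.measX
  have hN : Measurable fun ω => r - numFail (dataVec n fun i => X i ω) :=
    (measurable_const.sub (measurable_numFail n)).comp hD
  refine ((measurable_from_nat (f := fun k : ℕ => 1 / (k : ℝ))).comp hN).mul
    (measurable_sum_range hN fun j => ?_)
  exact measurable_nat_eval (S.measK j) fun i => (measurable_drawDev S.measπ hg i).comp hD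

/-- Given the data the second moment is (r/m) `condVar`. Good data with δ = 1/2 give m ≥ r/2, hence
r/m ≤ 2, and `condVar_le` supplies M. -/
lemma lintegral_sq_drawErr_le [IsProbabilityMeasure P] (S : DrawSetup P n r X π K) {g : Obs → ℝ}
    (hg : Measurable g) {M : ℝ} (hM : 0 ≤ M) (hr : 0 < r) :
    ∫⁻ ω in {ω | dataVec n (fun i => X i ω) ∈ goodData n r π (1 / 2) M},
        ENNReal.ofReal ((√r * drawErr g n r (fun i => X i ω) (π (dataVec n fun i => X i ω))
          fun j => K j ω) ^ 2) ∂P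
      ≤ ∫⁻ ω, ENNReal.ofReal (2 * M * fullMean (fun x => g x ^ 2) n fun i => X i ω) ∂P := by
  have hr' : (0 : ℝ) < r := by exact_mod_cast hr
  have hA := measurableSet_goodData (r := r) S.measπ (1 / 2) M
  have hN : Measurable fun D : Fin n → Obs => 1 / ((r - numFail D : ℕ) : ℝ) :=
    (measurable_from_nat (f := fun k : ℕ => 1 / (k : ℝ))).comp
      (measurable_const.sub (measurable_numFail n))
  have h := S.lintegral_sq_sum_draws hA (fun D hD => hD.1)
    (y := fun D i => √r * (1 / ((r - numFail D : ℕ) : ℝ)) * drawDev g (π D) D i)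
    (fun i => (hN.const_mul _).mul (measurable_drawDev S.measπ hg i)) (fun D hD => by
      have := sum_drawProb_mul_drawDev (g := g) (S.pos D) (S.sum_eq_one D hD.1)
      have e : ∀ i : Fin n, drawProb (π D) D i *
          (√r * (1 / ((r - numFail D : ℕ) : ℝ)) * drawDev g (π D) D i)
          = √r * (1 / ((r - numFail D : ℕ) : ℝ)) * (drawProb (π D) D i * drawDev g (π D) D i) :=
        fun i => by ring
      rw [Finset.sum_congr rfl fun i _ => e i, ← Finset.mul_sum, this, mul_zero])
  have e1 : ∀ ω, √r * drawErr g n r (fun i => X i ω) (π (dataVec n fun i => X i ω))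
          (fun j => K j ω)
        = ∑ j ∈ Finset.range (r - numFail (dataVec n fun i => X i ω)),
          √r * (1 / ((r - numFail (dataVec n fun i => X i ω) : ℕ) : ℝ)) *
            drawDev g (π (dataVec n fun i => X i ω)) (dataVec n fun i => X i ω) (K j ω) := by
    intro ω
    rw [drawErr, ← mul_assoc, Finset.mul_sum]
  simp_rw [e1]
  rw [h]
  refine (setLIntegral_mono' (S.measurableSet_data hA) fun ω hω => ?_).trans
    (setLIntegral_le_lintegral {ω | dataVec n (fun i => X i ω) ∈ goodData n r π (1 / 2) M} _)
  set D := dataVec n fun i => X i ω with hDdef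
  have hD : D ∈ goodData n r π (1 / 2) M := hω
  have hm := le_sub_of_goodData hD
  set m := ((r - numFail D : ℕ) : ℝ) with hmdef
  have hm0 : 0 < m := by linarith
  refine ENNReal.ofReal_le_ofReal ?_
  have e2 : ∀ i : Fin n, drawProb (π D) D i * (√r * (1 / m) * drawDev g (π D) D i) ^ 2
      = r / m ^ 2 * (drawProb (π D) D i * drawDev g (π D) D i ^ 2) := fun i => by
    rw [mul_pow, mul_pow, Real.sq_sqrt hr'.le]; ring
  rw [Finset.sum_congr rfl fun i _ => e2 i, ← Finset.mul_sum,
    sum_drawProb_mul_drawDev_sq (S.pos D) (S.sum_eq_one D hD.1)]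
  have h3 := condVar_le (g := g) hD.2.2 hM
  have h4 : (1 / (n : ℝ)) * ∑ i, g (D i) ^ 2 = fullMean (fun x => g x ^ 2) n fun i => X i ω := by
    rw [fullMean, Finset.sum_range]; rfl
  rw [h4] at h3
  have h5 : 0 ≤ condVar g (π D) D := condVar_nonneg (S.pos D) (S.sum_eq_one D hD.1)
  have h6 : m * (r / m ^ 2 * condVar g (π D) D) = r / m * condVar g (π D) D := by
    field_simp
  rw [h6, mul_assoc]
  exact mul_le_mul ((div_le_iff₀ hm0).2 (by linarith)) h3 h5 (by norm_num)

end DrawSetup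

/-- The i.i.d. rows with a censoring subsample of size `r n`. -/
structure SubsampleScheme {Ω : Type*} [MeasurableSpace Ω] (P : Measure Ω) (μ : ℕ → Measure Obs)
    (X : ℕ → ℕ → Ω → Obs) (r : ℕ → ℕ) (γ : ℝ) (π : (n : ℕ) → (Fin n → Obs) → ℕ → ℝ)
    (K : ℕ → ℕ → Ω → ℕ) : Prop where
  iid : IsIIDData P μ X
  tendsto_r : Tendsto r atTop atTop
  ratio : Tendsto (fun n => (r n : ℝ) / (n : ℝ)) atTop (𝓝 γ)
  failRate : TendstoInMeasure P
      (fun n ω => (numFail (dataVec n fun i => X n i ω) : ℝ) / (r n : ℝ)) atTop (fun _ => (0 : ℝ))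
  prob : IsSubsamplingProb π
  measK : ∀ n j, Measurable (K n j)
  draw : ∀ n, IsCensoringDraw P n (r n) (X n) (π n) (K n)
  weight : WeightAssumption P X π

/-! ### Good data and the stochastic order of subsample averages -/

namespace SubsampleScheme

variable {Ω : Type*} [MeasurableSpace Ω] {P : Measure Ω} {μ : ℕ → Measure Obs}
  {X : ℕ → ℕ → Ω → Obs} {r : ℕ → ℕ} {γ : ℝ} {π : (n : ℕ) → (Fin n → Obs) → ℕ → ℝ}
  {K : ℕ → ℕ → Ω → ℕ}

lemma setup (S : SubsampleScheme P μ X r γ π K) (n : ℕ) :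
    DrawSetup P n (r n) (X n) (π n) (K n) where
  measX := S.iid.measurable n
  measπ := S.prob.measurable n
  measK := S.measK n
  pos := S.prob.pos n
  sum_eq_one := fun D hD => by simpa [drawProb] using S.prob.sum_eq_one n D hD
  draw := S.draw n

lemma gamma_nonneg (S : SubsampleScheme P μ X r γ π K) : 0 ≤ γ :=
  ge_of_tendsto' S.ratio fun n => by positivity

lemma eventually_ratio_le (S : SubsampleScheme P μ X r γ π K) :
    ∀ᶠ n in atTop, 0 < r n ∧ 0 < n ∧ (r n : ℝ) / n ≤ γ + 1 := by
  filter_upwards [S.tendsto_r.eventually_gt_atTop 0, eventually_gt_atTop 0,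
    S.ratio.eventually_le_const (lt_add_one γ)] with n h1 h2 h3 using ⟨h1, h2, h3⟩

lemma exists_goodData (S : SubsampleScheme P μ X r γ π K) {δ ε : ℝ} (hδ : 0 < δ) (hε : 0 < ε) :
    ∃ M : ℝ, 0 < M ∧ ∀ᶠ n in atTop,
      P {ω | dataVec n (fun i => X n i ω) ∉ goodData n (r n) (π n) δ M} ≤ ENNReal.ofReal ε := by
  obtain ⟨M, hM⟩ := S.weight (ε / 2) (by linarith)
  have hγ := S.gamma_nonneg
  -- Eventually r ≤ (γ + 1) n, so the second entry forces n₀ ≤ n/2 < n and a censored individual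
  -- exists.
  set δ' := min δ (1 / (2 * (γ + 1))) with hδ'
  have hδ'pos : 0 < δ' := lt_min hδ (by positivity)
  refine ⟨max M 1, by positivity, ?_⟩
  filter_upwards [hM, whp_iff_forall_eps.1 (S.failRate.whp hδ'pos) (ε / 2) (by linarith),
    S.eventually_ratio_le] with n h1 h2 ⟨hr, hn, hrn⟩
  have hr' : (0 : ℝ) < r n := by exact_mod_cast hr
  have hn' : (0 : ℝ) < n := by exact_mod_cast hn
  rw [show ε = ε / 2 + ε / 2 by ring, ENNReal.ofReal_add (by linarith) (by linarith)]
  refine (measure_mono ?_).trans ((measure_union_le _ _).trans (add_le_add h1 h2))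
  intro ω hω
  by_contra hc
  simp only [Set.mem_union, Set.mem_ofPred_eq, not_or, not_lt, not_not, sub_zero] at hc
  obtain ⟨hc1, hc2⟩ := hc
  rw [abs_of_nonneg (by positivity), div_le_iff₀ hr'] at hc2
  refine hω ⟨?_, hc2.trans (mul_le_mul_of_nonneg_right (min_le_left _ _) hr'.le), fun i hi => ?_⟩
  · by_contra hno
    push Not at hno
    have hall : numFail (dataVec n fun i => X n i ω) = n := by
      rw [numFail, Finset.filter_true_of_mem, Finset.card_univ, Fintype.card_fin]
      intro i _
      simpa using hno i
    rw [hall] at hc2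
    have h3 : δ' * r n ≤ 1 / (2 * (γ + 1)) * ((γ + 1) * n) := by
      refine mul_le_mul (min_le_right _ _) ((div_le_iff₀ hn').1 hrn) hr'.le (by positivity)
    have h4 : 1 / (2 * (γ + 1)) * ((γ + 1) * n) = n / 2 := by field_simp
    linarith
  · have hfin : BddAbove (Set.range fun i : {i : Fin n // (X n i ω).2.1 = true} =>
        ((n : ℝ) * π n (dataVec n fun i => X n i ω) i.1)⁻¹) := (Set.finite_range _).bddAbove
    exact (le_ciSup hfin ⟨i, hi⟩).trans ((le_abs_self _).trans (hc1.trans (le_max_left _ _)))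

/-- The admissible M grows with the required confidence, but a claim proved for every fixed M holds
unconditionally. -/
lemma whp_of_goodData (S : SubsampleScheme P μ X r γ π K) {δ : ℝ} (hδ : 0 < δ)
    {p : ℕ → Ω → Prop}
    (h : ∀ M, 0 < M → Whp P fun n ω => dataVec n (fun i => X n i ω) ∈ goodData n (r n) (π n) δ M →
      p n ω) : Whp P p := by
  refine whp_iff_forall_eps.2 fun ε hε => ?_
  obtain ⟨M, hM0, hM⟩ := S.exists_goodData hδ (half_pos hε)
  filter_upwards [hM, whp_iff_forall_eps.1 (h M hM0) (ε / 2) (by linarith)] with n h1 h2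
  rw [show ε = ε / 2 + ε / 2 by ring, ENNReal.ofReal_add (by linarith) (by linarith)]
  refine (measure_mono ?_).trans ((measure_union_le _ _).trans (add_le_add h1 h2))
  intro ω hω
  by_contra hc
  simp only [Set.mem_union, Set.mem_ofPred_eq, not_or, not_not] at hc
  exact hω (hc.2 hc.1)

variable [IsProbabilityMeasure P]

/-- With probability tending to one, the draws are censored individuals of the sample, and there
is at least one draw. -/
lemma whp_valid (S : SubsampleScheme P μ X r γ π K) :
    Whp P fun n ω => 0 < r n - numFail (dataVec n fun i => X n i ω) ∧
      ValidDraws n (r n - numFail (dataVec n fun i => X n i ω)) (fun i => X n i ω)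
        fun j => K n j ω := by
  refine S.whp_of_goodData (δ := 1 / 2) (by norm_num) fun M _ => Whp.of_ae ?_
  filter_upwards [S.eventually_ratio_le] with n ⟨hr, _, _⟩
  filter_upwards [(S.setup n).ae_valid] with ω hω hg
  have hm := le_sub_of_goodData hg
  have hr' : (0 : ℝ) < r n := by exact_mod_cast hr
  refine ⟨?_, hω ?_⟩
  · have : (0 : ℝ) < ((r n - numFail (dataVec n fun i => X n i ω) : ℕ) : ℝ) := by linarith
    exact_mod_cast this
  · obtain ⟨i, hi⟩ := hg.1
    exact ⟨i, i.2, hi⟩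

/-- Chebyshev's inequality restricted to good data; the complement costs the other half of ε. -/
lemma boundedInProb_drawErr (S : SubsampleScheme P μ X r γ π K)
    {g : ℕ → Obs → ℝ} (hg : ∀ n, Measurable (g n)) (hg2 : ∀ n, MemLp (g n) 2 (μ n)) {B : ℝ}
    (hB : ∀ n, ∫ x, g n x ^ 2 ∂(μ n) ≤ B) :
    BoundedInProb P fun n ω => √(r n) * drawErr (g n) n (r n) (fun i => X n i ω)
      (π n (dataVec n fun i => X n i ω)) fun j => K n j ω := by
  intro ε hε
  obtain ⟨M, hM0, hM⟩ := S.exists_goodData (δ := 1 / 2) (by norm_num) (half_pos hε)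
  have hB0 : 0 ≤ B := (integral_nonneg fun x => sq_nonneg _).trans (hB 0)
  set C := 2 * M * B with hC
  have hC0 : 0 ≤ C := by positivity
  -- Markov's bound becomes C (ε/2)/(C + 1) ≤ ε/2; the added 1 keeps the threshold positive when C =
  -- 0.
  refine ⟨√((C + 1) / (ε / 2)), ?_⟩
  have hpos : 0 < (C + 1) / (ε / 2) := by positivity
  filter_upwards [hM, S.eventually_ratio_le] with n h1 ⟨hr, hn, hrn⟩
  set A := {ω | dataVec n (fun i => X n i ω) ∈ goodData n (r n) (π n) (1 / 2) M} with hA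
  have hAm : MeasurableSet A :=
    (S.setup n).measurableSet_data (measurableSet_goodData (S.prob.measurable n) _ _)
  set Z := fun ω => √(r n) * drawErr (g n) n (r n) (fun i => X n i ω)
      (π n (dataVec n fun i => X n i ω)) (fun j => K n j ω) with hZ
  have hZm : Measurable Z := ((S.setup n).measurable_drawErr (hg n)).const_mul _
  have h2 : ∫⁻ ω in A, ENNReal.ofReal (Z ω ^ 2) ∂P ≤ ENNReal.ofReal C := by
    refine ((S.setup n).lintegral_sq_drawErr_le (hg n) hM0.le hr).trans ?_
    have hm2 : Measurable fun x => g n x ^ 2 := (hg n).pow_const 2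
    have h3 := S.iid.lintegral_fullMean_le n hm2 fun x => sq_nonneg _
    rw [← ofReal_integral_eq_lintegral_ofReal (hg2 n).integrable_sq
      (ae_of_all _ fun x => sq_nonneg _)] at h3
    simp_rw [ENNReal.ofReal_mul (show (0 : ℝ) ≤ 2 * M by positivity)]
    rw [lintegral_const_mul _ (measurable_fullMean hm2 S.iid n).ennreal_ofReal, hC,
      ENNReal.ofReal_mul (show (0 : ℝ) ≤ 2 * M by positivity)]
    gcongr
    exact h3.trans (ENNReal.ofReal_le_ofReal (hB n))
  have h4 := measure_lt_le_of_lintegral_le (hZm.pow_const 2).aemeasurable hpos h2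
  rw [show ε = ε / 2 + ε / 2 by ring, ENNReal.ofReal_add (by linarith) (by linarith)]
  refine (measure_mono (t := {ω | dataVec n (fun i => X n i ω) ∉ goodData n (r n) (π n) (1 / 2) M}
    ∪ ({ω | (C + 1) / (ε / 2) < Z ω ^ 2} ∩ A)) ?_).trans
    ((measure_union_le _ _).trans (add_le_add h1 ?_))
  · intro ω hω
    by_cases hωA : ω ∈ A
    · refine Or.inr ⟨?_, hωA⟩
      have := Real.lt_sq_of_sqrt_lt (show √((C + 1) / (ε / 2)) < |Z ω| by
        rw [add_halves] at hω; exact hω)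
      rwa [sq_abs] at this
    · exact Or.inl hωA
  · rw [← Measure.restrict_apply' hAm]
    refine h4.trans (ENNReal.ofReal_le_ofReal ?_)
    rw [div_div_eq_mul_div, div_le_iff₀ (by positivity)]
    nlinarith

lemma boundedInProb_fullMean [∀ n, IsProbabilityMeasure (μ n)] (S : SubsampleScheme P μ X r γ π K)
    {g : ℕ → Obs → ℝ} (hg : ∀ n, Measurable (g n)) (hg2 : ∀ n, MemLp (g n) 2 (μ n)) {B : ℝ}
    (hB : ∀ n, ∫ x, g n x ^ 2 ∂(μ n) ≤ B) :
    BoundedInProb P fun n ω => √(r n) *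
      (fullMean (g n) n (fun i => X n i ω) - ∫ x, g n x ∂(μ n)) := by
  have hB0 : 0 ≤ B := (integral_nonneg fun x => sq_nonneg _).trans (hB 0)
  have hγ := S.gamma_nonneg
  refine boundedInProb_of_lintegral_sq_le (C := (γ + 1) * B) (fun n =>
    (((measurable_fullMean (hg n) S.iid n).sub_const _).const_mul _).aemeasurable) ?_
  filter_upwards [S.eventually_ratio_le] with n ⟨hr, hn, hrn⟩
  have hn' : (0 : ℝ) < n := by exact_mod_cast hn
  simp_rw [mul_pow, Real.sq_sqrt (Nat.cast_nonneg (r n) : (0 : ℝ) ≤ r n),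
    ENNReal.ofReal_mul (Nat.cast_nonneg (r n) : (0 : ℝ) ≤ r n)]
  rw [lintegral_const_mul _
    (((measurable_fullMean (hg n) S.iid n).sub_const _).pow_const 2).ennreal_ofReal]
  refine (mul_le_mul_right (S.iid.lintegral_sq_fullMean_sub_le hn (hg n) (hg2 n)) _).trans ?_
  rw [← ENNReal.ofReal_mul (Nat.cast_nonneg _)]
  refine ENNReal.ofReal_le_ofReal ?_
  rw [mul_div_assoc', mul_div_right_comm]
  exact mul_le_mul hrn (hB n) (integral_nonneg fun x => sq_nonneg _) (by positivity)

end SubsampleScheme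

/-! ### Calculus of O_p(1) sequences -/

section Bounded

variable {Ω : Type*} [MeasurableSpace Ω] {P : Measure Ω}

lemma BoundedInProb.add {Y Z : ℕ → Ω → ℝ} (hY : BoundedInProb P Y) (hZ : BoundedInProb P Z) :
    BoundedInProb P fun n ω => Y n ω + Z n ω := by
  intro ε hε
  obtain ⟨M, hM⟩ := hY (ε / 2) (by linarith)
  obtain ⟨N, hN⟩ := hZ (ε / 2) (by linarith)
  refine ⟨M + N, ?_⟩
  filter_upwards [hM, hN] with n h1 h2
  rw [show ε = ε / 2 + ε / 2 by ring, ENNReal.ofReal_add (by linarith) (by linarith)]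
  refine (measure_mono ?_).trans ((measure_union_le _ _).trans (add_le_add h1 h2))
  intro ω hω
  by_contra hc
  simp only [Set.mem_union, Set.mem_ofPred_eq, not_or, not_lt] at hc hω
  exact absurd hω (not_lt.2 ((abs_add_le _ _).trans (add_le_add hc.1 hc.2)))

lemma BoundedInProb.congr_whp {Y Z : ℕ → Ω → ℝ} (hY : BoundedInProb P Y)
    (h : Whp P fun n ω => |Z n ω| ≤ |Y n ω|) : BoundedInProb P Z := by
  intro ε hε
  obtain ⟨M, hM⟩ := hY (ε / 2) (by linarith)
  refine ⟨M, ?_⟩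
  filter_upwards [hM, whp_iff_forall_eps.1 h (ε / 2) (by linarith)] with n h1 h2
  rw [show ε = ε / 2 + ε / 2 by ring, ENNReal.ofReal_add (by linarith) (by linarith)]
  refine (measure_mono ?_).trans ((measure_union_le _ _).trans (add_le_add h1 h2))
  intro ω hω
  by_contra hc
  simp only [Set.mem_union, Set.mem_ofPred_eq, not_or, not_lt, not_not] at hc hω
  exact absurd hω (not_lt.2 (hc.2.trans hc.1))

end Bounded

lemma subMean_congr {g g' : Obs → ℝ} {n r : ℕ} {x : ℕ → Obs} {π : ℕ → ℝ} {K : ℕ → ℕ}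
    (hK : ValidDraws n (r - numFail (dataVec n x)) x K) (h : ∀ i < n, g (x i) = g' (x i)) :
    subMean g n r x π K = subMean g' n r x π K := by
  rw [subMean, subMean]
  congr 2
  · exact Finset.sum_congr rfl fun i hi => by rw [h i (Finset.mem_range.1 hi)]
  · exact Finset.sum_congr rfl fun j hj => by rw [h _ (hK j (Finset.mem_range.1 hj)).1]

namespace SubsampleScheme

variable {Ω : Type*} [MeasurableSpace Ω] {P : Measure Ω} [IsProbabilityMeasure P]
  {μ : ℕ → Measure Obs} [∀ n, IsProbabilityMeasure (μ n)]
  {X : ℕ → ℕ → Ω → Obs} {r : ℕ → ℕ} {γ : ℝ} {π : (n : ℕ) → (Fin n → Obs) → ℕ → ℝ}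
  {K : ℕ → ℕ → Ω → ℕ}

-- A modification of g on a null set is almost surely invisible on the whole sample, hence also on
-- the valid draws. This permits replacing an almost everywhere measurable g by a measurable
-- version.
omit [∀ n, IsProbabilityMeasure (μ n)] in
lemma whp_subMean_eq (S : SubsampleScheme P μ X r γ π K) {g g' : ℕ → Obs → ℝ}
    (h : ∀ n, g n =ᵐ[μ n] g' n) :
    Whp P fun n ω => subMean (g n) n (r n) (fun i => X n i ω) (π n (dataVec n fun i => X n i ω))
        (fun j => K n j ω)
      = fullMean (g' n) n (fun i => X n i ω) + drawErr (g' n) n (r n) (fun i => X n i ω)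
        (π n (dataVec n fun i => X n i ω)) (fun j => K n j ω) := by
  refine S.whp_valid.mono_ae (Eventually.of_forall fun n => ?_)
  filter_upwards [S.iid.ae_forall (h n)] with ω hω hv
  rw [subMean_congr hv.2 hω, subMean_eq hv.1 hv.2]

/-- Both sources of error, sampling of the data and drawing from them, are of order r^{-1/2}: the
first because r/n is bounded, the second by `boundedInProb_drawErr`. -/
lemma boundedInProb_subMean (S : SubsampleScheme P μ X r γ π K)
    {g : ℕ → Obs → ℝ} (hg2 : ∀ n, MemLp (g n) 2 (μ n)) {B : ℝ}
    (hB : ∀ n, ∫ x, g n x ^ 2 ∂(μ n) ≤ B) :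
    BoundedInProb P fun n ω => √(r n) * (subMean (g n) n (r n) (fun i => X n i ω)
      (π n (dataVec n fun i => X n i ω)) (fun j => K n j ω) - ∫ x, g n x ∂(μ n)) := by
  set g' : ℕ → Obs → ℝ := fun n => (hg2 n).aestronglyMeasurable.mk (g n) with hg'
  have hm : ∀ n, Measurable (g' n) := fun n =>
    (hg2 n).aestronglyMeasurable.stronglyMeasurable_mk.measurable
  have he : ∀ n, g n =ᵐ[μ n] g' n := fun n => (hg2 n).aestronglyMeasurable.ae_eq_mk
  have hL : ∀ n, MemLp (g' n) 2 (μ n) := fun n => (memLp_congr_ae (he n)).1 (hg2 n)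
  have hB' : ∀ n, ∫ x, g' n x ^ 2 ∂(μ n) ≤ B := fun n => by
    refine le_trans (le_of_eq (integral_congr_ae ?_)) (hB n)
    filter_upwards [he n] with x hx
    rw [hx]
  refine ((S.boundedInProb_fullMean hm hL hB').add (S.boundedInProb_drawErr hm hL hB')).congr_whp
    ((S.whp_subMean_eq he).mono fun n ω hω => ?_)
  rw [hω, integral_congr_ae (he n), ← mul_add]
  exact le_of_eq (by ring_nf)

lemma whp_abs_subMean_sub_le (S : SubsampleScheme P μ X r γ π K)
    {g : ℕ → Obs → ℝ} (hg2 : ∀ n, MemLp (g n) 2 (μ n)) {B : ℝ}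
    (hB : ∀ n, ∫ x, g n x ^ 2 ∂(μ n) ≤ B) {ε : ℝ} (hε : 0 < ε) :
    Whp P fun n ω => |subMean (g n) n (r n) (fun i => X n i ω)
      (π n (dataVec n fun i => X n i ω)) (fun j => K n j ω) - ∫ x, g n x ∂(μ n)| ≤ ε := by
  have hlim : Tendsto (fun n => (√(r n))⁻¹) atTop (𝓝 0) :=
    (Real.tendsto_sqrt_atTop.comp (tendsto_natCast_atTop_atTop.comp S.tendsto_r)).inv_tendsto_atTop
  refine ((S.boundedInProb_subMean hg2 hB).whp_mul_le hlim hε).mono_eventually ?_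
  filter_upwards [S.eventually_ratio_le] with n ⟨hr, _, _⟩ ω hω
  have : √(r n : ℝ) ≠ 0 := (Real.sqrt_pos.2 (by exact_mod_cast hr)).ne'
  rwa [inv_mul_cancel_left₀ this] at hω

lemma whp_abs_fullMean_sub_le (S : SubsampleScheme P μ X r γ π K)
    {g : ℕ → Obs → ℝ} (hg2 : ∀ n, MemLp (g n) 2 (μ n)) {B : ℝ}
    (hB : ∀ n, ∫ x, g n x ^ 2 ∂(μ n) ≤ B) {ε : ℝ} (hε : 0 < ε) :
    Whp P fun n ω => |fullMean (g n) n (fun i => X n i ω) - ∫ x, g n x ∂(μ n)| ≤ ε := by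
  set g' : ℕ → Obs → ℝ := fun n => (hg2 n).aestronglyMeasurable.mk (g n) with hg'
  have hm : ∀ n, Measurable (g' n) := fun n =>
    (hg2 n).aestronglyMeasurable.stronglyMeasurable_mk.measurable
  have he : ∀ n, g n =ᵐ[μ n] g' n := fun n => (hg2 n).aestronglyMeasurable.ae_eq_mk
  have hL : ∀ n, MemLp (g' n) 2 (μ n) := fun n => (memLp_congr_ae (he n)).1 (hg2 n)
  have hB' : ∀ n, ∫ x, g' n x ^ 2 ∂(μ n) ≤ B := fun n => by
    refine le_trans (le_of_eq (integral_congr_ae ?_)) (hB n)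
    filter_upwards [he n] with x hx
    rw [hx]
  have hlim : Tendsto (fun n => (√(r n))⁻¹) atTop (𝓝 0) :=
    (Real.tendsto_sqrt_atTop.comp (tendsto_natCast_atTop_atTop.comp S.tendsto_r)).inv_tendsto_atTop
  refine ((S.boundedInProb_fullMean hm hL hB').whp_mul_le hlim hε).mono_ae ?_
  filter_upwards [S.eventually_ratio_le] with n ⟨hr, _, _⟩
  filter_upwards [S.iid.ae_forall (he n)] with ω hω' hω
  have : √(r n : ℝ) ≠ 0 := (Real.sqrt_pos.2 (by exact_mod_cast hr)).ne'
  rw [inv_mul_cancel_left₀ this] at hω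
  rw [fullMean, Finset.sum_congr rfl fun i hi => hω' i (Finset.mem_range.1 hi),
    integral_congr_ae (he n)]
  exact hω

end SubsampleScheme

/-! ### The central limit theorem for subsample averages -/

/-- `norm_integral_exp_pow_sub_le` for the discrete law Σ wᵢ δᵢ, which will be the conditional law
of one draw. -/
lemma norm_sum_exp_pow_sub_le {n : ℕ} {w y : Fin n → ℝ} (hw : ∀ i, 0 ≤ w i)
    (hw1 : ∑ i, w i = 1) (hy : ∑ i, w i * y i = 0) {s : ℝ} (hs : 0 ≤ s) (m : ℕ) :
    ‖(∑ i, (w i : ℂ) * Complex.exp ((s * y i : ℝ) * Complex.I)) ^ m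
        - (Real.exp (-(m * s ^ 2 * (∑ i, w i * y i ^ 2) / 2)) : ℂ)‖
      ≤ 4 * (m * s ^ 2 * ∑ i, w i * (y i ^ 2 * min 1 (s * |y i|)))
        + m * (s ^ 2 * ∑ i, w i * y i ^ 2) ^ 2 := by
  set ν : Measure (Fin n) := ∑ i, ENNReal.ofReal (w i) • Measure.dirac i with hν
  have hprob : IsProbabilityMeasure ν := by
    refine ⟨?_⟩
    rw [hν, Measure.coe_finsetSum, Finset.sum_apply]
    simp only [Measure.smul_apply, measure_univ, smul_eq_mul, mul_one]
    rw [← ENNReal.ofReal_sum_of_nonneg fun i _ => hw i, hw1, ENNReal.ofReal_one]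
  have hfin : ∀ {E : Type} [NormedAddCommGroup E] [NormedSpace ℝ E] [CompleteSpace E]
      (h : Fin n → E), ∫ i, h i ∂ν = ∑ i, w i • h i := by
    intro E _ _ _ h
    rw [hν, integral_finsetSum_measure]
    · refine Finset.sum_congr rfl fun i _ => ?_
      rw [integral_smul_measure, integral_dirac, ENNReal.toReal_ofReal (hw i)]
    · intro i _
      exact (integrable_dirac (by simp)).smul_measure ENNReal.ofReal_ne_top
  have hL : MemLp y 2 ν := by
    refine MemLp.of_bound (C := ∑ i, |y i|) (measurable_of_countable y).aestronglyMeasurable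
      (ae_of_all _ fun i => ?_)
    exact Finset.single_le_sum (f := fun i => |y i|) (fun i _ => abs_nonneg _) (Finset.mem_univ i)
  have h := norm_integral_exp_pow_sub_le ν hL (by rw [hfin]; simpa using hy) hs m
  simp only [hfin, smul_eq_mul, Complex.real_smul] at h
  exact h

/-- The function u² min(1, su) is increasing on u ≥ 0, and doubling u costs at most 4 from the
square and 2 from the minimum. Thus |a - b| may be replaced by twice the larger of |a| and |b|,
which separates a draw from its centring. -/
lemma sub_sq_mul_min_le {s : ℝ} (hs : 0 ≤ s) (a b : ℝ) :
    (a - b) ^ 2 * min 1 (s * |a - b|)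
      ≤ 8 * (a ^ 2 * min 1 (s * |a|) + b ^ 2 * min 1 (s * |b|)) := by
  have mono : ∀ {u v : ℝ}, 0 ≤ u → u ≤ v → u ^ 2 * min 1 (s * u) ≤ v ^ 2 * min 1 (s * v) :=
    fun {u v} hu huv => mul_le_mul (pow_le_pow_left₀ hu huv 2)
      (min_le_min le_rfl (mul_le_mul_of_nonneg_left huv hs)) (by positivity) (sq_nonneg _)
  have dbl : ∀ {u : ℝ}, 0 ≤ u → (2 * u) ^ 2 * min 1 (s * (2 * u)) ≤ 8 * (u ^ 2 * min 1 (s * u)) := by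
    intro u hu
    have h1 : min 1 (s * (2 * u)) ≤ 2 * min 1 (s * u) := by
      rcases le_total 1 (s * u) with h | h
      · rw [min_eq_left h]; exact (min_le_left _ _).trans (by norm_num)
      · rw [min_eq_right h]; exact (min_le_right _ _).trans (by linarith)
    nlinarith [mul_le_mul_of_nonneg_left h1 (show 0 ≤ 4 * u ^ 2 by positivity)]
  have nn : ∀ c : ℝ, 0 ≤ |c| ^ 2 * min 1 (s * |c|) := fun c => by positivity
  have habs : |a - b| ≤ |a| + |b| := abs_sub _ _
  rw [← sq_abs (a - b), ← sq_abs a, ← sq_abs b]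
  rcases le_total |a| |b| with h | h
  · refine (mono (abs_nonneg _) (habs.trans (by linarith : |a| + |b| ≤ 2 * |b|))).trans
      ((dbl (abs_nonneg b)).trans ?_)
    linarith [nn a]
  · refine (mono (abs_nonneg _) (habs.trans (by linarith : |a| + |b| ≤ 2 * |a|))).trans
      ((dbl (abs_nonneg a)).trans ?_)
    linarith [nn b]

lemma censMean_sq_le {n : ℕ} (g : Obs → ℝ) (D : Fin n → Obs) :
    censMean g D ^ 2 ≤ (1 / (n : ℝ)) * ∑ i, g (D i) ^ 2 := by
  rcases Nat.eq_zero_or_pos n with rfl | hn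
  · simp [censMean]
  have hn' : (0 : ℝ) < n := by exact_mod_cast hn
  have h1 := sq_sum_le_card_mul_sum_sq (s := (Finset.univ : Finset (Fin n)))
    (f := fun i => if (D i).2.1 then g (D i) else 0)
  rw [Finset.card_univ, Fintype.card_fin] at h1
  have h2 : ∑ i, (if (D i).2.1 then g (D i) else 0) ^ 2 ≤ ∑ i, g (D i) ^ 2 :=
    Finset.sum_le_sum fun i _ => by split_ifs <;> simp [sq_nonneg]
  rw [censMean, mul_pow]
  calc (1 / (n : ℝ)) ^ 2 * (∑ i, if (D i).2.1 then g (D i) else 0) ^ 2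
      ≤ (1 / (n : ℝ)) ^ 2 * (n * ∑ i, g (D i) ^ 2) := by gcongr; exact h1.trans (by gcongr)
    _ = _ := by field_simp

/-- Lindeberg bound for the contribution of one draw. -/
lemma sum_drawProb_lindeberg_le {n : ℕ} {g : Obs → ℝ} {π : ℕ → ℝ} {D : Fin n → Obs}
    (hpos : ∀ i : Fin n, (D i).2.1 = true → 0 < π i) (hsum : ∑ i, drawProb π D i = 1) {M : ℝ}
    (hM : ∀ i : Fin n, (D i).2.1 = true → ((n : ℝ) * π i)⁻¹ ≤ M) (hM0 : 0 ≤ M) {s : ℝ}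
    (hs : 0 ≤ s) :
    ∑ i : Fin n, drawProb π D i * (drawDev g π D i ^ 2 * min 1 (s * |drawDev g π D i|))
      ≤ 8 * (M * ((1 / (n : ℝ)) * ∑ i, g (D i) ^ 2 * min 1 (s * M * |g (D i)|))
        + s * |censMean g D| ^ 3) := by
  have hw : ∀ i, 0 ≤ drawProb π D i := fun i => by
    rw [drawProb]
    split_ifs with h
    exacts [(hpos i h).le, le_rfl]
  have h1 : ∀ i : Fin n, drawProb π D i * (drawVal g π D i ^ 2 * min 1 (s * |drawVal g π D i|))
      ≤ M * ((1 / (n : ℝ)) * (g (D i) ^ 2 * min 1 (s * M * |g (D i)|))) := by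
    intro i
    rw [← mul_assoc, drawProb_mul_drawVal_sq hpos, drawVal, dif_pos i.2]
    by_cases hc : (D i).2.1 = true
    · have hn : (0 : ℝ) < n := by
        have : 0 < n := i.pos
        exact_mod_cast this
      have hp := hpos i hc
      have hMi := hM i hc
      have e : 1 / (n : ℝ) ^ 2 * (1 / π i * g (D i) ^ 2)
          = ((n : ℝ) * π i)⁻¹ * (1 / n * g (D i) ^ 2) := by rw [mul_inv]; ring
      have e2 : |g (D i) / (n * π i)| ≤ M * |g (D i)| := by
        rw [abs_div, abs_of_pos (mul_pos hn hp), div_eq_inv_mul]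
        exact mul_le_mul_of_nonneg_right hMi (abs_nonneg _)
      rw [if_pos hc, e]
      have e3 : min 1 (s * |g (D i) / (n * π i)|) ≤ min 1 (s * M * |g (D i)|) := by
        rw [mul_assoc]
        exact min_le_min le_rfl (mul_le_mul_of_nonneg_left e2 hs)
      calc ((n : ℝ) * π i)⁻¹ * (1 / n * g (D i) ^ 2) * min 1 (s * |g (D i) / (n * π i)|)
          ≤ M * (1 / n * g (D i) ^ 2) * min 1 (s * M * |g (D i)|) := by gcongr
        _ = _ := by ring
    · rw [if_neg hc]
      simp only [mul_zero, zero_mul]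
      positivity
  -- The centring is a bounded quantity, so here the cubic bound, with its factor s, is already
  -- negligible.
  have h2 : censMean g D ^ 2 * min 1 (s * |censMean g D|) ≤ s * |censMean g D| ^ 3 := by
    rw [← sq_abs]
    calc |censMean g D| ^ 2 * min 1 (s * |censMean g D|)
        ≤ |censMean g D| ^ 2 * (s * |censMean g D|) := by gcongr; exact min_le_right _ _
      _ = _ := by ring
  have h3 : ∀ i : Fin n, drawProb π D i * (drawDev g π D i ^ 2 * min 1 (s * |drawDev g π D i|))
      ≤ 8 * (M * ((1 / (n : ℝ)) * (g (D i) ^ 2 * min 1 (s * M * |g (D i)|))))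
        + 8 * (s * |censMean g D| ^ 3) * drawProb π D i := by
    intro i
    have := mul_le_mul_of_nonneg_left (sub_sq_mul_min_le hs (drawVal g π D i) (censMean g D)) (hw i)
    rw [drawDev]
    have h4 := mul_le_mul_of_nonneg_left h2 (hw i)
    linarith [h1 i]
  refine (Finset.sum_le_sum fun i _ => h3 i).trans (le_of_eq ?_)
  rw [Finset.sum_add_distrib, ← Finset.mul_sum, ← Finset.mul_sum, ← Finset.mul_sum,
    ← Finset.mul_sum, hsum]
  ring

/-- The conditional characteristic function of the draws, on good data. -/
lemma norm_charFun_draws_sub_le {n r : ℕ} {g : Obs → ℝ} {π : (Fin n → Obs) → ℕ → ℝ}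
    {D : Fin n → Obs} {δ M T η τ : ℝ} (hr : 0 < r) (hδ0 : 0 ≤ δ) (hδ : δ ≤ 1 / 2) (hM0 : 0 ≤ M)
    (hD : D ∈ goodData n r π δ M) (hpos : ∀ i : Fin n, (D i).2.1 = true → 0 < π D i)
    (hsum : ∑ i, drawProb (π D) D i = 1)
    (hT : (1 / (n : ℝ)) * ∑ i, g (D i) ^ 2 ≤ T)
    (hη : (1 / (n : ℝ)) * ∑ i, g (D i) ^ 2 * min 1 (2 * M / √r * |g (D i)|) ≤ η)
    (hτ0 : 0 ≤ τ) (hτ : |condVar g (π D) D - τ| ≤ η) :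
    ‖(∑ i : Fin n, (drawProb (π D) D i : ℂ) * Complex.exp
        ((√r / ((r - numFail D : ℕ) : ℝ) * drawDev g (π D) D i : ℝ) * Complex.I))
          ^ (r - numFail D) - (Real.exp (-(τ / 2)) : ℂ)‖
      ≤ 64 * (M * η + T * (1 + T) * (2 / √r)) + 8 * (M * T) ^ 2 / r + (η + δ * τ) := by
  have hr' : (0 : ℝ) < r := by exact_mod_cast hr
  have hm := le_sub_of_goodData hD
  set m := r - numFail D with hmdef
  have hmr : (m : ℝ) ≤ r := by exact_mod_cast Nat.sub_le _ _
  have hm0 : (0 : ℝ) < m := by nlinarith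
  have hm2 : (r : ℝ) / 2 ≤ m := by nlinarith
  have hsr : 0 < √(r : ℝ) := Real.sqrt_pos.2 hr'
  -- The scale of one summand in √r `drawErr`. The total variance factor m s² = r/m lies between 1
  -- and 2 and exceeds 1 by at most 2δ.
  set s := √(r : ℝ) / m with hsdef
  have hs0 : 0 ≤ s := by positivity
  have hss : √(r : ℝ) * √(r : ℝ) = r := Real.mul_self_sqrt hr'.le
  have hs2 : s ≤ 2 / √r := by
    rw [hsdef, div_le_div_iff₀ hm0 hsr, hss]; linarith
  have hms : m * s ^ 2 = r / m := by
    rw [hsdef, div_pow, Real.sq_sqrt hr'.le]; field_simp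
  have hrm1 : 1 ≤ (r : ℝ) / m := (one_le_div hm0).2 hmr
  have hrm2 : (r : ℝ) / m ≤ 2 := (div_le_iff₀ hm0).2 (by linarith)
  have hrm3 : (r : ℝ) / m - 1 ≤ 2 * δ := by
    rw [sub_le_iff_le_add, div_le_iff₀ hm0]
    nlinarith [mul_le_mul_of_nonneg_left hm (show 0 ≤ 2 * δ + 1 by linarith),
      mul_nonneg (mul_nonneg hδ0 hr'.le) (by linarith : 0 ≤ 1 - 2 * δ)]
  have hT0 : 0 ≤ T := le_trans (by positivity) hT
  set V := condVar g (π D) D with hV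
  have hV0 : 0 ≤ V := condVar_nonneg hpos hsum
  have hVM : V ≤ M * T := (condVar_le hD.2.2 hM0).trans (mul_le_mul_of_nonneg_left hT hM0)
  have hcm : |censMean g D| ^ 3 ≤ T * (1 + T) := by
    have h1 := (censMean_sq_le g D).trans hT
    rw [← sq_abs] at h1
    have h2 : |censMean g D| ≤ 1 + T := by nlinarith [abs_nonneg (censMean g D)]
    calc |censMean g D| ^ 3 = |censMean g D| ^ 2 * |censMean g D| := by ring
      _ ≤ T * (1 + T) := mul_le_mul h1 h2 (abs_nonneg _) hT0
  have hmain := norm_sum_exp_pow_sub_le (w := drawProb (π D) D)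
    (y := fun i : Fin n => drawDev g (π D) D i) (fun i => by
      rw [drawProb]; split_ifs with h
      exacts [(hpos i h).le, le_rfl]) hsum (sum_drawProb_mul_drawDev hpos hsum) hs0 m
  rw [sum_drawProb_mul_drawDev_sq hpos hsum, ← hV, hms] at hmain
  have hlin := sum_drawProb_lindeberg_le (g := g) hpos hsum hD.2.2 hM0 hs0
  have hlin2 : (1 / (n : ℝ)) * ∑ i, g (D i) ^ 2 * min 1 (s * M * |g (D i)|) ≤ η := by
    refine le_trans ?_ hη
    gcongr with i
    calc s * M ≤ 2 / √r * M := by gcongr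
      _ = 2 * M / √r := by ring
  have hη0 : 0 ≤ η := (abs_nonneg _).trans hτ
  have hlin3 : ∑ i : Fin n, drawProb (π D) D i *
      (drawDev g (π D) D i ^ 2 * min 1 (s * |drawDev g (π D) D i|))
      ≤ 8 * (M * η + T * (1 + T) * (2 / √r)) := by
    refine hlin.trans ?_
    have h5 : s * |censMean g D| ^ 3 ≤ 2 / √r * (T * (1 + T)) :=
      mul_le_mul hs2 hcm (by positivity) (by positivity)
    have h6 := mul_le_mul_of_nonneg_left hlin2 hM0
    linarith
  -- 64 = 4 · 2 · 8: Taylor remainder, bound on r/m, separation of the centring.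
  have hA : 4 * (r / m * ∑ i : Fin n, drawProb (π D) D i *
      (drawDev g (π D) D i ^ 2 * min 1 (s * |drawDev g (π D) D i|)))
      ≤ 64 * (M * η + T * (1 + T) * (2 / √r)) := by
    have h7 : (r : ℝ) / m * ∑ i : Fin n, drawProb (π D) D i *
      (drawDev g (π D) D i ^ 2 * min 1 (s * |drawDev g (π D) D i|))
      ≤ 2 * (8 * (M * η + T * (1 + T) * (2 / √r))) := by
      refine (mul_le_mul_of_nonneg_left hlin3 (by positivity)).trans
        (mul_le_mul_of_nonneg_right hrm2 (by positivity))
    linarith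
  have hB : (m : ℝ) * (s ^ 2 * V) ^ 2 ≤ 8 * (M * T) ^ 2 / r := by
    have h8 : (m : ℝ) * (s ^ 2 * V) ^ 2 = (r / m) ^ 2 * V ^ 2 / m := by
      rw [← hms]; field_simp
    rw [h8, div_le_div_iff₀ hm0 hr']
    have h9 : ((r : ℝ) / m) ^ 2 ≤ 4 := by nlinarith
    have h10 : V ^ 2 ≤ (M * T) ^ 2 := pow_le_pow_left₀ hV0 hVM 2
    calc ((r : ℝ) / m) ^ 2 * V ^ 2 * r ≤ 4 * (M * T) ^ 2 * (2 * m) := by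
          gcongr; linarith
      _ = _ := by ring
  -- Two replacements in the exponent: V by τ, at cost η, and r/m by 1, at cost δτ.
  have hC : ‖(Real.exp (-(r / m * V / 2)) : ℂ) - (Real.exp (-(τ / 2)) : ℂ)‖ ≤ η + δ * τ := by
    rw [← Complex.ofReal_sub, Complex.norm_real, Real.norm_eq_abs]
    refine (abs_exp_neg_sub_le (by positivity) (by positivity)).trans ?_
    have e : (r : ℝ) / m * V / 2 - τ / 2 = (r / m * (V - τ) + (r / m - 1) * τ) / 2 := by ring
    rw [e, abs_div, abs_of_pos (by norm_num : (0 : ℝ) < 2), div_le_iff₀ (by norm_num)]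
    refine (abs_add_le _ _).trans ?_
    rw [abs_mul, abs_mul, abs_of_nonneg (by linarith : (0 : ℝ) ≤ r / m),
      abs_of_nonneg (by linarith : (0 : ℝ) ≤ r / m - 1), abs_of_nonneg hτ0]
    have h11 : (r : ℝ) / m * |V - τ| ≤ 2 * η :=
      mul_le_mul hrm2 hτ (abs_nonneg _) (by norm_num)
    have h12 := mul_le_mul_of_nonneg_right hrm3 hτ0
    linarith
  refine (norm_sub_le_norm_sub_add_norm_sub _ _ _).trans (add_le_add (hmain.trans
    (add_le_add hA hB)) hC)

/-- Square-integrability that is uniform along the laws, in the form of a truncated third moment. -/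
def UnifLindeberg (μ : ℕ → Measure Obs) (g : ℕ → Obs → ℝ) : Prop :=
  ∀ ε : ℝ, 0 < ε → ∃ t : ℝ, 0 < t ∧ ∀ n, ∫ x, g n x ^ 2 * min 1 (t * |g n x|) ∂(μ n) ≤ ε

lemma integrable_sq_mul_min {α : Type*} [MeasurableSpace α] {ν : Measure α} {g : α → ℝ}
    (hg : MemLp g 2 ν) {t : ℝ} (ht : 0 ≤ t) :
    Integrable (fun x => g x ^ 2 * min 1 (t * |g x|)) ν := by
  refine hg.integrable_sq.mono' ?_ (ae_of_all _ fun a => ?_)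
  · exact ((by fun_prop : Continuous fun y : ℝ => y ^ 2 * min 1 (t * |y|))).comp_aestronglyMeasurable
      hg.aestronglyMeasurable
  · rw [Real.norm_of_nonneg (by positivity)]
    exact mul_le_of_le_one_right (sq_nonneg _) (min_le_left _ _)

lemma integral_sq_mul_min_mono {α : Type*} [MeasurableSpace α] {ν : Measure α} {g : α → ℝ}
    (hg : MemLp g 2 ν) {s t : ℝ} (hs : 0 ≤ s) (hst : s ≤ t) :
    ∫ x, g x ^ 2 * min 1 (s * |g x|) ∂ν ≤ ∫ x, g x ^ 2 * min 1 (t * |g x|) ∂ν :=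
  integral_mono (integrable_sq_mul_min hg hs) (integrable_sq_mul_min hg (hs.trans hst)) fun x => by
    simp only
    gcongr

namespace SubsampleScheme

variable {Ω : Type*} [MeasurableSpace Ω] {P : Measure Ω} [IsProbabilityMeasure P]
  {μ : ℕ → Measure Obs} [∀ n, IsProbabilityMeasure (μ n)]
  {X : ℕ → ℕ → Ω → Obs} {r : ℕ → ℕ} {γ : ℝ} {π : (n : ℕ) → (Fin n → Obs) → ℕ → ℝ}
  {K : ℕ → ℕ → Ω → ℕ}

omit [IsProbabilityMeasure P] [∀ n, IsProbabilityMeasure (μ n)] in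
lemma tendsto_natCast_r (S : SubsampleScheme P μ X r γ π K) :
    Tendsto (fun n => (r n : ℝ)) atTop atTop :=
  tendsto_natCast_atTop_atTop.comp S.tendsto_r

lemma tendsto_const_div_sqrt (S : SubsampleScheme P μ X r γ π K) (c : ℝ) :
    Tendsto (fun n => c / √(r n)) atTop (𝓝 0) :=
  tendsto_const_nhds.div_atTop (Real.tendsto_sqrt_atTop.comp S.tendsto_natCast_r)

/-- The central limit theorem for the full-data average. -/
lemma tendsto_charFun_fullMean (S : SubsampleScheme P μ X r γ π K)
    {g : ℕ → Obs → ℝ} (hg : ∀ n, Measurable (g n)) (hg2 : ∀ n, MemLp (g n) 2 (μ n)) {B : ℝ}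
    (hB : ∀ n, ∫ x, g n x ^ 2 ∂(μ n) ≤ B) (h0 : ∀ n, ∫ x, g n x ∂(μ n) = 0)
    (hUI : UnifLindeberg μ g) :
    Tendsto (fun n => ∫ ω, Complex.exp ((√(r n) * fullMean (g n) n (fun i => X n i ω) : ℝ)
        * Complex.I) ∂P - (Real.exp (-(γ * (∫ x, g n x ^ 2 ∂(μ n)) / 2)) : ℂ)) atTop (𝓝 0) := by
  have hγ := S.gamma_nonneg
  have hB0 : 0 ≤ B := (integral_nonneg fun x => sq_nonneg _).trans (hB 0)
  rw [Metric.tendsto_nhds]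
  intro ε hε
  obtain ⟨t, ht, htn⟩ := hUI (ε / (16 * (γ + 1))) (by positivity)
  -- Each observation enters with scale √r/n = (r/n)/√r; its vanishing is what makes the Lindeberg
  -- remainder small.
  have hs : Tendsto (fun n => √(r n : ℝ) / n) atTop (𝓝 0) := by
    have h1 : Tendsto (fun n => (r n : ℝ) / n * (√(r n : ℝ))⁻¹) atTop (𝓝 (γ * 0)) :=
      S.ratio.mul (Real.tendsto_sqrt_atTop.comp S.tendsto_natCast_r).inv_tendsto_atTop
    rw [mul_zero] at h1
    refine h1.congr' ?_
    filter_upwards [S.eventually_ratio_le] with n ⟨hr, _, _⟩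
    have h3 : 0 < √(r n : ℝ) := Real.sqrt_pos.2 (by exact_mod_cast hr)
    have h4 : √(r n : ℝ) * √(r n : ℝ) = r n := Real.mul_self_sqrt (Nat.cast_nonneg _)
    have h5 : (r n : ℝ) * (√(r n : ℝ))⁻¹ = √(r n : ℝ) :=
      (mul_inv_eq_iff_eq_mul₀ h3.ne').2 h4.symm
    rw [div_mul_eq_mul_div, h5]
  have h2 : Tendsto (fun n : ℕ => ((γ + 1) * B) ^ 2 / (n : ℝ)) atTop (𝓝 0) :=
    tendsto_const_div_atTop_nhds_zero_nat _
  have h3 : Tendsto (fun n => |(r n : ℝ) / n - γ| * B) atTop (𝓝 0) := by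
    have := ((S.ratio.sub_const γ).abs.mul_const B)
    simpa using this
  filter_upwards [S.eventually_ratio_le, hs.eventually_le_const ht,
    h2.eventually_lt_const (show (0 : ℝ) < ε / 4 by linarith),
    h3.eventually_lt_const (show (0 : ℝ) < ε / 4 by linarith)] with n ⟨hr, hn, hrn⟩ hst h2n h3n
  have hn' : (0 : ℝ) < n := by exact_mod_cast hn
  have hr' : (0 : ℝ) < r n := by exact_mod_cast hr
  set s := √(r n : ℝ) / n with hsdef
  have hs0 : 0 ≤ s := by positivity
  have hns : n * s ^ 2 = r n / n := by
    rw [hsdef, div_pow, Real.sq_sqrt hr'.le]; field_simp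
  set σ := ∫ x, g n x ^ 2 ∂(μ n) with hσ
  have hσ0 : 0 ≤ σ := integral_nonneg fun x => sq_nonneg _
  have e1 : ∀ ω, √(r n : ℝ) * fullMean (g n) n (fun i => X n i ω)
      = s * ∑ i ∈ Finset.range n, g n (X n i ω) := fun ω => by
    rw [fullMean, hsdef]; ring
  simp_rw [e1]
  rw [S.iid.integral_exp_sum n (hg n) s, dist_zero_right]
  have hmain := norm_integral_exp_pow_sub_le (μ n) (hg2 n) (h0 n) hs0 n
  rw [hns, ← hσ] at hmain
  have hA : 4 * ((r n : ℝ) / n * ∫ x, g n x ^ 2 * min 1 (s * |g n x|) ∂(μ n)) ≤ ε / 4 := by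
    have h5 : (r n : ℝ) / n * ∫ x, g n x ^ 2 * min 1 (s * |g n x|) ∂(μ n)
        ≤ (γ + 1) * (ε / (16 * (γ + 1))) :=
      mul_le_mul hrn ((integral_sq_mul_min_mono (hg2 n) hs0 hst).trans (htn n))
        (integral_nonneg fun x => by positivity) (by positivity)
    have h6 : (γ + 1) * (ε / (16 * (γ + 1))) = ε / 16 := by field_simp
    linarith
  have hBn : (n : ℝ) * (s ^ 2 * σ) ^ 2 ≤ ((γ + 1) * B) ^ 2 / n := by
    have h8 : (n : ℝ) * (s ^ 2 * σ) ^ 2 = (r n / n * σ) ^ 2 / n := by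
      rw [← hns]; field_simp
    rw [h8]
    gcongr
    exact hB n
  have hC : ‖(Real.exp (-(r n / n * σ / 2)) : ℂ) - (Real.exp (-(γ * σ / 2)) : ℂ)‖
      ≤ |(r n : ℝ) / n - γ| * B := by
    rw [← Complex.ofReal_sub, Complex.norm_real, Real.norm_eq_abs]
    refine (abs_exp_neg_sub_le (by positivity) (by positivity)).trans ?_
    have e : (r n : ℝ) / n * σ / 2 - γ * σ / 2 = (r n / n - γ) * (σ / 2) := by ring
    rw [e, abs_mul, abs_of_nonneg (by positivity : 0 ≤ σ / 2)]
    gcongr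
    linarith [hB n]
  have := norm_sub_le_norm_sub_add_norm_sub
    ((∫ x, Complex.exp ((s * g n x : ℝ) * Complex.I) ∂(μ n)) ^ n)
    (Real.exp (-(r n / n * σ / 2)) : ℂ) (Real.exp (-(γ * σ / 2)) : ℂ)
  linarith

omit [∀ n, IsProbabilityMeasure (μ n)] in
/-- Conditionally on the data, the fluctuation of the draws can be replaced by a constant. -/
lemma norm_integral_exp_sub_mul_le (S : SubsampleScheme P μ X r γ π K) {n : ℕ} {g : Obs → ℝ}
    (hg : Measurable g) {A : Set (Fin n → Obs)} (hA : MeasurableSet A)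
    (hAc : ∀ D ∈ A, ∃ i, (D i).2.1 = true) {κ : ℝ} (hκ0 : 0 ≤ κ) (hκ : κ ≤ 1) {b : ℝ} (hb : 0 ≤ b)
    (hAb : ∀ D ∈ A, ‖(∑ i : Fin n, (drawProb (π n D) D i : ℂ) * Complex.exp
        ((√(r n) / ((r n - numFail D : ℕ) : ℝ) * drawDev g (π n D) D i : ℝ) * Complex.I))
          ^ (r n - numFail D) - (κ : ℂ)‖ ≤ b) :
    ‖(∫ ω, Complex.exp ((√(r n) * (fullMean g n (fun i => X n i ω) + drawErr g n (r n)
          (fun i => X n i ω) (π n (dataVec n fun i => X n i ω)) (fun j => K n j ω)) : ℝ)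
          * Complex.I) ∂P)
        - κ * ∫ ω, Complex.exp ((√(r n) * fullMean g n (fun i => X n i ω) : ℝ) * Complex.I) ∂P‖
      ≤ b + 2 * P.real {ω | dataVec n (fun i => X n i ω) ∉ A} := by
  have T := S.setup n
  have hD := measurable_dataVec n T.measX
  have hAm := T.measurableSet_data hA
  set A' := {ω | dataVec n (fun i => X n i ω) ∈ A} with hA'
  have hexp : Measurable fun y : ℝ => Complex.exp ((y : ℂ) * Complex.I) := by fun_prop
  set a : Ω → ℝ := fun ω => √(r n) * fullMean g n (fun i => X n i ω) with ha
  set e : Ω → ℝ := fun ω => √(r n) * drawErr g n (r n)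
          (fun i => X n i ω) (π n (dataVec n fun i => X n i ω)) (fun j => K n j ω) with he
  have ham : Measurable a := (measurable_fullMean hg S.iid n).const_mul _
  have hem : Measurable e := (T.measurable_drawErr hg).const_mul _
  have hbd : ∀ y : ℝ, ‖Complex.exp ((y : ℂ) * Complex.I)‖ = 1 := Complex.norm_exp_ofReal_mul_I
  have hiE : ∀ f : Ω → ℝ, Measurable f → Integrable (fun ω => Complex.exp ((f ω : ℂ) * Complex.I)) P :=
    fun f hf => Integrable.of_bound (C := 1) (hexp.comp hf).aestronglyMeasurable
      (ae_of_all _ fun ω => (hbd _).le)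
  -- On A the first factor depends on the data only, so averaging over the draws replaces exp(i e)
  -- by its conditional characteristic function, which is within b of κ. Off A the bound ‖F‖ ≤ 2
  -- suffices.
  set F : Ω → ℂ := fun ω => Complex.exp ((a ω : ℂ) * Complex.I) *
    (Complex.exp ((e ω : ℂ) * Complex.I) - κ) with hF
  have hsplit : ∀ ω, F ω = Complex.exp (((a ω + e ω : ℝ) : ℂ) * Complex.I)
      - κ * Complex.exp ((a ω : ℂ) * Complex.I) := fun ω => by
    rw [hF]; push_cast; rw [add_mul, Complex.exp_add]; ring
  have hFi : Integrable F P := by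
    have : F = fun ω => Complex.exp (((a ω + e ω : ℝ) : ℂ) * Complex.I)
      - κ * Complex.exp ((a ω : ℂ) * Complex.I) := funext hsplit
    rw [this]
    exact (hiE (fun ω => a ω + e ω) (ham.add hem)).sub ((hiE a ham).const_mul _)
  have hFn : ∀ ω, ‖F ω‖ ≤ 2 := fun ω => by
    rw [hF, norm_mul, hbd, one_mul]
    refine (norm_sub_le _ _).trans ?_
    rw [hbd, Complex.norm_real, Real.norm_of_nonneg hκ0]
    linarith
  have hint : (∫ ω, Complex.exp ((√(r n) * (fullMean g n (fun i => X n i ω) + drawErr g n (r n)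
          (fun i => X n i ω) (π n (dataVec n fun i => X n i ω)) (fun j => K n j ω)) : ℝ)
          * Complex.I) ∂P)
        - κ * ∫ ω, Complex.exp ((√(r n) * fullMean g n (fun i => X n i ω) : ℝ) * Complex.I) ∂P
      = ∫ ω, F ω ∂P := by
    rw [integral_congr_ae (ae_of_all P hsplit), integral_sub
      (hiE (fun ω => a ω + e ω) (ham.add hem)) ((hiE a ham).const_mul _), integral_const_mul]
    simp_rw [ha, he, mul_add]
  rw [hint, ← integral_add_compl hAm hFi]
  refine (norm_add_le _ _).trans (add_le_add ?_ ?_)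
  · set c : (Fin n → Obs) → ℂ := fun D =>
      Complex.exp (((√(r n) * ((1 / (n : ℝ)) * ∑ i, g (D i)) : ℝ) : ℂ) * Complex.I) with hc
    set φ : (Fin n → Obs) → ℕ → ℂ := fun D i => Complex.exp
        ((√(r n) / ((r n - numFail D : ℕ) : ℝ) * drawDev g (π n D) D i : ℝ) * Complex.I) with hφ
    have hcm : Measurable c := hexp.comp (((Finset.measurable_sum _ fun i _ =>
      hg.comp (measurable_pi_apply i)).const_mul _).const_mul _)
    have hφm : ∀ i, Measurable fun D => φ D i := fun i => hexp.comp
      (((measurable_from_nat (f := fun k : ℕ => √(r n : ℝ) / (k : ℝ))).comp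
        (measurable_const.sub (measurable_numFail n))).mul (measurable_drawDev T.measπ hg i))
    have hca : ∀ ω, c (dataVec n fun i => X n i ω) = Complex.exp ((a ω : ℂ) * Complex.I) := by
      intro ω
      simp only [hc, ha, fullMean, Finset.sum_range]; rfl
    have hφe : ∀ ω, ∏ j ∈ Finset.range (r n - numFail (dataVec n fun i => X n i ω)),
        φ (dataVec n fun i => X n i ω) (K n j ω) = Complex.exp ((e ω : ℂ) * Complex.I) := by
      intro ω
      simp only [hφ, he, drawErr]
      rw [← Complex.exp_sum, ← Finset.sum_mul, ← Complex.ofReal_sum, ← Finset.mul_sum]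
      congr 3
      ring
    have h1 := T.integral_prod_draws hA hAc hcm (fun D => (hbd _).le) hφm (fun D i => (hbd _).le)
      (by simp_rw [hφe]; exact hexp.comp hem)
    simp_rw [hca, hφe] at h1
    have h2 : ∫ ω in A', F ω ∂P = ∫ ω in A', Complex.exp ((a ω : ℂ) * Complex.I) *
          ((∑ i : Fin n, (drawProb (π n (dataVec n fun i => X n i ω))
            (dataVec n fun i => X n i ω) i : ℂ) * φ (dataVec n fun i => X n i ω) i)
              ^ (r n - numFail (dataVec n fun i => X n i ω)) - κ) ∂P := by
      have hi1 : Integrable (fun ω => Complex.exp ((a ω : ℂ) * Complex.I)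
          * Complex.exp ((e ω : ℂ) * Complex.I)) P :=
        (hiE (fun ω => a ω + e ω) (ham.add hem)).congr (ae_of_all _ fun ω => by
          simp only []; push_cast; rw [add_mul, Complex.exp_add])
      have hi2 : IntegrableOn (fun ω => Complex.exp ((a ω : ℂ) * Complex.I) *
          (∑ i : Fin n, (drawProb (π n (dataVec n fun i => X n i ω))
            (dataVec n fun i => X n i ω) i : ℂ) * φ (dataVec n fun i => X n i ω) i)
              ^ (r n - numFail (dataVec n fun i => X n i ω))) A' P := by
        have hpm := measurable_pow_numFail (r := r n) (Finset.measurable_sum (Finset.univ : Finset (Fin n))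
          fun i _ => (Complex.measurable_ofReal.comp (measurable_drawProb T.measπ i)).mul (hφm i))
        refine Integrable.of_bound (C := 1) (((hexp.comp ham).mul
          (hpm.comp hD))).aestronglyMeasurable
          ((ae_restrict_iff' hAm).2 (ae_of_all _ fun ω hω => ?_))
        rw [norm_mul, hbd, one_mul, norm_pow]
        refine pow_le_one₀ (norm_nonneg _) ((norm_sum_le _ _).trans ?_)
        rw [← T.sum_eq_one _ (hAc _ hω)]
        refine Finset.sum_le_sum fun i _ => ?_
        rw [norm_mul, Complex.norm_real, Real.norm_of_nonneg (T.drawProb_nonneg _ _), hφ, hbd,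
          mul_one]
      simp_rw [hF, mul_sub]
      rw [integral_sub hi1.integrableOn ((hiE a ham).mul_const _).integrableOn, h1,
        integral_sub hi2 ((hiE a ham).mul_const _).integrableOn]
    rw [h2]
    have h3 := norm_setIntegral_le_of_norm_le_const (μ := P) (s := A') (C := b)
      (f := fun ω => Complex.exp ((a ω : ℂ) * Complex.I) *
          ((∑ i : Fin n, (drawProb (π n (dataVec n fun i => X n i ω))
            (dataVec n fun i => X n i ω) i : ℂ) * φ (dataVec n fun i => X n i ω) i)
              ^ (r n - numFail (dataVec n fun i => X n i ω)) - κ)) (measure_lt_top _ _)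
      (fun ω hω => by rw [norm_mul, hbd, one_mul]; exact hAb _ hω)
    refine h3.trans (mul_le_of_le_one_right hb measureReal_le_one)
  · exact norm_setIntegral_le_of_norm_le_const (measure_lt_top _ _) fun ω _ => hFn ω

end SubsampleScheme

namespace SubsampleScheme

variable {Ω : Type*} [MeasurableSpace Ω] {P : Measure Ω} [IsProbabilityMeasure P]
  {μ : ℕ → Measure Obs}
  {X : ℕ → ℕ → Ω → Obs} {r : ℕ → ℕ} {γ : ℝ} {π : (n : ℕ) → (Fin n → Obs) → ℕ → ℝ}
  {K : ℕ → ℕ → Ω → ℕ}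

omit [IsProbabilityMeasure P] in
lemma measure_fullMean_gt_le (S : SubsampleScheme P μ X r γ π K) (n : ℕ) {h : Obs → ℝ}
    (hh : Measurable h) (h0 : ∀ x, 0 ≤ h x) (hi : Integrable h (μ n)) {C c : ℝ} (hc : 0 < c)
    (hC : ∫ x, h x ∂(μ n) ≤ C) :
    P {ω | c < fullMean h n fun i => X n i ω} ≤ ENNReal.ofReal (C / c) := by
  refine measure_lt_le_of_lintegral_le (measurable_fullMean hh S.iid n).aemeasurable hc
    ((S.iid.lintegral_fullMean_le n hh h0).trans ?_)
  rw [← ofReal_integral_eq_lintegral_ofReal hi (ae_of_all _ h0)]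
  exact ENNReal.ofReal_le_ofReal hC

/-- Asymptotic independence of data and draws: on data that are good, with bounded mean square,
small truncated moment and conditional variance near `τ n`, the draws have conditional
characteristic function close to the constant exp(-τ/2), which leaves the integral. Such data have
probability close to one. -/
lemma tendsto_charFun_sub_mul [∀ n, IsProbabilityMeasure (μ n)] (S : SubsampleScheme P μ X r γ π K)
    {g : ℕ → Obs → ℝ} (hg : ∀ n, Measurable (g n)) (hg2 : ∀ n, MemLp (g n) 2 (μ n)) {B : ℝ}
    (hB : ∀ n, ∫ x, g n x ^ 2 ∂(μ n) ≤ B) (hUI : UnifLindeberg μ g)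
    {τ : ℕ → ℝ} {τmax : ℝ} (hτ0 : ∀ n, 0 ≤ τ n) (hτmax : ∀ n, τ n ≤ τmax)
    (hτ : ∀ ε : ℝ, 0 < ε → Whp P fun n ω => |condVar (g n) (π n (dataVec n fun i => X n i ω))
      (dataVec n fun i => X n i ω) - τ n| ≤ ε) :
    Tendsto (fun n => (∫ ω, Complex.exp ((√(r n) * (fullMean (g n) n (fun i => X n i ω)
          + drawErr (g n) n (r n) (fun i => X n i ω) (π n (dataVec n fun i => X n i ω))
            (fun j => K n j ω)) : ℝ) * Complex.I) ∂P)
        - (Real.exp (-(τ n / 2)) : ℂ) * ∫ ω, Complex.exp ((√(r n) *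
          fullMean (g n) n (fun i => X n i ω) : ℝ) * Complex.I) ∂P) atTop (𝓝 0) := by
  have hB0 : 0 ≤ B := (integral_nonneg fun x => sq_nonneg _).trans (hB 0)
  have hτm : 0 ≤ τmax := (hτ0 0).trans (hτmax 0)
  rw [Metric.tendsto_nhds]
  intro ε' hε'
  -- The error budget: ε from the terms in η, ε from those vanishing with r, ε from δτ, and 2 · 4ε
  -- from the four exceptional events; 11ε in all.
  set ε := ε' / 13 with hεdef
  have hε : 0 < ε := by positivity
  set δ := min (1 / 2) (ε / (τmax + 1)) with hδ
  have hδ0 : 0 < δ := lt_min (by norm_num) (by positivity)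
  obtain ⟨M, hM0, hM⟩ := S.exists_goodData hδ0 hε
  set T := (B + 1) / ε with hT
  have hT0 : 0 < T := by positivity
  set η := ε / (64 * M + 1) with hη
  have hη0 : 0 < η := by positivity
  -- A mean of at most εη lets Markov's inequality at threshold η give probability at most ε.
  obtain ⟨t, ht, htn⟩ := hUI (ε * η) (by positivity)
  have hl1 := S.tendsto_const_div_sqrt (2 * M)
  have hl2 : Tendsto (fun n => 64 * (T * (1 + T) * (2 / √(r n))) + 8 * (M * T) ^ 2 / r n) atTop
      (𝓝 (64 * (T * (1 + T) * 0) + 0)) :=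
    (((S.tendsto_const_div_sqrt 2).const_mul _).const_mul _).add
      (tendsto_const_nhds.div_atTop S.tendsto_natCast_r)
  have hε2 : 64 * (T * (1 + T) * 0) + 0 < ε := by simpa using hε
  filter_upwards [hM, S.eventually_ratio_le, hl1.eventually_le_const ht,
    hl2.eventually_lt_const hε2, whp_iff_forall_eps.1 (hτ η hη0) ε hε]
    with n h1 ⟨hr, hn, hrn⟩ hst hsmall h4
  have hsr : 0 < √(r n : ℝ) := Real.sqrt_pos.2 (by exact_mod_cast hr)
  have hm2 : Measurable fun x => g n x ^ 2 := (hg n).pow_const 2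
  have hm3 : Measurable fun x => g n x ^ 2 * min 1 (2 * M / √(r n) * |g n x|) :=
    hm2.mul (measurable_const.min ((hg n).abs.const_mul _))
  have h2 : P {ω | T < fullMean (fun x => g n x ^ 2) n fun i => X n i ω} ≤ ENNReal.ofReal ε := by
    refine (S.measure_fullMean_gt_le n hm2 (fun x => sq_nonneg _) (hg2 n).integrable_sq hT0
      (hB n)).trans (ENNReal.ofReal_le_ofReal ?_)
    rw [hT, div_div_eq_mul_div, div_le_iff₀ (by positivity)]
    nlinarith
  have h3 : P {ω | η < fullMean (fun x => g n x ^ 2 * min 1 (2 * M / √(r n) * |g n x|)) n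
      fun i => X n i ω} ≤ ENNReal.ofReal ε := by
    refine (S.measure_fullMean_gt_le n hm3 (fun x => by positivity)
      (integrable_sq_mul_min (hg2 n) (by positivity)) hη0
      ((integral_sq_mul_min_mono (hg2 n) (by positivity) hst).trans (htn n))).trans
      (ENNReal.ofReal_le_ofReal ?_)
    rw [mul_div_cancel_right₀ _ hη0.ne']
  set A : Set (Fin n → Obs) := goodData n (r n) (π n) δ M ∩
    ({D | (1 / (n : ℝ)) * ∑ i, g n (D i) ^ 2 ≤ T} ∩
    ({D | (1 / (n : ℝ)) * ∑ i, g n (D i) ^ 2 * min 1 (2 * M / √(r n) * |g n (D i)|) ≤ η} ∩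
      {D | |condVar (g n) (π n D) D - τ n| ≤ η})) with hAdef
  have hA : MeasurableSet A := by
    refine (measurableSet_goodData (S.prob.measurable n) δ M).inter
      ((measurableSet_le ((Finset.measurable_sum _ fun i _ =>
        hm2.comp (measurable_pi_apply i)).const_mul _) measurable_const).inter
      ((measurableSet_le ((Finset.measurable_sum _ fun i _ =>
        hm3.comp (measurable_pi_apply i)).const_mul _) measurable_const).inter
        (measurableSet_le ((measurable_condVar (S.prob.measurable n) (hg n)).sub_const _).abs
          measurable_const)))
  have hfm : ∀ (h : Obs → ℝ) ω, fullMean h n (fun i => X n i ω)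
      = (1 / (n : ℝ)) * ∑ i, h (dataVec n (fun i => X n i ω) i) := fun h ω => by
    rw [fullMean, Finset.sum_range]; rfl
  have hPA : P {ω | dataVec n (fun i => X n i ω) ∉ A}
      ≤ ENNReal.ofReal ε + (ENNReal.ofReal ε + (ENNReal.ofReal ε + ENNReal.ofReal ε)) := by
    refine (measure_mono ?_).trans ((measure_union_le _ _).trans (add_le_add h1
      ((measure_union_le _ _).trans (add_le_add h2 ((measure_union_le _ _).trans
        (add_le_add h3 h4))))))
    intro ω hω
    by_contra hc
    simp only [Set.mem_union, Set.mem_ofPred_eq, not_or, not_not, not_lt, hfm] at hc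
    exact hω ⟨hc.1, hc.2.1, hc.2.2.1, hc.2.2.2⟩
  have hPA' : P.real {ω | dataVec n (fun i => X n i ω) ∉ A} ≤ 4 * ε := by
    refine ENNReal.toReal_le_of_le_ofReal (by positivity) (hPA.trans (le_of_eq ?_))
    rw [← ENNReal.ofReal_add hε.le hε.le, ← ENNReal.ofReal_add hε.le (by positivity),
      ← ENNReal.ofReal_add hε.le (by positivity)]
    ring_nf
  set b := 64 * (M * η + T * (1 + T) * (2 / √(r n))) + 8 * (M * T) ^ 2 / r n + (η + δ * τ n) with hb
  have hb0 : 0 ≤ b := by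
    have := hτ0 n
    positivity
  have hmain := S.norm_integral_exp_sub_mul_le (hg n) hA (fun D hD => hD.1.1)
    (Real.exp_pos (-(τ n / 2))).le (Real.exp_le_one_iff.2 (by linarith [hτ0 n])) hb0
    (fun D hD => norm_charFun_draws_sub_le hr hδ0.le (min_le_left _ _) hM0.le hD.1
      ((S.setup n).pos D) ((S.setup n).sum_eq_one D hD.1.1) hD.2.1 hD.2.2.1 (hτ0 n) hD.2.2.2)
  rw [dist_zero_right]
  have hδτ : δ * τ n ≤ ε := by
    calc δ * τ n ≤ ε / (τmax + 1) * (τmax + 1) := by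
          refine mul_le_mul (min_le_right _ _) ((hτmax n).trans (by linarith)) (hτ0 n) (by positivity)
      _ = ε := by field_simp
  have hη1 : 64 * (M * η) + η = ε := by
    rw [hη]; field_simp
  have hε13 : ε' = 13 * ε := by rw [hεdef]; ring
  linarith

/-- The central limit theorem for subsample averages, in terms of characteristic functions, for
laws and functions that may vary with the sample size. -/
theorem tendsto_charFun [∀ n, IsProbabilityMeasure (μ n)] (S : SubsampleScheme P μ X r γ π K)
    {g : ℕ → Obs → ℝ} (hg2 : ∀ n, MemLp (g n) 2 (μ n)) {B : ℝ}
    (hB : ∀ n, ∫ x, g n x ^ 2 ∂(μ n) ≤ B) (h0 : ∀ n, ∫ x, g n x ∂(μ n) = 0)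
    (hUI : UnifLindeberg μ g)
    {τ : ℕ → ℝ} {τmax : ℝ} (hτ0 : ∀ n, 0 ≤ τ n) (hτmax : ∀ n, τ n ≤ τmax)
    (hτ : ∀ ε : ℝ, 0 < ε → Whp P fun n ω => |condVar (g n) (π n (dataVec n fun i => X n i ω))
      (dataVec n fun i => X n i ω) - τ n| ≤ ε)
    {a : ℕ → Ω → ℝ} (ham : ∀ n, AEMeasurable (a n) P)
    (ha : ∀ ε : ℝ, 0 < ε → Whp P fun n ω => |a n ω - √(r n) * subMean (g n) n (r n)
      (fun i => X n i ω) (π n (dataVec n fun i => X n i ω)) (fun j => K n j ω)| ≤ ε) :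
    Tendsto (fun n => (∫ ω, Complex.exp ((a n ω : ℂ) * Complex.I) ∂P)
        - (Real.exp (-((τ n + γ * ∫ x, g n x ^ 2 ∂(μ n)) / 2)) : ℂ)) atTop (𝓝 0) := by
  -- Only almost everywhere measurability of `g n` is available, whereas conditioning on the data
  -- needs measurable functions; every hypothesis passes to the version.
  set g' : ℕ → Obs → ℝ := fun n => (hg2 n).aestronglyMeasurable.mk (g n) with hg'
  have hm : ∀ n, Measurable (g' n) := fun n =>
    (hg2 n).aestronglyMeasurable.stronglyMeasurable_mk.measurable
  have he : ∀ n, g n =ᵐ[μ n] g' n := fun n => (hg2 n).aestronglyMeasurable.ae_eq_mk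
  have hL : ∀ n, MemLp (g' n) 2 (μ n) := fun n => (memLp_congr_ae (he n)).1 (hg2 n)
  have hsq : ∀ n, ∫ x, g' n x ^ 2 ∂(μ n) = ∫ x, g n x ^ 2 ∂(μ n) := fun n => by
    refine integral_congr_ae ?_
    filter_upwards [he n] with x hx
    rw [hx]
  have hB' : ∀ n, ∫ x, g' n x ^ 2 ∂(μ n) ≤ B := fun n => (hsq n).trans_le (hB n)
  have h0' : ∀ n, ∫ x, g' n x ∂(μ n) = 0 := fun n => by
    rw [← integral_congr_ae (he n)]; exact h0 n
  have hUI' : UnifLindeberg μ g' := by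
    intro ε hε
    obtain ⟨t, ht, h⟩ := hUI ε hε
    refine ⟨t, ht, fun n => le_trans (le_of_eq (integral_congr_ae ?_)) (h n)⟩
    filter_upwards [he n] with x hx
    rw [hx]
  have hτ' : ∀ ε : ℝ, 0 < ε → Whp P fun n ω => |condVar (g' n) (π n (dataVec n fun i => X n i ω))
      (dataVec n fun i => X n i ω) - τ n| ≤ ε := by
    intro ε hε
    refine (hτ ε hε).mono_ae (Eventually.of_forall fun n => ?_)
    filter_upwards [S.iid.ae_forall (he n)] with ω hω h
    have e : ∀ i : Fin n, g' n (dataVec n (fun i => X n i ω) i)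
        = g n (dataVec n (fun i => X n i ω) i) := fun i => (hω i i.2).symm
    simp only [condVar, censMean, e] at h ⊢
    exact h
  have hlim1 := S.tendsto_charFun_sub_mul hm hL hB' hUI' hτ0 hτmax hτ'
  have hlim2 := S.tendsto_charFun_fullMean hm hL hB' h0' hUI'
  set R : ℕ → Ω → ℝ := fun n ω => √(r n) * (fullMean (g' n) n (fun i => X n i ω)
          + drawErr (g' n) n (r n) (fun i => X n i ω) (π n (dataVec n fun i => X n i ω))
            (fun j => K n j ω)) with hR
  have hRm : ∀ n, Measurable (R n) := fun n =>
    ((measurable_fullMean (hm n) S.iid n).add ((S.setup n).measurable_drawErr (hm n))).const_mul _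
  have haR : ∀ ε : ℝ, 0 < ε → Whp P fun n ω => |a n ω - R n ω| ≤ ε := fun ε hε =>
    ((ha ε hε).and (S.whp_subMean_eq he)).mono fun n ω h => by
      rw [h.2] at h; exact h.1
  have hexp : Continuous fun y : ℝ => Complex.exp ((y : ℂ) * Complex.I) := by fun_prop
  have hbd : ∀ y : ℝ, ‖Complex.exp ((y : ℂ) * Complex.I)‖ = 1 := Complex.norm_exp_ofReal_mul_I
  have hint : ∀ f : Ω → ℝ, AEMeasurable f P →
      Integrable (fun ω => Complex.exp ((f ω : ℂ) * Complex.I)) P := fun f hf =>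
    Integrable.of_bound (C := 1) (hexp.measurable.comp_aemeasurable hf).aestronglyMeasurable
      (ae_of_all _ fun ω => (hbd _).le)
  -- Slutsky for characteristic functions: the integrands differ by at most |a - R| where that is
  -- small, and by at most 2 on the remaining rare event.
  have hlim3 : Tendsto (fun n => (∫ ω, Complex.exp ((a n ω : ℂ) * Complex.I) ∂P)
      - ∫ ω, Complex.exp ((R n ω : ℂ) * Complex.I) ∂P) atTop (𝓝 0) := by
    rw [Metric.tendsto_nhds]
    intro ε hε
    filter_upwards [whp_iff_forall_eps.1 (haR (ε / 4) (by positivity)) (ε / 8) (by positivity)]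
      with n hn
    rw [dist_zero_right, ← integral_sub (hint _ (ham n)) (hint _ (hRm n).aemeasurable)]
    set E := {ω | ¬ |a n ω - R n ω| ≤ ε / 4} with hE
    have hEm : NullMeasurableSet E P := by
      have : NullMeasurableSet {ω | |a n ω - R n ω| ≤ ε / 4} P :=
        nullMeasurableSet_le (((ham n).sub (hRm n).aemeasurable).abs) aemeasurable_const
      exact this.compl
    have hPE : P.real E ≤ ε / 8 := ENNReal.toReal_le_of_le_ofReal (by positivity) hn
    have hdiff : Integrable (fun ω => Complex.exp ((a n ω : ℂ) * Complex.I)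
        - Complex.exp ((R n ω : ℂ) * Complex.I)) P :=
      (hint _ (ham n)).sub (hint _ (hRm n).aemeasurable)
    rw [← integral_add_compl₀ hEm hdiff]
    have h1 : ‖∫ ω in E, (Complex.exp ((a n ω : ℂ) * Complex.I)
        - Complex.exp ((R n ω : ℂ) * Complex.I)) ∂P‖ ≤ 2 * P.real E :=
      norm_setIntegral_le_of_norm_le_const (measure_lt_top _ _) fun ω _ => by
        refine (norm_sub_le _ _).trans ?_
        rw [hbd, hbd]; norm_num
    have h2 : ‖∫ ω in Eᶜ, (Complex.exp ((a n ω : ℂ) * Complex.I)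
        - Complex.exp ((R n ω : ℂ) * Complex.I)) ∂P‖ ≤ ε / 4 * P.real Eᶜ :=
      norm_setIntegral_le_of_norm_le_const (measure_lt_top _ _) fun ω hω =>
        (norm_exp_I_sub_exp_I_le _ _).trans (not_not.1 hω)
    have h3 : ε / 4 * P.real Eᶜ ≤ ε / 4 := mul_le_of_le_one_right (by positivity) measureReal_le_one
    calc _ ≤ _ := norm_add_le _ _
      _ ≤ 2 * P.real E + ε / 4 * P.real Eᶜ := add_le_add h1 h2
      _ < ε := by linarith
  have hlim2' : Tendsto (fun n => (Real.exp (-(τ n / 2)) : ℂ) *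
      (∫ ω, Complex.exp ((√(r n) * fullMean (g' n) n (fun i => X n i ω) : ℝ)
        * Complex.I) ∂P - (Real.exp (-(γ * (∫ x, g' n x ^ 2 ∂(μ n)) / 2)) : ℂ))) atTop (𝓝 0) := by
    rw [tendsto_zero_iff_norm_tendsto_zero] at hlim2 ⊢
    refine squeeze_zero (fun n => norm_nonneg _) (fun n => ?_) hlim2
    rw [norm_mul]
    refine mul_le_of_le_one_left (norm_nonneg _) ?_
    rw [Complex.norm_real, Real.norm_of_nonneg (Real.exp_pos _).le, Real.exp_le_one_iff]
    linarith [hτ0 n]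
  have hsum := (hlim3.add hlim1).add hlim2'
  simp only [add_zero] at hsum
  refine hsum.congr fun n => ?_
  have e : (Real.exp (-((τ n + γ * ∫ x, g n x ^ 2 ∂(μ n)) / 2)) : ℂ)
      = (Real.exp (-(τ n / 2)) : ℂ) * (Real.exp (-(γ * (∫ x, g' n x ^ 2 ∂(μ n)) / 2)) : ℂ) := by
    rw [← Complex.ofReal_mul, ← Real.exp_add, hsq]
    ring_nf
  rw [e, hR]
  ring

end SubsampleScheme

/-! ### Twice differentiable objective functions -/

section Matrix

variable {d : ℕ}

/-- The matrix `A` as an operator on the parameter space. -/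
noncomputable abbrev matOp (A : Matrix (Fin d) (Fin d) ℝ) : Param d →L[ℝ] Param d :=
  Matrix.toEuclideanCLM (𝕜 := ℝ) A

lemma matOp_apply (A : Matrix (Fin d) (Fin d) ℝ) (v : Param d) (j : Fin d) :
    matOp A v j = ∑ k, A j k * v k := rfl

lemma inner_matOp (A : Matrix (Fin d) (Fin d) ℝ) (u v : Param d) :
    inner ℝ u (matOp A v) = ∑ j, ∑ k, u j * A j k * v k := by
  rw [Matrix.inner_toEuclideanCLM, dotProduct]
  refine Finset.sum_congr rfl fun j _ => ?_
  rw [Matrix.mulVec, dotProduct, Finset.mul_sum]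
  exact Finset.sum_congr rfl fun k _ => (mul_assoc _ _ _).symm

lemma norm_matOp_apply_le {A : Matrix (Fin d) (Fin d) ℝ} {a : ℝ} (ha : 0 ≤ a)
    (hA : ∀ j k, |A j k| ≤ a) (v : Param d) : ‖matOp A v‖ ≤ d * a * ‖v‖ := by
  refine abs_le_of_sq_le_sq' ?_ (by positivity) |>.2
  rw [EuclideanSpace.norm_sq_eq, mul_pow, EuclideanSpace.norm_sq_eq v]
  have h1 : ∀ j, ‖matOp A v j‖ ^ 2 ≤ d * a ^ 2 * ∑ k, ‖v k‖ ^ 2 := by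
    intro j
    rw [matOp_apply, Real.norm_eq_abs, sq_abs]
    refine (Finset.sum_mul_sq_le_sq_mul_sq _ _ _).trans ?_
    simp only [Real.norm_eq_abs, sq_abs]
    refine mul_le_mul_of_nonneg_right ?_ (Finset.sum_nonneg fun k _ => sq_nonneg _)
    calc ∑ k, A j k ^ 2 ≤ ∑ _k : Fin d, a ^ 2 := Finset.sum_le_sum fun k _ => by
          rw [← sq_abs]; exact pow_le_pow_left₀ (abs_nonneg _) (hA j k) 2
      _ = d * a ^ 2 := by simp
  refine (Finset.sum_le_sum fun j _ => h1 j).trans (le_of_eq ?_)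
  simp
  ring

lemma opNorm_matOp_le {A : Matrix (Fin d) (Fin d) ℝ} {a : ℝ} (ha : 0 ≤ a)
    (hA : ∀ j k, |A j k| ≤ a) : ‖matOp A‖ ≤ d * a :=
  ContinuousLinearMap.opNorm_le_bound _ (by positivity) (norm_matOp_apply_le ha hA)

lemma abs_inner_matOp_le {A : Matrix (Fin d) (Fin d) ℝ} {a : ℝ} (ha : 0 ≤ a)
    (hA : ∀ j k, |A j k| ≤ a) (v : Param d) : |inner ℝ v (matOp A v)| ≤ d * a * ‖v‖ ^ 2 := by
  refine (abs_real_inner_le_norm _ _).trans ?_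
  have := mul_le_mul_of_nonneg_left (norm_matOp_apply_le ha hA v) (norm_nonneg v)
  linarith

end Matrix

/-- `L` is twice differentiable on `Θ`, with gradient `G` and Hessian `H`. -/
structure HasHessianOn {d : ℕ} (L : Param d → ℝ) (G : Param d → Param d)
    (H : Param d → Matrix (Fin d) (Fin d) ℝ) (Θ : Set (Param d)) : Prop where
  grad : ∀ θ ∈ Θ, HasFDerivAt L (innerSL ℝ (G θ)) θ
  hess : ∀ θ ∈ Θ, HasFDerivAt G (matOp (H θ)) θ

lemma hasHessianOn_logLik {d : ℕ} {f : Param d → ℝ → ℝ} {Θ : Set (Param d)} {x : Obs}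
    (h : ∀ θ ∈ Θ, ContDiffAt ℝ 2 (logLik f x) θ) :
    HasHessianOn (logLik f x) (score f x) (hess f x) Θ where
  grad := fun θ hθ => by
    have h1 : DifferentiableAt ℝ (logLik f x) θ := (h θ hθ).differentiableAt (by norm_num)
    have h2 := h1.hasGradientAt.hasFDerivAt
    exact h2
  hess := fun θ hθ => by
    have h1 : ContDiffAt ℝ 1 (fderiv ℝ (logLik f x)) θ :=
      (h θ hθ).fderiv_right (by norm_num)
    have h2 : DifferentiableAt ℝ (score f x) θ := by
      have : score f x = fun η => (InnerProductSpace.toDual ℝ (Param d)).symm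
          (fderiv ℝ (logLik f x) η) := rfl
      rw [this]
      exact ((InnerProductSpace.toDual ℝ (Param d)).symm.toContinuousLinearEquiv
        |>.differentiableAt).comp θ (h1.differentiableAt (by norm_num))
    -- `hess` records the derivative coordinatewise along basis vectors; expanding v in the basis
    -- identifies the two operators.
    have h3 : fderiv ℝ (score f x) θ = matOp (hess f x θ) := by
      ext v j
      have h4 : ∀ w : Param d, fderiv ℝ (fun η => score f x η j) θ w
          = fderiv ℝ (score f x) θ w j := by
        intro w
        have h5 : HasFDerivAt (fun η => score f x η j)
            ((EuclideanSpace.proj j : Param d →L[ℝ] ℝ).comp (fderiv ℝ (score f x) θ)) θ :=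
          (EuclideanSpace.proj j : Param d →L[ℝ] ℝ).hasFDerivAt.comp θ h2.hasFDerivAt
        rw [h5.fderiv]; rfl
      rw [matOp_apply, ← h4]
      have h6 : v = ∑ k, v k • EuclideanSpace.single k (1 : ℝ) := by
        ext i
        simp [Finset.sum_apply, Pi.single_apply]
      conv_lhs => rw [h6]
      rw [map_sum]
      refine Finset.sum_congr rfl fun k _ => ?_
      rw [map_smul, hess, Matrix.of_apply, smul_eq_mul, mul_comm]
    rw [← h3]
    exact h2.hasFDerivAt

lemma HasHessianOn.sum {d : ℕ} {ι : Type*} {Θ : Set (Param d)} (s : Finset ι)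
    {c : ι → ℝ} {L : ι → Param d → ℝ} {G : ι → Param d → Param d}
    {H : ι → Param d → Matrix (Fin d) (Fin d) ℝ} (h : ∀ i ∈ s, HasHessianOn (L i) (G i) (H i) Θ) :
    HasHessianOn (fun θ => ∑ i ∈ s, c i * L i θ) (fun θ => ∑ i ∈ s, c i • G i θ)
      (fun θ => ∑ i ∈ s, c i • H i θ) Θ where
  grad := fun θ hθ => by
    have := HasFDerivAt.fun_sum fun i hi => ((h i hi).grad θ hθ).const_mul (c i)
    refine this.congr_fderiv ?_
    rw [map_sum]
    exact Finset.sum_congr rfl fun i _ => (map_smul _ _ _).symm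
  hess := fun θ hθ => by
    have := HasFDerivAt.fun_sum fun i hi => ((h i hi).hess θ hθ).const_smul (c i)
    refine this.congr_fderiv ?_
    unfold matOp
    rw [map_sum]
    exact Finset.sum_congr rfl fun i _ => (map_smul _ _ _).symm

namespace HasHessianOn

variable {d : ℕ} {L : Param d → ℝ} {G : Param d → Param d}
  {H : Param d → Matrix (Fin d) (Fin d) ℝ} {Θ : Set (Param d)}

lemma norm_grad_sub_le (h : HasHessianOn L G H Θ) (hΘ : Convex ℝ Θ) {a : ℝ} (ha : 0 ≤ a)
    (hH : ∀ θ ∈ Θ, ∀ j k, |H θ j k| ≤ a) {θ₀ θ₁ : Param d} (h₀ : θ₀ ∈ Θ) (h₁ : θ₁ ∈ Θ) :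
    ‖G θ₁ - G θ₀‖ ≤ d * a * ‖θ₁ - θ₀‖ :=
  hΘ.norm_image_sub_le_of_norm_hasFDerivWithin_le
    (fun θ hθ => (h.hess θ hθ).hasFDerivWithinAt) (fun θ hθ => opNorm_matOp_le ha (hH θ hθ)) h₀ h₁

/-- Mean value inequality on the segment, where the gradient moves by at most d a ‖θ₁ - θ₀‖. It
replaces differentiation under the integral when the mean score is computed. -/
lemma abs_sub_sub_inner_le (h : HasHessianOn L G H Θ) (hΘ : Convex ℝ Θ) {a : ℝ} (ha : 0 ≤ a)
    (hH : ∀ θ ∈ Θ, ∀ j k, |H θ j k| ≤ a) {θ₀ θ₁ : Param d} (h₀ : θ₀ ∈ Θ) (h₁ : θ₁ ∈ Θ) :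
    |L θ₁ - L θ₀ - inner ℝ (G θ₀) (θ₁ - θ₀)| ≤ d * a * ‖θ₁ - θ₀‖ ^ 2 := by
  have hs : segment ℝ θ₀ θ₁ ⊆ Θ := hΘ.segment_subset h₀ h₁
  have := (convex_segment θ₀ θ₁).norm_image_sub_le_of_norm_hasFDerivWithin_le'
    (φ := innerSL ℝ (G θ₀)) (C := d * a * ‖θ₁ - θ₀‖)
    (fun θ hθ => (h.grad θ (hs hθ)).hasFDerivWithinAt) (fun θ hθ => by
      rw [← map_sub, innerSL_apply_norm]
      refine (h.norm_grad_sub_le hΘ ha hH h₀ (hs hθ)).trans ?_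
      gcongr
      obtain ⟨t, ht, rfl⟩ := (segment_eq_image' ℝ θ₀ θ₁ ▸ hθ)
      simp only [add_sub_cancel_left, norm_smul, Real.norm_eq_abs, abs_of_nonneg ht.1]
      exact mul_le_of_le_one_left (norm_nonneg _) ht.2)
    (left_mem_segment ℝ _ _) (right_mem_segment ℝ _ _)
  rw [Real.norm_eq_abs, innerSL_apply_apply] at this
  calc _ ≤ _ := this
    _ = _ := by ring

/-- A maximizer of a strongly concave function is close to any point of small gradient. -/
lemma norm_sub_le_of_isMaxOn (h : HasHessianOn L G H Θ) (hΘ : Convex ℝ Θ) {c : ℝ} (hc : 0 < c)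
    (hH : ∀ θ ∈ Θ, ∀ v : Param d, inner ℝ v (matOp (H θ) v) ≤ -c * ‖v‖ ^ 2)
    {θ₀ θ₁ : Param d} (h₀ : θ₀ ∈ Θ) (h₁ : θ₁ ∈ Θ) (hmax : IsMaxOn L Θ θ₁) :
    ‖θ₁ - θ₀‖ ≤ ‖G θ₀‖ / c := by
  set v := θ₁ - θ₀ with hv
  have hmem : ∀ t ∈ Set.Icc (0 : ℝ) 1, θ₀ + t • v ∈ Θ := fun t ht => by
    refine hΘ.segment_subset h₀ h₁ ?_
    rw [segment_eq_image']
    exact ⟨t, ht, rfl⟩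
  have hd : ∀ t ∈ Set.Icc (0 : ℝ) 1, HasDerivAt (fun t : ℝ => inner ℝ v (G (θ₀ + t • v)))
      (inner ℝ v (matOp (H (θ₀ + t • v)) v)) t := by
    intro t ht
    have h1 : HasDerivAt (fun t : ℝ => θ₀ + t • v) v t := by
      simpa using ((hasDerivAt_id t).smul_const v).const_add θ₀
    have h2 := (h.hess _ (hmem t ht)).comp_hasDerivAt t h1
    exact (innerSL ℝ v).hasFDerivAt.comp_hasDerivAt t h2
  obtain ⟨ξ, hξ, hξe⟩ := exists_hasDerivAt_eq_slope (fun t : ℝ => inner ℝ v (G (θ₀ + t • v)))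
    (fun t => inner ℝ v (matOp (H (θ₀ + t • v)) v)) zero_lt_one
    (fun t ht => (hd t ht).continuousAt.continuousWithinAt)
    (fun t ht => hd t (Set.Ioo_subset_Icc_self ht))
  have h3 := hH _ (hmem ξ (Set.Ioo_subset_Icc_self hξ)) v
  rw [hξe] at h3
  have h4 : θ₀ + v = θ₁ := by rw [hv]; abel
  simp only [one_smul, zero_smul, add_zero, sub_zero, div_one, h4] at h3
  -- At a maximizer over a convex set the derivative towards θ₀ is nonpositive; θ₁ may lie on the
  -- boundary, so consistency is not presupposed.
  have h5 : 0 ≤ inner ℝ v (G θ₁) := by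
    have := IsLocalMaxOn.hasFDerivWithinAt_nonpos hmax.localize
      (h.grad θ₁ h₁).hasFDerivWithinAt
      (sub_mem_posTangentConeAt_of_segment_subset (hΘ.segment_subset h₁ h₀))
    rw [innerSL_apply_apply, real_inner_comm, ← neg_sub, inner_neg_left] at this
    linarith
  have h6 : inner ℝ v (G θ₀) ≤ ‖v‖ * ‖G θ₀‖ := real_inner_le_norm _ _
  rw [le_div_iff₀ hc]
  rcases (norm_nonneg v).eq_or_lt with h7 | h7
  · rw [← h7]; simp
  · nlinarith

/-- The gradient vanishes at an interior maximizer, so expanding it around θ₀ with a Lipschitz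
Hessian leaves only a quadratic remainder. -/
lemma norm_grad_add_le (h : HasHessianOn L G H Θ) (hΘ : Convex ℝ Θ) {a : ℝ} (ha : 0 ≤ a)
    {θ₀ θ₁ : Param d} (h₀ : θ₀ ∈ Θ) (h₁ : θ₁ ∈ interior Θ)
    (hH : ∀ θ ∈ Θ, ∀ j k, |H θ j k - H θ₀ j k| ≤ a * ‖θ - θ₀‖)
    (hmax : IsMaxOn L Θ θ₁) :
    ‖G θ₀ + matOp (H θ₀) (θ₁ - θ₀)‖ ≤ d * a * ‖θ₁ - θ₀‖ ^ 2 := by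
  have h₁' : θ₁ ∈ Θ := interior_subset h₁
  have hG : G θ₁ = 0 := by
    have h2 := (hmax.isLocalMax (mem_interior_iff_mem_nhds.1 h₁)).hasFDerivAt_eq_zero
      (h.grad θ₁ h₁')
    have h3 : innerSL ℝ (G θ₁) (G θ₁) = 0 := by rw [h2]; rfl
    rw [innerSL_apply_apply] at h3
    exact inner_self_eq_zero.1 h3
  have hs : segment ℝ θ₀ θ₁ ⊆ Θ := hΘ.segment_subset h₀ h₁'
  have := (convex_segment θ₀ θ₁).norm_image_sub_le_of_norm_hasFDerivWithin_le'
    (φ := matOp (H θ₀)) (C := d * (a * ‖θ₁ - θ₀‖))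
    (fun θ hθ => (h.hess θ (hs hθ)).hasFDerivWithinAt) (fun θ hθ => by
      rw [← map_sub]
      refine opNorm_matOp_le (by positivity) fun j k => (hH θ (hs hθ) j k).trans ?_
      gcongr
      obtain ⟨t, ht, rfl⟩ := (segment_eq_image' ℝ θ₀ θ₁ ▸ hθ)
      simp only [add_sub_cancel_left, norm_smul, Real.norm_eq_abs, abs_of_nonneg ht.1]
      exact mul_le_of_le_one_left (norm_nonneg _) ht.2)
    (left_mem_segment ℝ _ _) (right_mem_segment ℝ _ _)
  rw [hG, zero_sub] at this
  rw [← norm_neg, neg_add, ← sub_eq_add_neg]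
  calc _ ≤ _ := this
    _ = _ := by ring

end HasHessianOn

/-- Subsample averages are nonnegative combinations of the values at the individuals. -/
lemma exists_coeff {n r : ℕ} {x : ℕ → Obs} {π : ℕ → ℝ} {K : ℕ → ℕ}
    (hK : ValidDraws n (r - numFail (dataVec n x)) x K)
    (hpos : ∀ i < n, (x i).2.1 = true → 0 < π i) :
    ∃ c : ℕ → ℝ, (∀ i, 0 ≤ c i) ∧
      ∀ g : Obs → ℝ, subMean g n r x π K = ∑ i ∈ Finset.range n, c i * g (x i) := by
  set m := r - numFail (dataVec n x) with hm
  -- The coefficient of individual i collects all draws that hit i. It does not depend on g, so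
  -- differentiation in θ and pointwise bounds pass through `subMean`.
  refine ⟨fun i => (1 / (n : ℝ)) * ((if (x i).2.1 then 0 else 1) + ∑ j ∈ Finset.range m,
    if K j = i then 1 / ((m : ℝ) * π (K j)) else 0), fun i => ?_, fun g => ?_⟩
  · refine mul_nonneg (by positivity) (add_nonneg (by split_ifs <;> norm_num)
      (Finset.sum_nonneg fun j hj => ?_))
    have h1 := hK j (Finset.mem_range.1 hj)
    have h2 := hpos _ h1.1 h1.2
    split_ifs
    · positivity
    · exact le_rfl
  · rw [subMean, ← hm]
    simp_rw [mul_assoc, add_mul, Finset.sum_mul]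
    rw [← Finset.mul_sum, Finset.sum_add_distrib, Finset.sum_comm]
    congr 2
    · refine Finset.sum_congr rfl fun i _ => ?_
      split_ifs <;> simp
    · refine Finset.sum_congr rfl fun j hj => ?_
      have h1 := hK j (Finset.mem_range.1 hj)
      simp_rw [ite_mul, zero_mul]
      rw [Finset.sum_ite_eq]
      simp [h1.1]

/-! ### The score and the Hessian of the log-likelihood -/

lemma measurable_logLik {d : ℕ} {f : Param d → ℝ → ℝ} (hf : ∀ θ, Measurable (f θ)) (θ : Param d) :
    Measurable fun x : Obs => logLik f x θ := by
  have hF : Measurable (lifetimeCDF f θ) := by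
    have hmono : Monotone fun t : ℝ => lifetimeLaw f θ (Set.Iic t) := fun s t hst =>
      measure_mono (Set.Iic_subset_Iic.2 hst)
    exact hmono.measurable.ennreal_toReal
  have hc : MeasurableSet {x : Obs | x.2.1 = true} :=
    measurableSet_eq_fun (measurable_fst.comp measurable_snd) measurable_const
  exact (Measurable.ite hc (Real.measurable_log.comp ((hF.comp measurable_fst).const_sub 1))
    (Real.measurable_log.comp ((hf θ).comp measurable_fst))).sub
    (Real.measurable_log.comp ((hF.comp (measurable_snd.comp measurable_snd)).const_sub 1))

/-- The regularity of the log-likelihood along the laws `μ n`, with `θ₀` in the interior of `Θ`. -/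
structure RegularModel {d : ℕ} (f : Param d → ℝ → ℝ) (Θ : Set (Param d)) (μ : ℕ → Measure Obs)
    (θ₀ : Param d) : Prop where
  meas : ∀ θ, Measurable (f θ)
  mem_interior : θ₀ ∈ interior Θ
  regular : IsRegular f Θ μ
  lik : LikelihoodAssumption f Θ μ
  hess : HessianAssumption f Θ μ
  sqScore_posDef : UnifPosDef fun n => meanSqScore f (μ n) θ₀
  unifIntegrable : ∀ ε : ℝ, 0 < ε → ∃ B : ℝ, ∀ n,
    ∫⁻ x in {x | B < ‖score f x θ₀‖}, ENNReal.ofReal (‖score f x θ₀‖ ^ 2) ∂(μ n)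
      ≤ ENNReal.ofReal ε

lemma integral_sum_sum_mul {d : ℕ} {ν : Measure Obs} {h : Fin d → Fin d → Obs → ℝ}
    (hi : ∀ j k, Integrable (h j k) ν) (u v : Param d) :
    ∫ x, ∑ j, ∑ k, u j * h j k x * v k ∂ν
      = inner ℝ u (matOp (Matrix.of fun j k => ∫ x, h j k x ∂ν) v) := by
  rw [inner_matOp, integral_finsetSum _ fun j _ =>
    integrable_finsetSum _ fun k _ => ((hi j k).const_mul _).mul_const _]
  refine Finset.sum_congr rfl fun j _ => ?_
  rw [integral_finsetSum _ fun k _ => ((hi j k).const_mul _).mul_const _]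
  refine Finset.sum_congr rfl fun k _ => ?_
  rw [integral_mul_const, integral_const_mul, Matrix.of_apply]

lemma UnifPosDef.exists_le {d : ℕ} {A : ℕ → Matrix (Fin d) (Fin d) ℝ} (h : UnifPosDef A) :
    ∃ c : ℝ, 0 < c ∧ ∀ n (v : Param d), c * ‖v‖ ^ 2 ≤ inner ℝ v (matOp (A n) v) := by
  obtain ⟨c, hc, hA⟩ := h
  refine ⟨c, hc, fun n v => ?_⟩
  have h1 := (hA n).dotProduct_mulVec_nonneg v
  rw [star_trivial, ← Matrix.inner_toEuclideanCLM] at h1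
  have h2 : Matrix.toEuclideanCLM (𝕜 := ℝ) (A n - c • (1 : Matrix (Fin d) (Fin d) ℝ)) v
      = matOp (A n) v - c • v := by
    rw [map_sub, map_smul, map_one]; rfl
  rw [h2, inner_sub_right, inner_smul_right, real_inner_self_eq_norm_sq] at h1
  linarith

lemma UnifPosDef.isSymm {d : ℕ} {A : ℕ → Matrix (Fin d) (Fin d) ℝ} (h : UnifPosDef A) (n : ℕ) :
    (A n).IsSymm := by
  obtain ⟨c, hc, hA⟩ := h
  have h1 := (hA n).isHermitian
  have h2 : (c • (1 : Matrix (Fin d) (Fin d) ℝ)).IsHermitian :=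
    (Matrix.isHermitian_one).smul (by simp [IsSelfAdjoint])
  have h3 := h1.add h2
  rw [sub_add_cancel] at h3
  simpa [Matrix.IsHermitian, Matrix.conjTranspose_eq_transpose_of_trivial, Matrix.IsSymm] using h3

/-! ### Moments of the score at the true value -/

namespace RegularModel

variable {d : ℕ} {f : Param d → ℝ → ℝ} {Θ : Set (Param d)} {μ : ℕ → Measure Obs}
  {θ₀ : Param d}

lemma mem (R : RegularModel f Θ μ θ₀) : θ₀ ∈ Θ := interior_subset R.mem_interior

lemma ae_hasHessianOn (R : RegularModel f Θ μ θ₀) (n : ℕ) :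
    ∀ᵐ x ∂(μ n), HasHessianOn (logLik f x) (score f x) (CensSub.hess f x) Θ :=
  (R.regular n).mono fun _ hx => hasHessianOn_logLik fun θ hθ => (hx.2 θ hθ).2

/-- No measurability of the gradient in x is assumed: it is the almost sure limit of difference
quotients of the log-likelihood, measurable by `measurable_logLik`. -/
lemma aemeasurable_inner_score (R : RegularModel f Θ μ θ₀) (n : ℕ) (u : Param d) :
    AEMeasurable (fun x => inner ℝ u (score f x θ₀)) (μ n) := by
  refine aemeasurable_of_tendsto_metrizable_ae (u := atTop)
    (f := fun (k : ℕ) x => ((k : ℝ) + 1) * (logLik f x (θ₀ + ((k : ℝ) + 1)⁻¹ • u) - logLik f x θ₀))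
    (fun k => (((measurable_logLik R.meas _).sub (measurable_logLik R.meas _)).const_mul
      _).aemeasurable) ?_
  filter_upwards [R.ae_hasHessianOn n] with x hx
  have h1 : HasDerivAt (fun t : ℝ => θ₀ + t • u) u 0 := by
    simpa using ((hasDerivAt_id (0 : ℝ)).smul_const u).const_add θ₀
  have h2 : HasFDerivAt (logLik f x) (innerSL ℝ (score f x θ₀)) (θ₀ + (0 : ℝ) • u) := by
    simpa using hx.grad θ₀ R.mem
  have h3 := (h2.comp_hasDerivAt (0 : ℝ) h1)
  rw [hasDerivAt_iff_tendsto_slope] at h3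
  have h4 : Tendsto (fun k : ℕ => ((k : ℝ) + 1)⁻¹) atTop (𝓝[≠] 0) := by
    refine tendsto_nhdsWithin_iff.2 ⟨?_, Eventually.of_forall fun k => ?_⟩
    · simpa using tendsto_one_div_add_atTop_nhds_zero_nat (𝕜 := ℝ)
    · simp only [Set.mem_compl_iff, Set.mem_singleton_iff]
      positivity
  have h5 := h3.comp h4
  rw [innerSL_apply_apply, real_inner_comm] at h5
  refine h5.congr fun k => ?_
  simp [slope_def_field]
  ring

lemma score_apply_eq (x : Obs) (θ : Param d) (j : Fin d) :
    score f x θ j = inner ℝ (EuclideanSpace.single j (1 : ℝ)) (score f x θ) := by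
  simp [EuclideanSpace.inner_single_left]

lemma aemeasurable_norm_score (R : RegularModel f Θ μ θ₀) (n : ℕ) :
    AEMeasurable (fun x => ‖score f x θ₀‖) (μ n) := by
  simp_rw [EuclideanSpace.norm_eq, Real.norm_eq_abs, sq_abs, score_apply_eq]
  exact Real.continuous_sqrt.measurable.comp_aemeasurable
    (Finset.aemeasurable_fun_sum _ fun j _ => (R.aemeasurable_inner_score n _).pow_const 2)

/-- The squared score, restricted to large values, is small in mean. -/
lemma exists_integral_tail_le (R : RegularModel f Θ μ θ₀) [∀ n, IsProbabilityMeasure (μ n)] :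
    (∃ C : ℝ, 0 ≤ C ∧ ∀ n, Integrable (fun x => ‖score f x θ₀‖ ^ 2) (μ n) ∧
      ∫ x, ‖score f x θ₀‖ ^ 2 ∂(μ n) ≤ C) ∧
    ∀ ε : ℝ, 0 < ε → ∃ B : ℝ, 0 < B ∧ ∀ n,
      ∫ x in {x | B < ‖score f x θ₀‖}, ‖score f x θ₀‖ ^ 2 ∂(μ n) ≤ ε := by
  have hm : ∀ n, AEMeasurable (fun x => ‖score f x θ₀‖ ^ 2) (μ n) := fun n =>
    (R.aemeasurable_norm_score n).pow_const 2
  have hlin : ∀ B n, ∫⁻ x, ENNReal.ofReal (‖score f x θ₀‖ ^ 2) ∂(μ n)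
      ≤ ENNReal.ofReal (B ^ 2) + ∫⁻ x in {x | B < ‖score f x θ₀‖},
        ENNReal.ofReal (‖score f x θ₀‖ ^ 2) ∂(μ n) := by
    intro B n
    have hs : NullMeasurableSet {x | B < ‖score f x θ₀‖} (μ n) :=
      nullMeasurableSet_lt aemeasurable_const (R.aemeasurable_norm_score n)
    rw [← setLIntegral_univ, ← Set.union_compl_self {x | B < ‖score f x θ₀‖}, add_comm]
    refine (lintegral_union_le _ _ _).trans ?_
    gcongr
    have hsc : NullMeasurableSet {x | B < ‖score f x θ₀‖}ᶜ (μ n) := hs.compl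
    refine (lintegral_mono_ae (g := fun _ => ENNReal.ofReal (B ^ 2))
      ((ae_restrict_mem₀ hsc).mono fun x hx => ?_)).trans ?_
    · refine ENNReal.ofReal_le_ofReal (pow_le_pow_left₀ (norm_nonneg _) ?_ 2)
      simpa using hx
    · rw [setLIntegral_const]
      exact mul_le_of_le_one_right' prob_le_one
  obtain ⟨B₁, hB₁⟩ := R.unifIntegrable 1 one_pos
  have hbd : ∀ n, ∫⁻ x, ENNReal.ofReal (‖score f x θ₀‖ ^ 2) ∂(μ n)
      ≤ ENNReal.ofReal (B₁ ^ 2 + 1) := fun n => by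
    rw [ENNReal.ofReal_add (sq_nonneg _) zero_le_one]
    exact (hlin B₁ n).trans (by gcongr; exact hB₁ n)
  have hint : ∀ n, Integrable (fun x => ‖score f x θ₀‖ ^ 2) (μ n) := fun n => by
    refine ⟨(hm n).aestronglyMeasurable, ?_⟩
    rw [hasFiniteIntegral_iff_ofReal (ae_of_all _ fun x => sq_nonneg _)]
    exact (hbd n).trans_lt ENNReal.ofReal_lt_top
  refine ⟨⟨B₁ ^ 2 + 1, by positivity, fun n => ⟨hint n, ?_⟩⟩, fun ε hε => ?_⟩
  · rw [integral_eq_lintegral_of_nonneg_ae (ae_of_all _ fun x => sq_nonneg _)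
      (hm n).aestronglyMeasurable]
    exact ENNReal.toReal_le_of_le_ofReal (by positivity) (hbd n)
  · obtain ⟨B, hB⟩ := R.unifIntegrable ε hε
    refine ⟨max B 1, by positivity, fun n => ?_⟩
    rw [integral_eq_lintegral_of_nonneg_ae (ae_of_all _ fun x => sq_nonneg _)
      (hm n).aestronglyMeasurable.restrict]
    refine ENNReal.toReal_le_of_le_ofReal hε.le (le_trans (lintegral_mono_set ?_) (hB n))
    intro x hx
    show B < _
    exact lt_of_le_of_lt (le_max_left _ _) hx

lemma memLp_inner_score (R : RegularModel f Θ μ θ₀) [∀ n, IsProbabilityMeasure (μ n)] (n : ℕ)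
    (u : Param d) : MemLp (fun x => inner ℝ u (score f x θ₀)) 2 (μ n) := by
  obtain ⟨⟨C, -, hC⟩, -⟩ := R.exists_integral_tail_le
  have hm := (R.aemeasurable_inner_score n u).aestronglyMeasurable
  rw [memLp_two_iff_integrable_sq hm]
  refine ((hC n).1.const_mul (‖u‖ ^ 2)).mono' (hm.pow 2) (ae_of_all _ fun x => ?_)
  rw [Real.norm_of_nonneg (sq_nonneg _), ← sq_abs, ← mul_pow]
  exact pow_le_pow_left₀ (abs_nonneg _) (abs_real_inner_le_norm _ _) 2

lemma exists_integral_inner_score_sq_le (R : RegularModel f Θ μ θ₀)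
    [∀ n, IsProbabilityMeasure (μ n)] :
    ∃ C : ℝ, 0 ≤ C ∧ ∀ n (u : Param d),
      ∫ x, inner ℝ u (score f x θ₀) ^ 2 ∂(μ n) ≤ ‖u‖ ^ 2 * C := by
  obtain ⟨⟨C, hC0, hC⟩, -⟩ := R.exists_integral_tail_le
  refine ⟨C, hC0, fun n u => ?_⟩
  refine (integral_mono (R.memLp_inner_score n u).integrable_sq ((hC n).1.const_mul (‖u‖ ^ 2))
    fun x => ?_).trans ?_
  · simp only
    rw [← sq_abs, ← mul_pow]
    exact pow_le_pow_left₀ (abs_nonneg _) (abs_real_inner_le_norm _ _) 2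
  · rw [integral_const_mul]
    exact mul_le_mul_of_nonneg_left (hC n).2 (sq_nonneg _)

/-- Split at ‖score‖ = B. Above B the minimum is at most 1 and uniform integrability acts; below B
it is at most tUB. Only a bound on the directions enters, so they may vary with n. -/
lemma unifLindeberg_inner_score (R : RegularModel f Θ μ θ₀) [∀ n, IsProbabilityMeasure (μ n)]
    {u : ℕ → Param d} {U : ℝ} (hu : ∀ n, ‖u n‖ ≤ U) :
    UnifLindeberg μ fun n x => inner ℝ (u n) (score f x θ₀) := by
  intro ε hε
  obtain ⟨⟨C, hC0, hC⟩, htail⟩ := R.exists_integral_tail_le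
  have hU : 0 ≤ U := (norm_nonneg _).trans (hu 0)
  obtain ⟨B, hB0, hB⟩ := htail (ε / (2 * (U ^ 2 + 1))) (by positivity)
  -- Chosen so that the part below B, at most t U³ B C, does not exceed ε/2.
  set t := ε / (2 * (U ^ 3 * B * C + 1)) with ht
  have ht0 : 0 < t := by positivity
  refine ⟨t, ht0, fun n => ?_⟩
  set s : Set Obs := {x | B < ‖score f x θ₀‖} with hs
  have hsm : NullMeasurableSet s (μ n) :=
    nullMeasurableSet_lt aemeasurable_const (R.aemeasurable_norm_score n)
  have hle : ∀ x, |inner ℝ (u n) (score f x θ₀)| ≤ U * ‖score f x θ₀‖ := fun x =>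
    (abs_real_inner_le_norm _ _).trans (mul_le_mul_of_nonneg_right (hu n) (norm_nonneg _))
  have hsq : ∀ x, inner ℝ (u n) (score f x θ₀) ^ 2 ≤ U ^ 2 * ‖score f x θ₀‖ ^ 2 := fun x => by
    rw [← sq_abs, ← mul_pow]
    exact pow_le_pow_left₀ (abs_nonneg _) (hle x) 2
  have hi := integrable_sq_mul_min (R.memLp_inner_score n (u n)) ht0.le
  rw [← integral_add_compl₀ hsm hi]
  have h1 : ∫ x in s, inner ℝ (u n) (score f x θ₀) ^ 2 *
      min 1 (t * |inner ℝ (u n) (score f x θ₀)|) ∂(μ n) ≤ ε / 2 := by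
    refine (integral_mono hi.integrableOn ((hC n).1.integrableOn.const_mul (U ^ 2)) fun x => ?_).trans
      ?_
    · exact (mul_le_of_le_one_right (sq_nonneg _) (min_le_left _ _)).trans (hsq x)
    · rw [integral_const_mul]
      refine (mul_le_mul_of_nonneg_left (hB n) (sq_nonneg _)).trans ?_
      rw [mul_div_assoc', div_le_div_iff₀ (by positivity) (by norm_num)]
      nlinarith
  have h2 : ∫ x in sᶜ, inner ℝ (u n) (score f x θ₀) ^ 2 *
      min 1 (t * |inner ℝ (u n) (score f x θ₀)|) ∂(μ n) ≤ ε / 2 := by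
    have h3 : ∫ x in sᶜ, inner ℝ (u n) (score f x θ₀) ^ 2 *
        min 1 (t * |inner ℝ (u n) (score f x θ₀)|) ∂(μ n)
        ≤ ∫ x in sᶜ, t * (U ^ 3 * B) * ‖score f x θ₀‖ ^ 2 ∂(μ n) := by
      refine setIntegral_mono_on₀ hi.integrableOn ((hC n).1.integrableOn.const_mul _) hsm.compl
        fun x hx => ?_
      have hxB : ‖score f x θ₀‖ ≤ B := by simpa [hs] using hx
      have h4 : min 1 (t * |inner ℝ (u n) (score f x θ₀)|) ≤ t * (U * B) :=
        (min_le_right _ _).trans (mul_le_mul_of_nonneg_left ((hle x).trans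
          (mul_le_mul_of_nonneg_left hxB hU)) ht0.le)
      calc _ ≤ U ^ 2 * ‖score f x θ₀‖ ^ 2 * (t * (U * B)) :=
            mul_le_mul (hsq x) h4 (by positivity) (by positivity)
        _ = _ := by ring
    have h5 : ∫ x in sᶜ, ‖score f x θ₀‖ ^ 2 ∂(μ n) ≤ C :=
      (setIntegral_le_integral (hC n).1 (ae_of_all _ fun x => sq_nonneg _)).trans (hC n).2
    rw [integral_const_mul] at h3
    refine h3.trans ((mul_le_mul_of_nonneg_left h5 (by positivity)).trans ?_)
    have h6 : t * (2 * (U ^ 3 * B * C + 1)) = ε := by rw [ht]; field_simp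
    nlinarith
  linarith

lemma integrable_score_mul (R : RegularModel f Θ μ θ₀) [∀ n, IsProbabilityMeasure (μ n)] (n : ℕ)
    (j k : Fin d) : Integrable (fun x => outer (score f x θ₀) j k) (μ n) := by
  have h : ∀ j, MemLp (fun x => score f x θ₀ j) 2 (μ n) := fun j => by
    simp_rw [score_apply_eq]; exact R.memLp_inner_score n _
  exact (h j).integrable_mul (h k)

lemma sum_outer_eq (u v : Param d) :
    ∑ j, ∑ k, u j * outer v j k * u k = inner ℝ u v ^ 2 := by
  rw [PiLp.inner_apply, pow_two, Finset.sum_mul_sum]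
  refine Finset.sum_congr rfl fun j _ => Finset.sum_congr rfl fun k _ => ?_
  simp [outer]
  ring

lemma integral_inner_score_sq (R : RegularModel f Θ μ θ₀) [∀ n, IsProbabilityMeasure (μ n)] (n : ℕ)
    (u : Param d) : ∫ x, inner ℝ u (score f x θ₀) ^ 2 ∂(μ n)
      = inner ℝ u (matOp (meanSqScore f (μ n) θ₀) u) := by
  rw [meanSqScore, ← integral_sum_sum_mul (R.integrable_score_mul n)]
  refine integral_congr_ae (ae_of_all _ fun x => ?_)
  exact (sum_outer_eq u _).symm

/-- The mean absolute score is bounded below in every direction. -/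
lemma exists_le_integral_abs_inner_score (R : RegularModel f Θ μ θ₀)
    [∀ n, IsProbabilityMeasure (μ n)] {u : Param d} (hu : u ≠ 0) :
    ∃ κ : ℝ, 0 < κ ∧ ∀ n, κ ≤ ∫ x, |inner ℝ u (score f x θ₀)| ∂(μ n) := by
  obtain ⟨⟨C, hC0, hC⟩, htail⟩ := R.exists_integral_tail_le
  obtain ⟨c, hc, hcn⟩ := R.sqScore_posDef.exists_le
  have hu' : 0 < ‖u‖ := norm_pos_iff.2 hu
  obtain ⟨B, hB0, hB⟩ := htail (c / 2) (by positivity)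
  -- From c‖u‖² ≤ E g² ≤ ‖u‖² c/2 + ‖u‖ B E|g|, with g = ⟨u, score⟩: the tail above B uses at most
  -- half of the second moment.
  refine ⟨c * ‖u‖ / (2 * B), by positivity, fun n => ?_⟩
  set s : Set Obs := {x | B < ‖score f x θ₀‖} with hs
  have hsm : NullMeasurableSet s (μ n) :=
    nullMeasurableSet_lt aemeasurable_const (R.aemeasurable_norm_score n)
  have hL := R.memLp_inner_score n u
  have hiabs : Integrable (fun x => |inner ℝ u (score f x θ₀)|) (μ n) :=
    (hL.integrable (by norm_num)).abs
  have h1 : c * ‖u‖ ^ 2 ≤ ∫ x, inner ℝ u (score f x θ₀) ^ 2 ∂(μ n) := by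
    rw [R.integral_inner_score_sq]; exact hcn n u
  rw [← integral_add_compl₀ hsm hL.integrable_sq] at h1
  have h2 : ∫ x in s, inner ℝ u (score f x θ₀) ^ 2 ∂(μ n) ≤ ‖u‖ ^ 2 * (c / 2) := by
    refine (integral_mono hL.integrable_sq.integrableOn
      ((hC n).1.integrableOn.const_mul (‖u‖ ^ 2)) fun x => ?_).trans ?_
    · simp only
      rw [← sq_abs, ← mul_pow]
      exact pow_le_pow_left₀ (abs_nonneg _) (abs_real_inner_le_norm _ _) 2
    · rw [integral_const_mul]
      exact mul_le_mul_of_nonneg_left (hB n) (sq_nonneg _)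
  have h3 : ∫ x in sᶜ, inner ℝ u (score f x θ₀) ^ 2 ∂(μ n)
      ≤ ‖u‖ * B * ∫ x, |inner ℝ u (score f x θ₀)| ∂(μ n) := by
    have h4 : ∫ x in sᶜ, inner ℝ u (score f x θ₀) ^ 2 ∂(μ n)
        ≤ ∫ x in sᶜ, ‖u‖ * B * |inner ℝ u (score f x θ₀)| ∂(μ n) := by
      refine setIntegral_mono_on₀ hL.integrable_sq.integrableOn (hiabs.integrableOn.const_mul _)
        hsm.compl fun x hx => ?_
      have hxB : ‖score f x θ₀‖ ≤ B := by simpa [hs] using hx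
      rw [← sq_abs, pow_two]
      exact mul_le_mul_of_nonneg_right ((abs_real_inner_le_norm _ _).trans
        (mul_le_mul_of_nonneg_left hxB (norm_nonneg _))) (abs_nonneg _)
    rw [integral_const_mul] at h4
    refine h4.trans (mul_le_mul_of_nonneg_left ?_ (by positivity))
    exact setIntegral_le_integral hiabs (ae_of_all _ fun x => abs_nonneg _)
  rw [div_le_iff₀ (by positivity)]
  have h5 : ‖u‖ * (c * ‖u‖) ≤ ‖u‖ * ((∫ x, |inner ℝ u (score f x θ₀)| ∂(μ n)) * (2 * B)) := by
    nlinarith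
  exact le_of_mul_le_mul_left h5 hu'

/-- For small t > 0 the point θ₀ + t u is still in Θ, and a second-order bound integrated over x
gives t E⟨u, score⟩ - t² C ≤ E l(θ₀ + t u) - E l(θ₀) ≤ 0. Divide by t and let t tend to 0; applied
also to -u this yields a centred score. -/
lemma integral_inner_score_nonpos (R : RegularModel f Θ μ θ₀) [∀ n, IsProbabilityMeasure (μ n)]
    (n : ℕ) (hmax : IsMaxOn (fun θ => ∫ x, logLik f x θ ∂(μ n)) Θ θ₀) (u : Param d) :
    ∫ x, inner ℝ u (score f x θ₀) ∂(μ n) ≤ 0 := by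
  obtain ⟨ψ, ⟨Bψ, hψ⟩, hlip⟩ := R.hess.lipschitz
  obtain ⟨D, hD⟩ := R.lik.compact.isBounded.exists_norm_le
  have hD' : ∀ θ ∈ Θ, ‖θ - θ₀‖ ≤ 2 * D := fun θ hθ =>
    (norm_sub_le _ _).trans (by linarith [hD θ hθ, hD θ₀ R.mem])
  have hD0 : 0 ≤ 2 * D := (norm_nonneg _).trans (hD' θ₀ R.mem)
  -- An integrable bound for the Hessian on all of Θ: its size at θ₀ plus the Lipschitz constant
  -- times a bound on the distance to θ₀.
  set a : Obs → ℝ := fun x => (∑ j, ∑ k, |CensSub.hess f x θ₀ j k|) + |ψ x| * (2 * D) with ha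
  have ha0 : ∀ x, 0 ≤ a x := fun x => add_nonneg
    (Finset.sum_nonneg fun j _ => Finset.sum_nonneg fun k _ => abs_nonneg _) (by positivity)
  have hai : Integrable a (μ n) := by
    refine Integrable.add (integrable_finsetSum _ fun j _ => integrable_finsetSum _ fun k _ => ?_)
      (((hψ n).1.integrable (by norm_num)).abs.mul_const _)
    obtain ⟨_, hB⟩ := R.hess.moment θ₀ R.mem j k
    exact ((hB n).1.integrable (by norm_num)).abs
  have hli : ∀ θ ∈ Θ, Integrable (fun x => logLik f x θ) (μ n) := fun θ hθ => by
    obtain ⟨_, hB⟩ := R.lik.moment θ hθ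
    exact (hB n).1.integrable (by norm_num)
  have hgi := (R.memLp_inner_score n u).integrable (by norm_num)
  set C := d * ‖u‖ ^ 2 * ∫ x, a x ∂(μ n) with hCdef
  have hC0 : 0 ≤ C := mul_nonneg (by positivity) (integral_nonneg ha0)
  have key : ∀ t : ℝ, 0 < t → θ₀ + t • u ∈ Θ → ∫ x, inner ℝ u (score f x θ₀) ∂(μ n) ≤ t * C := by
    intro t ht hmem
    have h1 : ∫ x, (logLik f x θ₀ + t * inner ℝ u (score f x θ₀) - t ^ 2 * (d * ‖u‖ ^ 2) * a x) ∂(μ n)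
        ≤ ∫ x, logLik f x (θ₀ + t • u) ∂(μ n) := by
      refine integral_mono_ae (((hli θ₀ R.mem).add (hgi.const_mul t)).sub (hai.const_mul _))
        (hli _ hmem) ?_
      filter_upwards [R.ae_hasHessianOn n, hlip n] with x hx hl
      have h2 := hx.abs_sub_sub_inner_le R.lik.convex (ha0 x) (fun θ hθ j k => by
        have h3 := hl θ hθ θ₀ R.mem j k
        have h4 : |CensSub.hess f x θ₀ j k| ≤ ∑ j, ∑ k, |CensSub.hess f x θ₀ j k| :=
          (Finset.single_le_sum (f := fun k => |CensSub.hess f x θ₀ j k|)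
            (fun k _ => abs_nonneg _) (Finset.mem_univ k)).trans
          (Finset.single_le_sum (f := fun j => ∑ k, |CensSub.hess f x θ₀ j k|)
            (fun j _ => Finset.sum_nonneg fun k _ => abs_nonneg _) (Finset.mem_univ j))
        have h5 : ψ x * ‖θ - θ₀‖ ≤ |ψ x| * (2 * D) :=
          mul_le_mul (le_abs_self _) (hD' θ hθ) (norm_nonneg _) (abs_nonneg _)
        have h6 := abs_sub_abs_le_abs_sub (CensSub.hess f x θ j k) (CensSub.hess f x θ₀ j k)
        simp only [ha]
        linarith) R.mem hmem
      rw [add_sub_cancel_left, inner_smul_right, norm_smul, Real.norm_of_nonneg ht.le,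
        real_inner_comm] at h2
      have h3 := (abs_le.1 h2).1
      nlinarith
    have h2 : ∫ x, logLik f x (θ₀ + t • u) ∂(μ n) ≤ ∫ x, logLik f x θ₀ ∂(μ n) := hmax hmem
    have h3 : Integrable (fun x => logLik f x θ₀ + t * inner ℝ u (score f x θ₀)) (μ n) :=
      (hli θ₀ R.mem).add (hgi.const_mul t)
    rw [integral_sub h3 (hai.const_mul _),
      integral_add (hli θ₀ R.mem) (hgi.const_mul t), integral_const_mul, integral_const_mul] at h1
    have h4 : t * ∫ x, inner ℝ u (score f x θ₀) ∂(μ n) ≤ t * (t * C) := by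
      rw [hCdef]; nlinarith
    exact le_of_mul_le_mul_left h4 ht
  have hlim : Tendsto (fun t : ℝ => t * C) (𝓝[>] 0) (𝓝 0) := by
    have : Tendsto (fun t : ℝ => t * C) (𝓝 0) (𝓝 (0 * C)) := (continuous_mul_const C).tendsto 0
    rw [zero_mul] at this
    exact this.mono_left nhdsWithin_le_nhds
  refine ge_of_tendsto hlim ?_
  have hcont : Tendsto (fun t : ℝ => θ₀ + t • u) (𝓝[>] 0) (𝓝 θ₀) := by
    have : Tendsto (fun t : ℝ => θ₀ + t • u) (𝓝 0) (𝓝 (θ₀ + (0 : ℝ) • u)) :=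
      (by fun_prop : Continuous fun t : ℝ => θ₀ + t • u).tendsto 0
    rw [zero_smul, add_zero] at this
    exact this.mono_left nhdsWithin_le_nhds
  filter_upwards [hcont.eventually_mem (mem_interior_iff_mem_nhds.1 R.mem_interior),
    self_mem_nhdsWithin] with t h1 h2 using key t h2 h1

lemma integral_inner_score_eq_zero (R : RegularModel f Θ μ θ₀) [∀ n, IsProbabilityMeasure (μ n)]
    (n : ℕ) (hmax : IsMaxOn (fun θ => ∫ x, logLik f x θ ∂(μ n)) Θ θ₀) (u : Param d) :
    ∫ x, inner ℝ u (score f x θ₀) ∂(μ n) = 0 := by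
  refine le_antisymm (R.integral_inner_score_nonpos n hmax u) ?_
  have := R.integral_inner_score_nonpos n hmax (-u)
  simp_rw [inner_neg_left, integral_neg] at this
  linarith

end RegularModel

/-! ### The true parameter of the lifetime model maximizes the expected log-likelihood -/

section Gibbs

variable {d : ℕ} {f : Param d → ℝ → ℝ} {Θ : Set (Param d)}

lemma lifetimeCDF_compl {θ : Param d} [IsProbabilityMeasure (lifetimeLaw f θ)] (t : ℝ) :
    lifetimeLaw f θ (Set.Ioi t) = ENNReal.ofReal (1 - lifetimeCDF f θ t) := by
  rw [lifetimeCDF, ← probReal_compl_eq_one_sub measurableSet_Iic, Set.compl_Iic,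
    ofReal_measureReal]

/-- Where f θ₀ vanishes the mass that θ puts is lost, hence an inequality; it is in the direction
that Gibbs' inequality needs. -/
lemma setLIntegral_ratio_le (hf : ∀ θ, Measurable (f θ)) {θ θ₀ : Param d}
    (h₀ : ∀ s, 0 ≤ f θ₀ s) {A : Set ℝ} (hA : MeasurableSet A) :
    ∫⁻ s in A, ENNReal.ofReal (f θ s / f θ₀ s) ∂(lifetimeLaw f θ₀) ≤ lifetimeLaw f θ A := by
  have hm : Measurable fun s => ENNReal.ofReal (f θ s / f θ₀ s) :=
    ((hf θ).div (hf θ₀)).ennreal_ofReal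
  rw [lifetimeLaw, lifetimeLaw, withDensity_apply _ hA, restrict_withDensity hA,
    lintegral_withDensity_eq_lintegral_mul _ (hf θ₀).ennreal_ofReal hm]
  refine lintegral_mono fun s => ?_
  rw [Pi.mul_apply, ← ENNReal.ofReal_mul (h₀ s)]
  rcases (h₀ s).eq_or_lt with h | h
  · simp [← h]
  · rw [mul_div_cancel₀ _ h.ne']

lemma ofReal_survival_ratio_mul_le {θ θ₀ : Param d} [IsProbabilityMeasure (lifetimeLaw f θ)]
    [IsProbabilityMeasure (lifetimeLaw f θ₀)] (t : ℝ) :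
    ENNReal.ofReal ((1 - lifetimeCDF f θ t) / (1 - lifetimeCDF f θ₀ t)) *
      lifetimeLaw f θ₀ (Set.Ioi t) ≤ lifetimeLaw f θ (Set.Ioi t) := by
  have h1 : lifetimeCDF f θ t ≤ 1 := measureReal_le_one
  have h0 : lifetimeCDF f θ₀ t ≤ 1 := measureReal_le_one
  rw [lifetimeCDF_compl, lifetimeCDF_compl,
    ← ENNReal.ofReal_mul (div_nonneg (sub_nonneg.2 h1) (sub_nonneg.2 h0))]
  refine ENNReal.ofReal_le_ofReal ?_
  rcases h0.eq_or_lt with h | h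
  · rw [h]; simpa using h1
  · rw [div_mul_cancel₀ _ (sub_pos.2 h).ne']

/-- Conditionally on the truncation time `τ` and the censoring time `c`, the likelihood ratio has
mean at most one. -/
lemma setLIntegral_exp_logLik_sub_le (hf : IsLifetimeModel f Θ) {θ θ₀ : Param d} (hθ : θ ∈ Θ)
    (hθ₀ : θ₀ ∈ Θ) {c τ : ℝ} (hreg : ∀ᵐ s ∂(lifetimeLaw f θ₀), τ < s →
      τ ≤ min s c ∧ PosLik f (min s c, decide (c < s), τ) θ ∧
        PosLik f (min s c, decide (c < s), τ) θ₀) :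
    ∫⁻ s in Set.Ioi τ, ENNReal.ofReal (Real.exp (logLik f (min s c, decide (c < s), τ) θ
      - logLik f (min s c, decide (c < s), τ) θ₀)) ∂(lifetimeLaw f θ₀)
      ≤ lifetimeLaw f θ₀ (Set.Ioi τ) := by
  have := hf.isProbabilityMeasure θ hθ
  have := hf.isProbabilityMeasure θ₀ hθ₀
  by_cases hz : lifetimeLaw f θ₀ (Set.Ioi τ) = 0
  · rw [Measure.restrict_eq_zero.2 hz]; simp
  -- Since survival beyond τ has positive probability, one regular lifetime exists; it yields the
  -- facts not involving s, namely τ ≤ c and positive survival at τ.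
  obtain ⟨s₀, hs₀, hs₀'⟩ : ∃ s, τ < s ∧ (τ ≤ min s c ∧
      PosLik f (min s c, decide (c < s), τ) θ ∧ PosLik f (min s c, decide (c < s), τ) θ₀) := by
    by_contra hc
    push Not at hc
    refine hz (measure_mono_null (fun s hs => ?_) (ae_iff.1 hreg))
    intro h
    obtain ⟨h1, h2, h3⟩ := h hs
    exact hc s hs h1 h2 h3
  have hτc : τ ≤ c := hs₀'.1.trans (min_le_right _ _)
  have hBθ : 0 < 1 - lifetimeCDF f θ τ := sub_pos.2 hs₀'.2.1.2
  have hB₀ : 0 < 1 - lifetimeCDF f θ₀ τ := sub_pos.2 hs₀'.2.2.2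
  -- The truncation terms contribute this constant factor to the likelihood ratio.
  set κ := (1 - lifetimeCDF f θ₀ τ) / (1 - lifetimeCDF f θ τ) with hκ
  have hκ0 : 0 < κ := div_pos hB₀ hBθ
  have hexp : ∀ {a a₀ : ℝ}, 0 < a → 0 < a₀ →
      Real.exp (Real.log a - Real.log (1 - lifetimeCDF f θ τ)
        - (Real.log a₀ - Real.log (1 - lifetimeCDF f θ₀ τ))) = κ * (a / a₀) := by
    intro a a₀ ha ha₀
    rw [Real.exp_sub, Real.exp_sub, Real.exp_sub, Real.exp_log ha, Real.exp_log ha₀,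
      Real.exp_log hBθ, Real.exp_log hB₀, hκ]
    field_simp
  -- Up to c the failure is seen and the ratio is that of densities; beyond c it is the constant
  -- ratio of survival functions at c. Both integrate to at most the θ-mass of their range, and κ
  -- times the θ-mass of (τ, ∞) is the θ₀-mass.
  have hsplit : Set.Ioi τ = Set.Ioc τ c ∪ Set.Ioi c := (Set.Ioc_union_Ioi_eq_Ioi hτc).symm
  have h1 : ∫⁻ s in Set.Ioc τ c, ENNReal.ofReal (Real.exp
      (logLik f (min s c, decide (c < s), τ) θ - logLik f (min s c, decide (c < s), τ) θ₀))
        ∂(lifetimeLaw f θ₀) ≤ ENNReal.ofReal κ * lifetimeLaw f θ (Set.Ioc τ c) := by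
    refine le_trans ?_ (mul_le_mul_right (setLIntegral_ratio_le hf.measurable
      (hf.nonneg θ₀ hθ₀) measurableSet_Ioc) _)
    have hm : Measurable fun s => ENNReal.ofReal (f θ s / f θ₀ s) :=
      ((hf.measurable θ).div (hf.measurable θ₀)).ennreal_ofReal
    rw [← lintegral_const_mul _ hm]
    refine lintegral_mono_ae ((ae_restrict_iff' measurableSet_Ioc).2 ?_)
    filter_upwards [hreg] with s hs hsm
    obtain ⟨-, h2, h3⟩ := hs hsm.1
    have hd : decide (c < s) = false := by simpa using hsm.2
    have hmin : min s c = s := min_eq_left hsm.2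
    rw [hd, hmin] at h2 h3 ⊢
    rw [← ENNReal.ofReal_mul hκ0.le]
    refine ENNReal.ofReal_le_ofReal (le_of_eq ?_)
    have h4 : 0 < f θ s := by simpa using h2.1
    have h5 : 0 < f θ₀ s := by simpa using h3.1
    rw [← hexp h4 h5]
    simp [logLik]
  have h2 : ∫⁻ s in Set.Ioi c, ENNReal.ofReal (Real.exp
      (logLik f (min s c, decide (c < s), τ) θ - logLik f (min s c, decide (c < s), τ) θ₀))
        ∂(lifetimeLaw f θ₀) ≤ ENNReal.ofReal κ * lifetimeLaw f θ (Set.Ioi c) := by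
    refine le_trans ?_ (mul_le_mul_right (ofReal_survival_ratio_mul_le (θ₀ := θ₀) c) _)
    rw [← setLIntegral_const, ← lintegral_const_mul _ measurable_const]
    refine lintegral_mono_ae ((ae_restrict_iff' measurableSet_Ioi).2 ?_)
    filter_upwards [hreg] with s hs hsm
    obtain ⟨-, h2, h3⟩ := hs (hτc.trans_lt hsm)
    have hd : decide (c < s) = true := by simpa using hsm
    have hmin : min s c = c := min_eq_right (le_of_lt hsm)
    rw [hd, hmin] at h2 h3 ⊢
    rw [← ENNReal.ofReal_mul hκ0.le]
    refine ENNReal.ofReal_le_ofReal (le_of_eq ?_)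
    have h4 : 0 < 1 - lifetimeCDF f θ c := by simpa using h2.1
    have h5 : 0 < 1 - lifetimeCDF f θ₀ c := by simpa using h3.1
    rw [← hexp h4 h5]
    simp [logLik]
  calc _ ≤ _ := by rw [hsplit]; exact lintegral_union_le _ _ _
    _ ≤ _ := add_le_add h1 h2
    _ = ENNReal.ofReal κ * lifetimeLaw f θ (Set.Ioi τ) := by
        rw [← mul_add, hsplit, measure_union (Set.Ioc_disjoint_Ioi le_rfl) measurableSet_Ioi]
    _ = lifetimeLaw f θ₀ (Set.Ioi τ) := by
        rw [lifetimeCDF_compl, lifetimeCDF_compl, ← ENNReal.ofReal_mul hκ0.le, hκ,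
          div_mul_cancel₀ _ hBθ.ne']

/-- The observation recorded from a lifetime and a pair (censoring time, truncation time). -/
noncomputable def observe (p : ℝ × ℝ × ℝ) : Obs := (min p.1 p.2.1, decide (p.2.1 < p.1), p.2.2)

lemma measurable_observe : Measurable observe := by
  have h : Measurable fun p : ℝ × ℝ × ℝ => decide (p.2.1 < p.1) := by
    refine measurable_to_bool ?_
    have : MeasurableSet {p : ℝ × ℝ × ℝ | p.2.1 < p.1} :=
      measurableSet_lt (by fun_prop) (by fun_prop)
    convert this using 1
    ext p
    simp
  exact (measurable_fst.min (measurable_fst.comp measurable_snd)).prodMk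
    (h.prodMk (measurable_snd.comp measurable_snd))

/-- Lifetime and (c, τ) are independent before truncation, so Fubini reduces the claim to fixed (c,
τ); the normalization by the probability of being observed cancels. -/
lemma lintegral_exp_logLik_sub_le (hf : IsLifetimeModel f Θ) {θ θ₀ : Param d} (hθ : θ ∈ Θ)
    (hθ₀ : θ₀ ∈ Θ) {ν : Measure (ℝ × ℝ)} [IsProbabilityMeasure ν]
    [IsProbabilityMeasure (modelLaw f θ₀ ν)]
    (hreg : ∀ᵐ x ∂(modelLaw f θ₀ ν), x.2.2 ≤ x.1 ∧ PosLik f x θ ∧ PosLik f x θ₀) :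
    ∫⁻ x, ENNReal.ofReal (Real.exp (logLik f x θ - logLik f x θ₀)) ∂(modelLaw f θ₀ ν) ≤ 1 := by
  have := hf.isProbabilityMeasure θ₀ hθ₀
  set m := (lifetimeLaw f θ₀).prod ν with hm
  set E : Set (ℝ × ℝ × ℝ) := {p | p.2.2 < p.1} with hE
  have hEm : MeasurableSet E := measurableSet_lt (by fun_prop) (by fun_prop)
  have hlaw : modelLaw f θ₀ ν = (ProbabilityTheory.cond m E).map observe := rfl
  set F : Obs → ℝ≥0∞ := fun x => ENNReal.ofReal (Real.exp (logLik f x θ - logLik f x θ₀)) with hF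
  have hFm : Measurable F := (Real.measurable_exp.comp ((measurable_logLik hf.measurable θ).sub
    (measurable_logLik hf.measurable θ₀))).ennreal_ofReal
  -- Conditioning on a null event would give the zero measure, which is no probability law.
  have hmE : m E ≠ 0 := by
    intro h0
    have h1 : ProbabilityTheory.cond m E = 0 := by
      rw [ProbabilityTheory.cond, Measure.restrict_eq_zero.2 h0, smul_zero]
    have h2 := measure_univ (μ := modelLaw f θ₀ ν)
    rw [hlaw, h1] at h2
    simp at h2
  have hae : ∀ᵐ y ∂ν, ∀ᵐ s ∂(lifetimeLaw f θ₀), (s, y) ∈ E →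
      (observe (s, y)).2.2 ≤ (observe (s, y)).1 ∧ PosLik f (observe (s, y)) θ ∧
        PosLik f (observe (s, y)) θ₀ := by
    have h1 := ae_of_ae_map measurable_observe.aemeasurable (hlaw ▸ hreg)
    have h2 : m.restrict E ≪ ProbabilityTheory.cond m E :=
      Measure.absolutelyContinuous_smul (ENNReal.inv_ne_zero.2 (measure_ne_top _ _))
    have h3 := (ae_restrict_iff' hEm).1 (h2.ae_le h1)
    rw [hm, ← Measure.prod_swap] at h3
    exact Measure.ae_ae_of_ae_prod (ae_of_ae_map measurable_swap.aemeasurable h3)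
  rw [hlaw, lintegral_map hFm measurable_observe, ProbabilityTheory.cond, lintegral_smul_measure,
    smul_eq_mul, ENNReal.inv_mul_le_iff hmE (measure_ne_top _ _), mul_one,
    ← lintegral_indicator hEm, hm,
    lintegral_prod_symm (E.indicator fun a => F (observe a))
      ((hFm.comp measurable_observe).indicator hEm).aemeasurable,
    Measure.prod_apply_symm hEm]
  refine lintegral_mono_ae ?_
  filter_upwards [hae] with y hy
  have h1 := setLIntegral_exp_logLik_sub_le hf hθ hθ₀ (c := y.1) (τ := y.2) hy
  rw [← lintegral_indicator measurableSet_Ioi] at h1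
  exact h1

end Gibbs

namespace RegularModel

variable {d : ℕ} {f : Param d → ℝ → ℝ} {Θ : Set (Param d)} {μ : ℕ → Measure Obs} {θ₀ : Param d}

/-- Gibbs' inequality: y ≤ e^y - 1 for the log-likelihood ratio y, and e^y has mean at most one. -/
lemma isMaxOn_of_modelLaw (R : RegularModel f Θ μ θ₀) [∀ n, IsProbabilityMeasure (μ n)]
    (hf : IsLifetimeModel f Θ) {n : ℕ} {ν : Measure (ℝ × ℝ)} [IsProbabilityMeasure ν]
    (hν : μ n = modelLaw f θ₀ ν) : IsMaxOn (fun θ => ∫ x, logLik f x θ ∂(μ n)) Θ θ₀ := by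
  intro θ hθ
  have hpm : IsProbabilityMeasure (modelLaw f θ₀ ν) := hν ▸ inferInstance
  have h1 : ∫⁻ x, ENNReal.ofReal (Real.exp (logLik f x θ - logLik f x θ₀)) ∂(μ n) ≤ 1 := by
    have hreg := R.regular n
    rw [hν] at hreg ⊢
    exact lintegral_exp_logLik_sub_le hf hθ R.mem
      (hreg.mono fun x hx => ⟨hx.1.2, (hx.2 θ hθ).1, (hx.2 θ₀ R.mem).1⟩)
  have hm : Measurable fun x => Real.exp (logLik f x θ - logLik f x θ₀) :=
    Real.measurable_exp.comp ((measurable_logLik R.meas θ).sub (measurable_logLik R.meas θ₀))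
  have hi : Integrable (fun x => Real.exp (logLik f x θ - logLik f x θ₀)) (μ n) := by
    refine ⟨hm.aestronglyMeasurable, ?_⟩
    rw [hasFiniteIntegral_iff_ofReal (ae_of_all _ fun x => (Real.exp_pos _).le)]
    exact h1.trans_lt ENNReal.one_lt_top
  have h2 : ∫ x, Real.exp (logLik f x θ - logLik f x θ₀) ∂(μ n) ≤ 1 := by
    rw [integral_eq_lintegral_of_nonneg_ae (ae_of_all _ fun x => (Real.exp_pos _).le)
      hm.aestronglyMeasurable]
    exact ENNReal.toReal_le_of_le_ofReal zero_le_one (by simpa using h1)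
  have hli : ∀ θ ∈ Θ, Integrable (fun x => logLik f x θ) (μ n) := fun θ hθ => by
    obtain ⟨_, hB⟩ := R.lik.moment θ hθ
    exact (hB n).1.integrable (by norm_num)
  have h3 : ∫ x, (logLik f x θ - logLik f x θ₀) ∂(μ n)
      ≤ ∫ x, (Real.exp (logLik f x θ - logLik f x θ₀) - 1) ∂(μ n) :=
    integral_mono ((hli θ hθ).sub (hli θ₀ R.mem)) (hi.sub (integrable_const _)) fun x => by
      have := Real.add_one_le_exp (logLik f x θ - logLik f x θ₀)
      simp only
      linarith
  rw [integral_sub (hli θ hθ) (hli θ₀ R.mem), integral_sub hi (integrable_const _)] at h3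
  simp only [integral_const, probReal_univ, smul_eq_mul, one_mul] at h3
  show ∫ x, logLik f x θ ∂(μ n) ≤ ∫ x, logLik f x θ₀ ∂(μ n)
  linarith

lemma isMaxOn_integral_logLik (R : RegularModel f Θ μ θ₀) [∀ n, IsProbabilityMeasure (μ n)]
    (hf : IsLifetimeModel f Θ) (htrue : IsTrueValue f Θ μ θ₀) (n : ℕ) :
    IsMaxOn (fun θ => ∫ x, logLik f x θ ∂(μ n)) Θ θ₀ := by
  rcases htrue n with ⟨ν, hν, h⟩ | h
  · exact R.isMaxOn_of_modelLaw hf h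
  · exact h

end RegularModel

/-! ### Linearization of the subsample estimator -/

/-- The gradient of the subsample log-likelihood. -/
noncomputable def subScore {d : ℕ} (f : Param d → ℝ → ℝ) (n r : ℕ) (x : ℕ → Obs) (π : ℕ → ℝ)
    (K : ℕ → ℕ) (θ : Param d) : Param d :=
  WithLp.toLp 2 fun j => subMean (fun y => score f y θ j) n r x π K

/-- The Hessian of the subsample log-likelihood. -/
noncomputable def subHess {d : ℕ} (f : Param d → ℝ → ℝ) (n r : ℕ) (x : ℕ → Obs) (π : ℕ → ℝ)
    (K : ℕ → ℕ) (θ : Param d) : Matrix (Fin d) (Fin d) ℝ :=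
  Matrix.of fun j k => subMean (fun y => hess f y θ j k) n r x π K

lemma BoundedInProb.sum {Ω : Type*} [MeasurableSpace Ω] {P : Measure Ω} {ι : Type*} (s : Finset ι)
    {Z : ι → ℕ → Ω → ℝ} (h : ∀ i ∈ s, BoundedInProb P (Z i)) :
    BoundedInProb P fun n ω => ∑ i ∈ s, |Z i n ω| := by
  classical
  induction s using Finset.induction_on with
  | empty => exact fun ε _ => ⟨0, by simp⟩
  | insert a s ha ih =>
    simp_rw [Finset.sum_insert ha]
    exact ((h a (Finset.mem_insert_self _ _)).congr_whp (Z := fun n ω => |Z a n ω|)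
      (Whp.of_forall (by simp))).add (ih fun i hi => h i (Finset.mem_insert_of_mem hi))

lemma norm_le_sum_abs {d : ℕ} (v : Param d) : ‖v‖ ≤ ∑ j, |v j| := by
  have h : v = ∑ k, v k • EuclideanSpace.single k (1 : ℝ) := by
    ext i
    simp [Finset.sum_apply, Pi.single_apply]
  conv_lhs => rw [h]
  refine (norm_sum_le _ _).trans (le_of_eq (Finset.sum_congr rfl fun j _ => ?_))
  simp [norm_smul]

section SubMean

variable {d n r : ℕ} {f : Param d → ℝ → ℝ} {Θ : Set (Param d)} {x : ℕ → Obs} {π : ℕ → ℝ}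
  {K : ℕ → ℕ}

lemma inner_subScore (hK : ValidDraws n (r - numFail (dataVec n x)) x K)
    (hpos : ∀ i < n, (x i).2.1 = true → 0 < π i) (θ u : Param d) :
    inner ℝ u (subScore f n r x π K θ) = subMean (fun y => inner ℝ u (score f y θ)) n r x π K := by
  obtain ⟨c, -, hg⟩ := exists_coeff hK hpos
  have h : subScore f n r x π K θ = ∑ i ∈ Finset.range n, c i • score f (x i) θ := by
    ext j
    simp [subScore, hg]
  rw [h, hg, inner_sum]
  simp_rw [inner_smul_right]

lemma hasHessianOn_subMean (hK : ValidDraws n (r - numFail (dataVec n x)) x K)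
    (hpos : ∀ i < n, (x i).2.1 = true → 0 < π i)
    (h : ∀ i < n, HasHessianOn (logLik f (x i)) (score f (x i)) (hess f (x i)) Θ) :
    HasHessianOn (fun θ => subMean (fun y => logLik f y θ) n r x π K) (subScore f n r x π K)
      (subHess f n r x π K) Θ := by
  obtain ⟨c, -, hg⟩ := exists_coeff hK hpos
  have h1 := HasHessianOn.sum (Finset.range n) (c := c) fun i hi => h i (Finset.mem_range.1 hi)
  have e1 : subScore f n r x π K = fun θ => ∑ i ∈ Finset.range n, c i • score f (x i) θ := by
    ext θ j
    simp [subScore, hg]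
  have e2 : subHess f n r x π K = fun θ => ∑ i ∈ Finset.range n, c i • hess f (x i) θ := by
    ext θ j k
    simp [subHess, hg, Matrix.sum_apply]
  simp_rw [hg]
  rw [e1, e2]
  exact h1

lemma abs_subHess_sub_le (hK : ValidDraws n (r - numFail (dataVec n x)) x K)
    (hpos : ∀ i < n, (x i).2.1 = true → 0 < π i) {ψ : Obs → ℝ}
    (h : ∀ i < n, ∀ θ₁ ∈ Θ, ∀ θ₂ ∈ Θ, ∀ j k,
      |hess f (x i) θ₁ j k - hess f (x i) θ₂ j k| ≤ ψ (x i) * ‖θ₁ - θ₂‖)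
    {θ₁ θ₂ : Param d} (h₁ : θ₁ ∈ Θ) (h₂ : θ₂ ∈ Θ) (j k : Fin d) :
    |subHess f n r x π K θ₁ j k - subHess f n r x π K θ₂ j k|
      ≤ subMean ψ n r x π K * ‖θ₁ - θ₂‖ := by
  obtain ⟨c, hc, hg⟩ := exists_coeff hK hpos
  simp only [subHess, Matrix.of_apply, hg]
  rw [← Finset.sum_sub_distrib, Finset.sum_mul]
  refine (Finset.abs_sum_le_sum_abs _ _).trans (Finset.sum_le_sum fun i hi => ?_)
  rw [← mul_sub, abs_mul, abs_of_nonneg (hc i), mul_assoc]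
  exact mul_le_mul_of_nonneg_left (h i (Finset.mem_range.1 hi) θ₁ h₁ θ₂ h₂ j k) (hc i)

/-- The average of the log-likelihood is `subLogLik` divided by n, so maximizers carry over. -/
lemma isMaxOn_subMean {θ₁ : Param d} (h : IsMaxOn (subLogLik f n r x π K) Θ θ₁) :
    IsMaxOn (fun θ => subMean (fun y => logLik f y θ) n r x π K) Θ θ₁ := by
  intro θ hθ
  have h1 : subLogLik f n r x π K θ ≤ subLogLik f n r x π K θ₁ := h hθ
  exact mul_le_mul_of_nonneg_left h1 (by positivity : (0 : ℝ) ≤ 1 / (n : ℝ))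

end SubMean

namespace SubsampleScheme

variable {Ω : Type*} [MeasurableSpace Ω] {P : Measure Ω} [IsProbabilityMeasure P]
  {μ : ℕ → Measure Obs} [∀ n, IsProbabilityMeasure (μ n)]
  {X : ℕ → ℕ → Ω → Obs} {r : ℕ → ℕ} {γ : ℝ} {π : (n : ℕ) → (Fin n → Obs) → ℕ → ℝ}
  {K : ℕ → ℕ → Ω → ℕ} {d : ℕ} {f : Param d → ℝ → ℝ} {Θ : Set (Param d)} {θ₀ : Param d}

omit [IsProbabilityMeasure P] [∀ n, IsProbabilityMeasure (μ n)] in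
lemma pos_of_lt (S : SubsampleScheme P μ X r γ π K) (n : ℕ) (ω : Ω) :
    ∀ i < n, (X n i ω).2.1 = true → 0 < π n (dataVec n fun i => X n i ω) i := fun i hi hc =>
  S.prob.pos n (dataVec n fun i => X n i ω) ⟨i, hi⟩ hc

/-- The subsample Lipschitz constant of the Hessian is bounded with probability tending to one. -/
lemma exists_whp_lipschitz (S : SubsampleScheme P μ X r γ π K) (R : RegularModel f Θ μ θ₀) :
    ∃ a : ℝ, 0 < a ∧ Whp P fun n ω => ∀ θ₁ ∈ Θ, ∀ θ₂ ∈ Θ, ∀ j k,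
      |subHess f n (r n) (fun i => X n i ω) (π n (dataVec n fun i => X n i ω)) (fun j => K n j ω)
          θ₁ j k
        - subHess f n (r n) (fun i => X n i ω) (π n (dataVec n fun i => X n i ω))
          (fun j => K n j ω) θ₂ j k| ≤ a * ‖θ₁ - θ₂‖ := by
  obtain ⟨ψ, ⟨B, hB⟩, hlip⟩ := R.hess.lipschitz
  have hB0 : 0 ≤ B := (integral_nonneg fun x => sq_nonneg _).trans (hB 0).2
  have hψ : ∀ n, ∫ x, ψ x ∂(μ n) ≤ 1 + B := fun n => by
    have h1 : ∫ x, ψ x ∂(μ n) ≤ ∫ x, (1 + ψ x ^ 2) ∂(μ n) :=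
      integral_mono ((hB n).1.integrable (by norm_num))
        ((integrable_const _).add (hB n).1.integrable_sq) fun x => by
          simp only
          nlinarith [sq_nonneg (ψ x - 1)]
    rw [integral_add (integrable_const _) (hB n).1.integrable_sq] at h1
    simp only [integral_const, probReal_univ, smul_eq_mul, mul_one] at h1
    linarith [(hB n).2]
  -- The mean of ψ is at most 1 + B, and one more unit absorbs the deviation of its subsample
  -- average.
  refine ⟨2 + B, by linarith, ?_⟩
  refine (S.whp_valid.and (S.whp_abs_subMean_sub_le (g := fun _ => ψ) (fun n => (hB n).1)
    (fun n => (hB n).2) one_pos)).mono_ae (Eventually.of_forall fun n => ?_)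
  filter_upwards [S.iid.ae_forall (hlip n)] with ω hω hv θ₁ h₁ θ₂ h₂ j k
  refine (abs_subHess_sub_le hv.1.2 (S.pos_of_lt n ω) hω h₁ h₂ j k).trans ?_
  refine mul_le_mul_of_nonneg_right ?_ (norm_nonneg _)
  linarith [(abs_le.1 hv.2).2, hψ n]

lemma whp_abs_subHess_sub_le (S : SubsampleScheme P μ X r γ π K) (R : RegularModel f Θ μ θ₀)
    {θ : Param d} (hθ : θ ∈ Θ) {ε : ℝ} (hε : 0 < ε) :
    Whp P fun n ω => ∀ j k,
      |subHess f n (r n) (fun i => X n i ω) (π n (dataVec n fun i => X n i ω)) (fun j => K n j ω)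
          θ j k - meanHess f (μ n) θ j k| ≤ ε := by
  refine Whp.forall fun j => Whp.forall fun k => ?_
  obtain ⟨B, hB⟩ := R.hess.moment θ hθ j k
  exact S.whp_abs_subMean_sub_le (g := fun _ x => hess f x θ j k) (fun n => (hB n).1)
    (fun n => (hB n).2) hε

/-- The subsample log-likelihood is strongly concave on `Θ` with probability tending to one. -/
lemma exists_whp_concave (S : SubsampleScheme P μ X r γ π K) (R : RegularModel f Θ μ θ₀) :
    ∃ c : ℝ, 0 < c ∧ Whp P fun n ω => ∀ θ ∈ Θ, ∀ v : Param d,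
      inner ℝ v (matOp (subHess f n (r n) (fun i => X n i ω)
        (π n (dataVec n fun i => X n i ω)) (fun j => K n j ω) θ) v) ≤ -c * ‖v‖ ^ 2 := by
  obtain ⟨a, ha, hlip⟩ := S.exists_whp_lipschitz R
  -- Compactness is used by induction over sets; intersecting with Θ keeps the Lipschitz bound
  -- available on them.
  suffices h : ∃ c : ℝ, 0 < c ∧ Whp P fun n ω => ∀ θ ∈ Θ ∩ Θ, ∀ v : Param d,
      inner ℝ v (matOp (subHess f n (r n) (fun i => X n i ω)
        (π n (dataVec n fun i => X n i ω)) (fun j => K n j ω) θ) v) ≤ -c * ‖v‖ ^ 2 by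
    simpa only [Set.inter_self] using h
  refine R.lik.compact.induction_on (p := fun s => ∃ c : ℝ, 0 < c ∧ Whp P fun n ω =>
    ∀ θ ∈ s ∩ Θ, ∀ v : Param d, inner ℝ v (matOp (subHess f n (r n) (fun i => X n i ω)
      (π n (dataVec n fun i => X n i ω)) (fun j => K n j ω) θ) v) ≤ -c * ‖v‖ ^ 2) ?_ ?_ ?_ ?_
  · exact ⟨1, one_pos, Whp.of_forall (by simp)⟩
  · rintro s t hst ⟨c, hc, h⟩
    exact ⟨c, hc, h.mono fun n ω hω θ hθ => hω θ ⟨hst hθ.1, hθ.2⟩⟩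
  · rintro s t ⟨c, hc, h⟩ ⟨c', hc', h'⟩
    refine ⟨min c c', lt_min hc hc', (h.and h').mono fun n ω hω θ hθ v => ?_⟩
    rcases hθ.1 with hs | ht
    · refine (hω.1 θ ⟨hs, hθ.2⟩ v).trans ?_
      nlinarith [sq_nonneg ‖v‖, min_le_left c c']
    · refine (hω.2 θ ⟨ht, hθ.2⟩ v).trans ?_
      nlinarith [sq_nonneg ‖v‖, min_le_right c c']
  · intro θ₁ hθ₁
    obtain ⟨c, hc, hM⟩ := (R.hess.posDef θ₁ hθ₁).exists_le
    -- In the ball of radius η/a each Hessian entry moves by at most η, and sampling adds another η;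
    -- the quadratic form changes by at most d · 2η ≤ c/2 times ‖v‖².
    set η := c / (4 * (d + 1)) with hη
    have hη0 : 0 < η := by positivity
    refine ⟨Metric.ball θ₁ (η / a), mem_nhdsWithin_of_mem_nhds
      (Metric.ball_mem_nhds _ (by positivity)), c / 2, by positivity, ?_⟩
    refine (hlip.and (S.whp_abs_subHess_sub_le R hθ₁ hη0)).mono fun n ω hω θ hθ v => ?_
    set H := subHess f n (r n) (fun i => X n i ω)
      (π n (dataVec n fun i => X n i ω)) (fun j => K n j ω) with hH
    have h1 : ∀ j k, |(H θ - meanHess f (μ n) θ₁) j k| ≤ 2 * η := fun j k => by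
      have h2 := hω.1 θ hθ.2 θ₁ hθ₁ j k
      have h3 : a * ‖θ - θ₁‖ ≤ η := by
        have := mem_ball_iff_norm.1 hθ.1
        rw [lt_div_iff₀ ha] at this
        linarith
      have h4 := hω.2 j k
      rw [Matrix.sub_apply]
      have := abs_sub_le (H θ j k) (H θ₁ j k) (meanHess f (μ n) θ₁ j k)
      linarith
    have h2 := (abs_le.1 (abs_inner_matOp_le (by positivity) h1 v)).2
    have h3 := hM n v
    unfold matOp at h2 h3 ⊢
    rw [map_sub, _root_.sub_apply, inner_sub_right] at h2
    rw [map_neg, _root_.neg_apply, inner_neg_right] at h3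
    have h4 : (d : ℝ) * (2 * η) ≤ c / 2 := by
      rw [hη]
      have : (d : ℝ) * (2 * (c / (4 * (d + 1)))) = c / 2 * (d / (d + 1)) := by field_simp; ring
      rw [this]
      exact mul_le_of_le_one_right (by positivity) (div_le_one_of_le₀ (by linarith) (by positivity))
    nlinarith [sq_nonneg ‖v‖, mul_le_mul_of_nonneg_right h4 (sq_nonneg ‖v‖)]

lemma boundedInProb_norm_subScore (S : SubsampleScheme P μ X r γ π K) (R : RegularModel f Θ μ θ₀)
    (h0 : ∀ n (u : Param d), ∫ x, inner ℝ u (score f x θ₀) ∂(μ n) = 0) :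
    BoundedInProb P fun n ω => √(r n) * ‖subScore f n (r n) (fun i => X n i ω)
      (π n (dataVec n fun i => X n i ω)) (fun j => K n j ω) θ₀‖ := by
  obtain ⟨C, -, hC⟩ := R.exists_integral_inner_score_sq_le
  have h1 : ∀ j : Fin d, BoundedInProb P fun n ω => √(r n) * subScore f n (r n)
      (fun i => X n i ω) (π n (dataVec n fun i => X n i ω)) (fun j => K n j ω) θ₀ j := fun j => by
    have := S.boundedInProb_subMean
      (g := fun _ x => inner ℝ (EuclideanSpace.single j (1 : ℝ)) (score f x θ₀))
      (fun n => R.memLp_inner_score n _) (fun n => hC n _)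
    simp only [h0, sub_zero] at this
    simpa only [← RegularModel.score_apply_eq, subScore] using this
  refine (BoundedInProb.sum Finset.univ fun j _ => h1 j).congr_whp
    (Whp.of_forall (Eventually.of_forall fun n ω => ?_))
  rw [abs_of_nonneg (by positivity), abs_of_nonneg (Finset.sum_nonneg fun j _ => abs_nonneg _)]
  refine (mul_le_mul_of_nonneg_left (norm_le_sum_abs _) (Real.sqrt_nonneg _)).trans (le_of_eq ?_)
  rw [Finset.mul_sum]
  refine Finset.sum_congr rfl fun j _ => ?_
  rw [abs_mul, abs_of_nonneg (Real.sqrt_nonneg _)]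

/-- The subsample estimator is asymptotically linear in the subsample score. -/
lemma whp_norm_subScore_add_le (S : SubsampleScheme P μ X r γ π K) (R : RegularModel f Θ μ θ₀)
    (h0 : ∀ n (u : Param d), ∫ x, inner ℝ u (score f x θ₀) ∂(μ n) = 0)
    {θc : ℕ → Ω → Param d} (hθc : ∀ n, ∀ᵐ ω ∂P, θc n ω ∈ Θ ∧
      IsMaxOn (subLogLik f n (r n) (fun i => X n i ω) (π n (dataVec n fun i => X n i ω))
        (fun j => K n j ω)) Θ (θc n ω)) {ε : ℝ} (hε : 0 < ε) :
    Whp P fun n ω => √(r n) * ‖subScore f n (r n) (fun i => X n i ω)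
      (π n (dataVec n fun i => X n i ω)) (fun j => K n j ω) θ₀
        + matOp (meanHess f (μ n) θ₀) (θc n ω - θ₀)‖ ≤ ε := by
  obtain ⟨a, ha, hlip⟩ := S.exists_whp_lipschitz R
  obtain ⟨c, hc, hconc⟩ := S.exists_whp_concave R
  obtain ⟨ρ, hρ, hball⟩ := Metric.isOpen_iff.1 isOpen_interior θ₀ R.mem_interior
  refine (S.boundedInProb_norm_subScore R h0).whp fun B hB => ?_
  -- Makes the Hessian error d η times √r‖θc - θ₀‖ ≤ B/c at most ε/2.
  set η := ε * c / (2 * (d + 1) * B) with hη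
  have hη0 : 0 < η := by positivity
  have hl1 := S.tendsto_const_div_sqrt (B / c)
  have hl2 := S.tendsto_const_div_sqrt (d * a * (B / c) ^ 2)
  refine ((S.whp_valid.and (hlip.and hconc)).and
    (S.whp_abs_subHess_sub_le R R.mem hη0)).mono_ae ?_
  filter_upwards [hl1.eventually_lt_const hρ, hl2.eventually_lt_const (half_pos hε),
    S.eventually_ratio_le] with n hn1 hn2 ⟨hr, _, _⟩
  filter_upwards [hθc n, S.iid.ae_forall (R.ae_hasHessianOn n)] with ω hmax hreg ⟨⟨hv, hl, hcv⟩, hH⟩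
    hG
  have hs : 0 < √(r n : ℝ) := Real.sqrt_pos.2 (by exact_mod_cast hr)
  have hess := hasHessianOn_subMean hv.2 (S.pos_of_lt n ω) hreg
  set G := subScore f n (r n) (fun i => X n i ω) (π n (dataVec n fun i => X n i ω))
    (fun j => K n j ω) with hGdef
  set H := subHess f n (r n) (fun i => X n i ω) (π n (dataVec n fun i => X n i ω))
    (fun j => K n j ω) with hHdef
  rw [abs_of_nonneg (by positivity)] at hG
  -- Strong concavity on all of Θ gives the rate r^{-1/2} outright; consistency, and with it
  -- interiority of the maximizer, follows from the rate.
  have h1 := hess.norm_sub_le_of_isMaxOn R.lik.convex hc hcv R.mem hmax.1 (isMaxOn_subMean hmax.2)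
  have h2 : ‖θc n ω - θ₀‖ ≤ B / c / √(r n) := by
    refine h1.trans ?_
    rw [div_div, div_le_div_iff₀ hc (by positivity)]
    nlinarith
  have h3 : θc n ω ∈ interior Θ := hball (mem_ball_iff_norm.2 (h2.trans_lt hn1))
  have h4 := hess.norm_grad_add_le R.lik.convex ha.le R.mem h3
    (fun θ hθ => hl θ hθ θ₀ R.mem) (isMaxOn_subMean hmax.2)
  have h5 : ‖matOp (meanHess f (μ n) θ₀ - H θ₀) (θc n ω - θ₀)‖ ≤ d * η * ‖θc n ω - θ₀‖ :=
    norm_matOp_apply_le hη0.le (fun j k => by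
      rw [Matrix.sub_apply, abs_sub_comm]; exact hH j k) _
  have h6 : G θ₀ + matOp (meanHess f (μ n) θ₀) (θc n ω - θ₀)
      = (G θ₀ + matOp (H θ₀) (θc n ω - θ₀))
        + matOp (meanHess f (μ n) θ₀ - H θ₀) (θc n ω - θ₀) := by
    have h7 : matOp (meanHess f (μ n) θ₀ - H θ₀)
        = matOp (meanHess f (μ n) θ₀) - matOp (H θ₀) := map_sub _ _ _
    rw [h7, _root_.sub_apply]
    abel
  set y := ‖θc n ω - θ₀‖ with hy
  have hy0 : 0 ≤ y := norm_nonneg _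
  have h7 : √(r n) * y ≤ B / c := by
    rw [le_div_iff₀ hs] at h2; linarith
  have h8 : √(r n) * ‖G θ₀ + matOp (meanHess f (μ n) θ₀) (θc n ω - θ₀)‖
      ≤ √(r n) * (d * a * y ^ 2 + d * η * y) := by
    rw [h6]
    exact mul_le_mul_of_nonneg_left ((norm_add_le _ _).trans (add_le_add h4 h5)) hs.le
  refine h8.trans ?_
  have h9 : √(r n) * (d * a * y ^ 2) ≤ d * a * (B / c) ^ 2 / √(r n) := by
    rw [le_div_iff₀ hs]
    calc √(r n) * (d * a * y ^ 2) * √(r n) = d * a * (√(r n) * y) ^ 2 := by ring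
      _ ≤ _ := by gcongr
  have h10 : √(r n) * (d * η * y) ≤ ε / 2 := by
    calc √(r n) * (d * η * y) = d * η * (√(r n) * y) := by ring
      _ ≤ d * η * (B / c) := by gcongr
      _ = ε / 2 * (d / (d + 1)) := by rw [hη]; field_simp
      _ ≤ ε / 2 := mul_le_of_le_one_right (by positivity)
          (div_le_one_of_le₀ (by linarith) (by positivity))
  rw [mul_add]
  linarith

end SubsampleScheme

/-! ### The limit of the conditional variance is positive definite -/

lemma inner_matOp_outer {d : ℕ} (u v : Param d) :
    inner ℝ u (matOp (outer v) u) = inner ℝ u v ^ 2 := by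
  rw [inner_matOp, RegularModel.sum_outer_eq]

/-- Links the matrix hypothesis on Λ_c to the scalar central limit theorem in each direction u. -/
lemma condVar_inner_score {d n : ℕ} (f : Param d → ℝ → ℝ) (D : Fin n → Obs) (π : ℕ → ℝ)
    (θ u : Param d) : condVar (fun x => inner ℝ u (score f x θ)) π D
      = inner ℝ u (matOp (lambdaC f D π θ) u) := by
  unfold lambdaC matOp
  rw [map_sub, map_smul, map_sum, _root_.sub_apply, inner_sub_right, inner_matOp_outer, condVar,
    censMean, _root_.smul_apply, inner_smul_right, _root_.sum_apply,
    inner_sum, inner_smul_right, inner_sum]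
  refine congrArg₂ (fun a b => 1 / (n : ℝ) ^ 2 * a - (1 / (n : ℝ) * b) ^ 2)
    (Finset.sum_congr rfl fun i _ => ?_) (Finset.sum_congr rfl fun i _ => ?_)
  · split_ifs
    · rw [map_smul, _root_.smul_apply, inner_smul_right, inner_matOp_outer]
    · simp
  · split_ifs <;> simp

lemma lambdaC_symm {d n : ℕ} (f : Param d → ℝ → ℝ) (D : Fin n → Obs) (π : ℕ → ℝ)
    (θ : Param d) (j k : Fin d) : lambdaC f D π θ j k = lambdaC f D π θ k j := by
  have h : ∀ v : Param d, (outer v).transpose = outer v := fun v => by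
    ext j k; simp [outer, mul_comm]
  have h2 : (lambdaC f D π θ).transpose = lambdaC f D π θ := by
    rw [lambdaC, Matrix.transpose_sub, h, Matrix.transpose_smul, Matrix.transpose_sum]
    congr 2
    refine Finset.sum_congr rfl fun i _ => ?_
    split_ifs
    · rw [Matrix.transpose_smul, h]
    · simp
  conv_lhs => rw [← h2]
  rfl

/-- The weighted sum of squares sees only |g|. As `condVar` of |g| is nonnegative, `condVar` of g is
at least (mean of |g|)² - (mean of g)². -/
lemma condVar_eq_add {n : ℕ} (g : Obs → ℝ) (π : ℕ → ℝ) (D : Fin n → Obs) :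
    condVar g π D = condVar (fun x => |g x|) π D + censMean (fun x => |g x|) D ^ 2
      - censMean g D ^ 2 := by
  simp only [condVar, sq_abs]
  ring

lemma censMean_dataVec (g : Obs → ℝ) (n : ℕ) (x : ℕ → Obs) :
    censMean g (dataVec n x) = fullMean (fun y => if y.2.1 then g y else 0) n x := by
  rw [censMean, fullMean, Finset.sum_range]
  rfl

lemma measurableSet_obs_censored : MeasurableSet {x : Obs | x.2.1 = true} :=
  measurableSet_eq_fun (measurable_fst.comp measurable_snd) measurable_const

lemma memLp_ite_censored {ν : Measure Obs} {g : Obs → ℝ} (hg : MemLp g 2 ν) :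
    MemLp (fun y : Obs => if y.2.1 then g y else 0) 2 ν := by
  have : (fun y : Obs => if y.2.1 then g y else 0) = {x : Obs | x.2.1 = true}.indicator g := by
    ext y
    simp [Set.indicator_apply]
  rw [this]
  exact hg.indicator measurableSet_obs_censored

lemma integral_ite_censored_sq_le {ν : Measure Obs} {g : Obs → ℝ} (hg : MemLp g 2 ν) :
    ∫ y : Obs, (if y.2.1 then g y else 0) ^ 2 ∂ν ≤ ∫ y, g y ^ 2 ∂ν := by
  refine integral_mono (memLp_ite_censored hg).integrable_sq hg.integrable_sq fun y => ?_
  simp only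
  split_ifs
  · exact le_rfl
  · rw [zero_pow two_ne_zero]; exact sq_nonneg _

namespace SubsampleScheme

variable {Ω : Type*} [MeasurableSpace Ω] {P : Measure Ω} [IsProbabilityMeasure P]
  {μ : ℕ → Measure Obs} [∀ n, IsProbabilityMeasure (μ n)]
  {X : ℕ → ℕ → Ω → Obs} {r : ℕ → ℕ} {γ : ℝ} {π : (n : ℕ) → (Fin n → Obs) → ℕ → ℝ}
  {K : ℕ → ℕ → Ω → ℕ} {d : ℕ} {f : Param d → ℝ → ℝ} {Θ : Set (Param d)} {θ₀ : Param d}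

/-- The probability of a failure tends to zero. -/
lemma eventually_failProb_le (S : SubsampleScheme P μ X r γ π K) {ε : ℝ} (hε : 0 < ε) :
    ∀ᶠ n in atTop, ∫ x : Obs, (if x.2.1 then (0 : ℝ) else 1) ∂(μ n) ≤ ε := by
  have hγ := S.gamma_nonneg
  have hm : Measurable fun x : Obs => if x.2.1 then (0 : ℝ) else 1 :=
    Measurable.ite measurableSet_obs_censored measurable_const measurable_const
  have hL : ∀ n, MemLp (fun x : Obs => if x.2.1 then (0 : ℝ) else 1) 2 (μ n) := fun n =>
    MemLp.of_bound hm.aestronglyMeasurable 1 (ae_of_all _ fun x => by split_ifs <;> simp)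
  have hB : ∀ n, ∫ x : Obs, (if x.2.1 then (0 : ℝ) else 1) ^ 2 ∂(μ n) ≤ 1 := fun n => by
    refine (integral_mono (hL n).integrable_sq (integrable_const 1) fun x => ?_).trans ?_
    · simp only
      split_ifs <;> simp
    · simp
  have h1 := (S.whp_abs_fullMean_sub_le hL hB (half_pos hε)).and
    (S.failRate.whp (show 0 < ε / (2 * (γ + 1)) by positivity))
  -- The failure probability is not random, so one ω suffices where the failure frequency n₀/n =
  -- (n₀/r)(r/n) is small and near its mean.
  filter_upwards [h1.frequently, S.eventually_ratio_le] with n ⟨ω, h2, h3⟩ ⟨hr, hn, hrn⟩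
  have hr' : (0 : ℝ) < r n := by exact_mod_cast hr
  have hn' : (0 : ℝ) < n := by exact_mod_cast hn
  have h4 : fullMean (fun x : Obs => if x.2.1 then (0 : ℝ) else 1) n (fun i => X n i ω)
      = (numFail (dataVec n fun i => X n i ω) : ℝ) / n := by
    rw [fullMean, numFail, Finset.card_filter, Finset.sum_range, Nat.cast_sum, one_div_mul_eq_div]
    congr 1
    refine Finset.sum_congr rfl fun i _ => ?_
    simp only [dataVec]
    by_cases hc : (X n i ω).2.1 = true <;> simp [hc]
  rw [sub_zero, abs_of_nonneg (by positivity), div_le_iff₀ hr'] at h3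
  have h5 : (numFail (dataVec n fun i => X n i ω) : ℝ) / n ≤ ε / 2 := by
    rw [div_le_iff₀ hn']
    rw [div_le_iff₀ hn'] at hrn
    calc _ ≤ ε / (2 * (γ + 1)) * ((γ + 1) * n) := h3.trans (by gcongr)
      _ = ε / 2 * n := by field_simp
  rw [h4] at h2
  linarith [(abs_le.1 h2).1]

/-- Failures are rare and g has bounded second moment: on failures |g| ≤ η g² + 1/(4η), the weighted
form of Cauchy–Schwarz. -/
lemma eventually_integral_abs_fail_le (S : SubsampleScheme P μ X r γ π K) {g : Obs → ℝ}
    (hg : ∀ n, MemLp g 2 (μ n)) {B : ℝ} (hB : ∀ n, ∫ x, g x ^ 2 ∂(μ n) ≤ B) {ε : ℝ} (hε : 0 < ε) :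
    ∀ᶠ n in atTop, ∫ x, |g x| ∂(μ n) - ε ≤ ∫ x : Obs, (if x.2.1 then |g x| else 0) ∂(μ n) ∧
      |∫ x : Obs, (if x.2.1 then g x else 0) ∂(μ n) - ∫ x, g x ∂(μ n)| ≤ ε := by
  have hB0 : 0 ≤ B := (integral_nonneg fun x => sq_nonneg _).trans (hB 0)
  set η := ε / (2 * (B + 1)) with hη
  have hη0 : 0 < η := by positivity
  filter_upwards [S.eventually_failProb_le (show 0 < 2 * η * ε by positivity)] with n hn
  have hgi := (hg n).integrable (by norm_num : (1 : ℝ≥0∞) ≤ 2)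
  have hci := (memLp_ite_censored (hg n)).integrable (by norm_num : (1 : ℝ≥0∞) ≤ 2)
  have hai : Integrable (fun x : Obs => if x.2.1 then |g x| else 0) (μ n) :=
    (memLp_ite_censored (hg n).abs).integrable (by norm_num : (1 : ℝ≥0∞) ≤ 2)
  have hfm : Measurable fun x : Obs => if x.2.1 then (0 : ℝ) else 1 :=
    Measurable.ite measurableSet_obs_censored measurable_const measurable_const
  have hfi : Integrable (fun x : Obs => if x.2.1 then (0 : ℝ) else 1) (μ n) :=
    (MemLp.of_bound hfm.aestronglyMeasurable 1
      (ae_of_all _ fun x => by split_ifs <;> simp) : MemLp _ 1 (μ n)).integrable le_rfl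
  have key : ∫ x : Obs, (|g x| - if x.2.1 then |g x| else 0) ∂(μ n) ≤ ε := by
    have h1 : ∫ x : Obs, (|g x| - if x.2.1 then |g x| else 0) ∂(μ n)
        ≤ ∫ x : Obs, (η * g x ^ 2 + (4 * η)⁻¹ * if x.2.1 then (0 : ℝ) else 1) ∂(μ n) := by
      refine integral_mono (hgi.abs.sub hai)
        (((hg n).integrable_sq.const_mul _).add (hfi.const_mul _)) fun x => ?_
      simp only
      split_ifs
      · simp; positivity
      · rw [sub_zero, mul_one, ← sq_abs (g x)]
        have h2 : η * |g x| ^ 2 + (4 * η)⁻¹ - |g x| = η * (|g x| - (2 * η)⁻¹) ^ 2 := by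
          field_simp; ring
        have h3 : 0 ≤ η * (|g x| - (2 * η)⁻¹) ^ 2 := by positivity
        linarith
    rw [integral_add ((hg n).integrable_sq.const_mul _) (hfi.const_mul _), integral_const_mul,
      integral_const_mul] at h1
    have h2 : η * ∫ x, g x ^ 2 ∂(μ n) ≤ ε / 2 := by
      calc _ ≤ η * (B + 1) := by gcongr; linarith [hB n]
        _ = ε / 2 := by rw [hη]; field_simp
    have h3 : (4 * η)⁻¹ * ∫ x : Obs, (if x.2.1 then (0 : ℝ) else 1) ∂(μ n) ≤ ε / 2 := by
      calc _ ≤ (4 * η)⁻¹ * (2 * η * ε) := by gcongr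
        _ = ε / 2 := by field_simp; ring
    linarith
  refine ⟨?_, ?_⟩
  · rw [integral_sub hgi.abs hai] at key
    linarith
  · rw [abs_sub_comm, ← integral_sub hgi hci]
    refine (abs_integral_le_integral_abs).trans (le_trans (le_of_eq ?_) key)
    refine integral_congr_ae (ae_of_all _ fun x => ?_)
    simp only
    split_ifs <;> simp

variable {Λ₁ : Matrix (Fin d) (Fin d) ℝ}

omit [IsProbabilityMeasure P] [∀ n, IsProbabilityMeasure (μ n)] in
lemma whp_abs_condVar_sub_le
    (hΛ₁ : ∀ j k, TendstoInMeasure P (fun n ω => lambdaC f (dataVec n fun i => X n i ω)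
      (π n (dataVec n fun i => X n i ω)) θ₀ j k) atTop (fun _ => Λ₁ j k))
    {u : ℕ → Param d} {U : ℝ} (hu : ∀ n, ‖u n‖ ≤ U) {ε : ℝ} (hε : 0 < ε) :
    Whp P fun n ω => |condVar (fun x => inner ℝ (u n) (score f x θ₀))
      (π n (dataVec n fun i => X n i ω)) (dataVec n fun i => X n i ω)
        - inner ℝ (u n) (matOp Λ₁ (u n))| ≤ ε := by
  have hη : 0 < ε / (d * U ^ 2 + 1) := by positivity
  refine (Whp.forall fun j => Whp.forall fun k => (hΛ₁ j k).whp hη).mono fun n ω hω => ?_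
  have h1 := abs_inner_matOp_le (A := lambdaC f (dataVec n fun i => X n i ω)
    (π n (dataVec n fun i => X n i ω)) θ₀ - Λ₁) hη.le hω (u n)
  have h2 : matOp (lambdaC f (dataVec n fun i => X n i ω)
      (π n (dataVec n fun i => X n i ω)) θ₀ - Λ₁) = matOp (lambdaC f (dataVec n fun i => X n i ω)
        (π n (dataVec n fun i => X n i ω)) θ₀) - matOp Λ₁ := map_sub _ _ _
  rw [h2, _root_.sub_apply, inner_sub_right, ← condVar_inner_score] at h1
  refine h1.trans ?_
  have h3 : ‖u n‖ ^ 2 ≤ U ^ 2 := pow_le_pow_left₀ (norm_nonneg _) (hu n) 2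
  calc _ ≤ d * (ε / (d * U ^ 2 + 1)) * U ^ 2 := by gcongr
    _ = ε * ((d * U ^ 2) / (d * U ^ 2 + 1)) := by field_simp
    _ ≤ ε := mul_le_of_le_one_right hε.le (div_le_one_of_le₀ (by linarith) (by positivity))

-- Each `lambdaC` is symmetric, and at some sample point both entries are within ε/2 of their
-- limits.
omit [∀ n, IsProbabilityMeasure (μ n)] in
lemma limit_isSymm
    (hΛ₁ : ∀ j k, TendstoInMeasure P (fun n ω => lambdaC f (dataVec n fun i => X n i ω)
      (π n (dataVec n fun i => X n i ω)) θ₀ j k) atTop (fun _ => Λ₁ j k)) : Λ₁.IsSymm := by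
  ext j k
  rw [Matrix.transpose_apply]
  refine eq_of_abs_sub_le_all fun ε hε => ?_
  obtain ⟨n, ω, h1, h2⟩ :=
    (((hΛ₁ k j).whp (half_pos hε)).and ((hΛ₁ j k).whp (half_pos hε))).frequently.exists
  rw [lambdaC_symm] at h2
  rw [abs_le] at *
  constructor <;> linarith

/-- With g = ⟨u, score⟩, nearly everyone is censored, so the censored mean of g is near E g = 0
while that of |g| stays above a positive constant; `condVar_eq_add` then keeps the conditional
variance away from zero whatever the drawing probabilities are. -/
lemma inner_limit_pos (S : SubsampleScheme P μ X r γ π K) (R : RegularModel f Θ μ θ₀)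
    (h0 : ∀ n (u : Param d), ∫ x, inner ℝ u (score f x θ₀) ∂(μ n) = 0)
    (hΛ₁ : ∀ j k, TendstoInMeasure P (fun n ω => lambdaC f (dataVec n fun i => X n i ω)
      (π n (dataVec n fun i => X n i ω)) θ₀ j k) atTop (fun _ => Λ₁ j k))
    {u : Param d} (hu : u ≠ 0) : 0 < inner ℝ u (matOp Λ₁ u) := by
  obtain ⟨κ, hκ0, hκ⟩ := R.exists_le_integral_abs_inner_score hu
  obtain ⟨C, -, hC⟩ := R.exists_integral_inner_score_sq_le
  set g : Obs → ℝ := fun x => inner ℝ u (score f x θ₀) with hg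
  have hgL : ∀ n, MemLp g 2 (μ n) := fun n => R.memLp_inner_score n u
  have hgB : ∀ n, ∫ x, g x ^ 2 ∂(μ n) ≤ ‖u‖ ^ 2 * C := fun n => hC n u
  -- Two errors of κ/8 leave means at least 3κ/4 for |g| and at most κ/4 in size for g. So `condVar`
  -- ≥ 9κ²/16 - κ²/16 = κ²/2, and the limit is at least κ²/4.
  have hκ8 : 0 < κ / 8 := by positivity
  have h1 := S.whp_abs_fullMean_sub_le (g := fun _ y => if y.2.1 then g y else 0)
    (fun n => memLp_ite_censored (hgL n))
    (fun n => (integral_ite_censored_sq_le (hgL n)).trans (hgB n)) hκ8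
  have h2 := S.whp_abs_fullMean_sub_le (g := fun _ y => if y.2.1 then |g y| else 0)
    (fun n => memLp_ite_censored (hgL n).abs)
    (fun n => (integral_ite_censored_sq_le (g := fun x => |g x|) (hgL n).abs).trans
      (le_trans (by simp only [sq_abs, le_refl]) (hgB n))) hκ8
  have h3 := whp_abs_condVar_sub_le hΛ₁ (fun _ : ℕ => le_refl ‖u‖)
    (show 0 < κ ^ 2 / 4 by positivity)
  obtain ⟨n, ⟨ω, hv, ⟨h4, h5⟩, h6⟩, h7⟩ := ((S.whp_valid.and ((h1.and h2).and h3)).frequently.and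
    (S.eventually_integral_abs_fail_le hgL hgB hκ8)).exists
  have hsum := (S.setup n).sum_eq_one (dataVec n fun i => X n i ω)
    ⟨⟨_, (hv.2 0 hv.1).1⟩, (hv.2 0 hv.1).2⟩
  have h8 := condVar_nonneg (g := fun x => |g x|) (S.prob.pos n (dataVec n fun i => X n i ω)) hsum
  have h9 := condVar_eq_add g (π n (dataVec n fun i => X n i ω)) (dataVec n fun i => X n i ω)
  rw [censMean_dataVec, censMean_dataVec] at h9
  rw [h0 n u, sub_zero] at h7
  have h10 := hκ n
  set a := fullMean (fun y : Obs => if y.2.1 then |g y| else 0) n fun i => X n i ω with ha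
  set b := fullMean (fun y : Obs => if y.2.1 then g y else 0) n fun i => X n i ω with hb
  have ha' : κ * (3 / 4) ≤ a := by linarith [(abs_le.1 h5).1, h7.1]
  have hb' : |b| ≤ κ / 4 := by
    rw [abs_le]
    constructor <;> linarith [(abs_le.1 h4).1, (abs_le.1 h4).2, (abs_le.1 h7.2).1,
      (abs_le.1 h7.2).2]
  have ha2 : (κ * (3 / 4)) ^ 2 ≤ a ^ 2 := pow_le_pow_left₀ (by positivity) ha' 2
  have hb2 : b ^ 2 ≤ (κ / 4) ^ 2 := by
    rw [← sq_abs]; exact pow_le_pow_left₀ (abs_nonneg _) hb' 2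
  have h11 := (abs_le.1 h6).2
  have h12 : condVar g (π n (dataVec n fun i => X n i ω)) (dataVec n fun i => X n i ω)
    - inner ℝ u (matOp Λ₁ u) ≤ κ ^ 2 / 4 := h11
  nlinarith [pow_pos hκ0 2]

end SubsampleScheme

/-! ### Square roots of positive definite matrices and the asymptotic covariance -/

section Matrix

variable {d : ℕ}

lemma matOp_mul_apply (A B : Matrix (Fin d) (Fin d) ℝ) (v : Param d) :
    matOp (A * B) v = matOp A (matOp B v) := by
  unfold matOp
  rw [map_mul]
  rfl

lemma matOp_one_apply (v : Param d) : matOp (1 : Matrix (Fin d) (Fin d) ℝ) v = v := by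
  unfold matOp
  rw [map_one]
  rfl

lemma inner_matOp_symm {A : Matrix (Fin d) (Fin d) ℝ} (hA : A.IsSymm) (u v : Param d) :
    inner ℝ u (matOp A v) = inner ℝ (matOp A u) v := by
  rw [real_inner_comm v (matOp A u), inner_matOp, inner_matOp, Finset.sum_comm]
  refine Finset.sum_congr rfl fun j _ => Finset.sum_congr rfl fun k _ => ?_
  rw [hA.apply]
  ring

lemma posDef_of_inner_pos {A : Matrix (Fin d) (Fin d) ℝ} (hA : A.IsSymm)
    (h : ∀ u : Param d, u ≠ 0 → 0 < inner ℝ u (matOp A u)) : A.PosDef := by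
  refine Matrix.PosDef.of_dotProduct_mulVec_pos ?_ fun x hx => ?_
  · rw [Matrix.IsHermitian, Matrix.conjTranspose_eq_transpose_of_trivial]; exact hA
  · have := h (WithLp.toLp 2 x) (by simpa using hx)
    rwa [Matrix.inner_toEuclideanCLM] at this

lemma isSymm_of_isHermitian {A : Matrix (Fin d) (Fin d) ℝ} (hA : A.IsHermitian) : A.IsSymm := by
  rwa [Matrix.IsHermitian, Matrix.conjTranspose_eq_transpose_of_trivial] at hA

lemma exists_le_inner_of_pos {A : Matrix (Fin d) (Fin d) ℝ}
    (h : ∀ u : Param d, u ≠ 0 → 0 < inner ℝ u (matOp A u)) :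
    ∃ c : ℝ, 0 < c ∧ ∀ u : Param d, c * ‖u‖ ^ 2 ≤ inner ℝ u (matOp A u) := by
  have hcont : Continuous fun u : Param d => inner ℝ u (matOp A u) :=
    continuous_id.inner (matOp A).continuous
  -- The unit sphere is empty for d = 0; otherwise c is the minimum of the form on it.
  rcases (Metric.sphere (0 : Param d) 1).eq_empty_or_nonempty with he | hne
  · refine ⟨1, one_pos, fun u => ?_⟩
    have hu : u = 0 := by
      by_contra hu
      have : ‖u‖⁻¹ • u ∈ Metric.sphere (0 : Param d) 1 := by
        simp [norm_smul, inv_mul_cancel₀ (norm_ne_zero_iff.2 hu)]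
      rw [he] at this
      exact this
    simp [hu]
  · obtain ⟨w, hw, hmin⟩ := (isCompact_sphere (0 : Param d) 1).exists_isMinOn hne hcont.continuousOn
    have hw0 : w ≠ 0 := fun h0 => by simp [h0] at hw
    refine ⟨_, h w hw0, fun u => ?_⟩
    rcases eq_or_ne u 0 with rfl | hu
    · simp
    have hn : 0 < ‖u‖ := norm_pos_iff.2 hu
    have h1 : inner ℝ w (matOp A w) ≤ inner ℝ (‖u‖⁻¹ • u) (matOp A (‖u‖⁻¹ • u)) :=
      hmin (by simp [norm_smul, inv_mul_cancel₀ hn.ne'])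
    rw [map_smul, inner_smul_left, inner_smul_right] at h1
    simp only [map_inv₀, conj_trivial] at h1
    calc _ ≤ ‖u‖⁻¹ * (‖u‖⁻¹ * inner ℝ u (matOp A u)) * ‖u‖ ^ 2 :=
          mul_le_mul_of_nonneg_right h1 (sq_nonneg _)
      _ = _ := by field_simp

lemma posDef_asympCov {M S : Matrix (Fin d) (Fin d) ℝ} (hM : (-M).PosDef) (hS : S.PosDef) :
    (M⁻¹ * S * M⁻¹).PosDef := by
  have hu : IsUnit M := by simpa using hM.isUnit
  have hH : M⁻¹.conjTranspose = M⁻¹ := by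
    have : M.IsHermitian := by simpa using hM.isHermitian.neg
    exact this.inv
  have h := hS.conjTranspose_mul_mul_same (B := M⁻¹)
    (Matrix.mulVec_injective_of_isUnit (Matrix.isUnit_nonsing_inv_iff.2 hu))
  rwa [hH] at h

/-- With `u = -M⁻¹ V^{-1/2} t` the quadratic form of `S` at `u` is `‖t‖²`, and `V^{-1/2}`
is self-adjoint. -/
lemma exists_direction {M S : Matrix (Fin d) (Fin d) ℝ} (hM : (-M).PosDef) (hS : S.PosDef)
    (t : Param d) :
    ∃ u : Param d, inner ℝ u (matOp S u) = ‖t‖ ^ 2 ∧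
      ∀ v, inner ℝ (invSqrtMul (M⁻¹ * S * M⁻¹) v) t = -inner ℝ u (matOp M v) := by
  set V := M⁻¹ * S * M⁻¹ with hV
  have hVp : V.PosDef := posDef_asympCov hM hS
  have hV0 : 0 ≤ V := Matrix.nonneg_iff_posSemidef.2 hVp.posSemidef
  set Q := CFC.sqrt V with hQ
  have hQu : IsUnit Q := (CFC.isUnit_sqrt_iff V hV0).2 hVp.isUnit
  have hQd : IsUnit Q.det := (Matrix.isUnit_iff_isUnit_det Q).1 hQu
  have hQQ : Q * Q = V := CFC.sqrt_mul_sqrt_self V hV0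
  have hQs : Q⁻¹.IsSymm := isSymm_of_isHermitian
    (Matrix.nonneg_iff_posSemidef.1 (CFC.sqrt_nonneg V)).isHermitian.inv
  have hMh : M.IsHermitian := by simpa using hM.isHermitian.neg
  have hMs : M.IsSymm := isSymm_of_isHermitian hMh
  have hMis : M⁻¹.IsSymm := isSymm_of_isHermitian hMh.inv
  have hMd : IsUnit M.det := (Matrix.isUnit_iff_isUnit_det M).1 (by simpa using hM.isUnit)
  refine ⟨-matOp M⁻¹ (matOp Q⁻¹ t), ?_, fun v => ?_⟩
  · rw [map_neg, inner_neg_neg, ← inner_matOp_symm hMis, ← inner_matOp_symm hQs,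
      ← matOp_mul_apply, ← matOp_mul_apply, ← matOp_mul_apply, ← matOp_mul_apply]
    have : Q⁻¹ * M⁻¹ * S * M⁻¹ * Q⁻¹ = 1 := by
      calc _ = Q⁻¹ * V * Q⁻¹ := by rw [hV]; simp only [mul_assoc]
        _ = 1 := by
          rw [← hQQ, ← mul_assoc, Matrix.nonsing_inv_mul _ hQd, one_mul,
            Matrix.mul_nonsing_inv _ hQd]
    rw [this, matOp_one_apply, real_inner_self_eq_norm_sq]
  · rw [inner_neg_left, neg_neg, ← inner_matOp_symm hMis, ← matOp_mul_apply,
      Matrix.nonsing_inv_mul _ hMd, matOp_one_apply, ← inner_matOp_symm hQs]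
    exact real_inner_comm _ _

end Matrix

lemma UnifPosDef.posDef {d : ℕ} {A : ℕ → Matrix (Fin d) (Fin d) ℝ} (h : UnifPosDef A) (n : ℕ) :
    (A n).PosDef := by
  obtain ⟨c, hc, hcn⟩ := h.exists_le
  refine posDef_of_inner_pos (h.isSymm n) fun u hu => lt_of_lt_of_le ?_ (hcn n u)
  have := norm_pos_iff.2 hu
  positivity

/-! ### The characteristic function of the normalized estimator -/

section Limit

variable {Ω : Type*} [MeasurableSpace Ω] {P : Measure Ω} [IsProbabilityMeasure P]
  {μ : ℕ → Measure Obs} [∀ n, IsProbabilityMeasure (μ n)]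
  {X : ℕ → ℕ → Ω → Obs} {r : ℕ → ℕ} {γ : ℝ} {π : (n : ℕ) → (Fin n → Obs) → ℕ → ℝ}
  {K : ℕ → ℕ → Ω → ℕ} {d : ℕ} {f : Param d → ℝ → ℝ} {Θ : Set (Param d)} {θ₀ : Param d}
  {Λ₁ : Matrix (Fin d) (Fin d) ℝ}

omit [∀ n, IsProbabilityMeasure (μ n)] in
lemma posDef_limit_add (hsym : Λ₁.IsSymm)
    (hpos : ∀ u : Param d, u ≠ 0 → 0 < inner ℝ u (matOp Λ₁ u)) (hγ : 0 ≤ γ)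
    (R : RegularModel f Θ μ θ₀) (n : ℕ) : (Λ₁ + γ • meanSqScore f (μ n) θ₀).PosDef :=
  (posDef_of_inner_pos hsym hpos).add_posSemidef
    ((R.sqScore_posDef.posDef n).posSemidef.smul hγ)

/-- The normalization is moved onto t, giving a direction `u n` in which the asymptotic variance is
‖t‖² for every n; convergence of V is thus never needed. -/
lemma SubsampleScheme.tendsto_charFun_estimator (S : SubsampleScheme P μ X r γ π K)
    (R : RegularModel f Θ μ θ₀)
    (h0 : ∀ n (u : Param d), ∫ x, inner ℝ u (score f x θ₀) ∂(μ n) = 0)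
    (hΛ₁ : ∀ j k, TendstoInMeasure P (fun n ω => lambdaC f (dataVec n fun i => X n i ω)
      (π n (dataVec n fun i => X n i ω)) θ₀ j k) atTop (fun _ => Λ₁ j k))
    {θc : ℕ → Ω → Param d} (hθcm : ∀ n, AEMeasurable (θc n) P)
    (hθc : ∀ n, ∀ᵐ ω ∂P, θc n ω ∈ Θ ∧
      IsMaxOn (subLogLik f n (r n) (fun i => X n i ω) (π n (dataVec n fun i => X n i ω))
        (fun j => K n j ω)) Θ (θc n ω)) (t : Param d) :
    Tendsto (fun n => ∫ ω, Complex.exp ((inner ℝ (√(r n) • invSqrtMul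
      (asympCov (meanHess f (μ n) θ₀) Λ₁ (meanSqScore f (μ n) θ₀) γ) (θc n ω - θ₀)) t : ℝ)
        * Complex.I) ∂P) atTop (𝓝 (Complex.exp (-(‖t‖ : ℂ) ^ 2 / 2))) := by
  have hpos : ∀ u : Param d, u ≠ 0 → 0 < inner ℝ u (matOp Λ₁ u) := fun u hu =>
    S.inner_limit_pos R h0 hΛ₁ hu
  have hsym := limit_isSymm hΛ₁
  obtain ⟨c, hc, hcu⟩ := exists_le_inner_of_pos hpos
  choose u hu1 hu2 using fun n => exists_direction ((R.hess.posDef θ₀ R.mem).posDef n)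
    (posDef_limit_add hsym hpos S.gamma_nonneg R n) t
  have hsum : ∀ n, inner ℝ (u n) (matOp Λ₁ (u n))
      + γ * ∫ x, inner ℝ (u n) (score f x θ₀) ^ 2 ∂(μ n) = ‖t‖ ^ 2 := fun n => by
    rw [← hu1 n, R.integral_inner_score_sq]
    unfold matOp
    rw [map_add, map_smul, _root_.add_apply, _root_.smul_apply, inner_add_right, inner_smul_right]
  have hτ0 : ∀ n, 0 ≤ inner ℝ (u n) (matOp Λ₁ (u n)) := fun n =>
    (by positivity : 0 ≤ c * ‖u n‖ ^ 2).trans (hcu _)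
  have hτmax : ∀ n, inner ℝ (u n) (matOp Λ₁ (u n)) ≤ ‖t‖ ^ 2 := fun n => by
    have := mul_nonneg S.gamma_nonneg
      (integral_nonneg (μ := μ n) fun x => sq_nonneg (inner ℝ (u n) (score f x θ₀)))
    have := hsum n
    linarith
  -- Here positive definiteness of Λ₁ matters: c‖u‖² ≤ ⟨u, Λ₁ u⟩ ≤ ‖t‖².
  have hU : ∀ n, ‖u n‖ ≤ √(‖t‖ ^ 2 / c) := fun n => by
    refine Real.le_sqrt_of_sq_le ?_
    rw [le_div_iff₀ hc, mul_comm]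
    exact (hcu _).trans (hτmax n)
  obtain ⟨C, hC0, hC⟩ := R.exists_integral_inner_score_sq_le
  have hm : ∀ n, AEMeasurable (fun ω => inner ℝ (√(r n) • invSqrtMul
      (asympCov (meanHess f (μ n) θ₀) Λ₁ (meanSqScore f (μ n) θ₀) γ) (θc n ω - θ₀)) t) P := by
    intro n
    have : Continuous fun v : Param d => (inner ℝ (√(r n) • invSqrtMul
        (asympCov (meanHess f (μ n) θ₀) Λ₁ (meanSqScore f (μ n) θ₀) γ) (v - θ₀)) t : ℝ) := by
      unfold invSqrtMul
      fun_prop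
    exact this.measurable.comp_aemeasurable (hθcm n)
  have key := S.tendsto_charFun (g := fun n x => inner ℝ (u n) (score f x θ₀))
    (fun n => R.memLp_inner_score n (u n)) (B := ‖t‖ ^ 2 / c * C) (fun n => (hC n _).trans (by
      refine mul_le_mul_of_nonneg_right ?_ hC0
      exact (pow_le_pow_left₀ (norm_nonneg _) (hU n) 2).trans (Real.sq_sqrt (by positivity)).le))
    (fun n => h0 n _) (R.unifLindeberg_inner_score hU) hτ0 hτmax
    (fun ε hε => SubsampleScheme.whp_abs_condVar_sub_le hΛ₁ hU hε) hm (fun ε hε => by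
      set U := √(‖t‖ ^ 2 / c) with hUdef
      have hU0 : 0 ≤ U := Real.sqrt_nonneg _
      refine ((S.whp_norm_subScore_add_le R h0 hθc
        (show 0 < ε / (U + 1) by positivity)).and S.whp_valid).mono fun n ω hω => ?_
      have h1 := inner_subScore (f := f) hω.2.2 (S.pos_of_lt n ω) θ₀ (u n)
      -- The difference to be bounded is -√r ⟨u n, subScore + M(θc - θ₀)⟩, the linearization error
      -- tested against u n.
      rw [← h1, inner_smul_left, asympCov, hu2 n, conj_trivial, ← mul_sub, neg_sub_left,
        ← inner_add_right, abs_mul, abs_neg, abs_of_nonneg (Real.sqrt_nonneg _)]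
      refine (mul_le_mul_of_nonneg_left (abs_real_inner_le_norm _ _) (Real.sqrt_nonneg _)).trans ?_
      calc _ = ‖u n‖ * (√(r n) * ‖subScore f n (r n) (fun i => X n i ω)
            (π n (dataVec n fun i => X n i ω)) (fun j => K n j ω) θ₀
              + matOp (meanHess f (μ n) θ₀) (θc n ω - θ₀)‖) := by ring
        _ ≤ U * (ε / (U + 1)) := mul_le_mul (hU n) hω.1 (by positivity) hU0
        _ = ε * (U / (U + 1)) := by ring
        _ ≤ ε := mul_le_of_le_one_right hε.le (div_le_one_of_le₀ (by linarith) (by positivity)))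
  simp only [hsum] at key
  have h2 := key.add_const (Real.exp (-(‖t‖ ^ 2 / 2)) : ℂ)
  simp only [sub_add_cancel, zero_add] at h2
  convert h2 using 2
  push_cast
  congr 1
  ring

end Limit

end CensSub

/-! ### The theorem -/

theorem mainTheorem6 {Ω : Type*} [MeasurableSpace Ω] (P : Measure Ω) [IsProbabilityMeasure P]
    {d : ℕ} (f : CensSub.Param d → ℝ → ℝ) (Θ : Set (CensSub.Param d))
    (hf : CensSub.IsLifetimeModel f Θ)
    -- the data: for each `n`, independent observations `X n 0, …, X n (n - 1)` with law `μ n`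
    (μ : ℕ → Measure CensSub.Obs) [∀ n, IsProbabilityMeasure (μ n)]
    (X : ℕ → ℕ → Ω → CensSub.Obs) (hX : CensSub.IsIIDData P μ X)
    (hreg : CensSub.IsRegular f Θ μ)
    -- the true value
    (θ₀ : CensSub.Param d) (hθ₀ : θ₀ ∈ interior Θ) (htrue : CensSub.IsTrueValue f Θ μ θ₀)
    -- the full-data maximum likelihood estimator
    (θhat : ℕ → Ω → CensSub.Param d) (hθhat : CensSub.IsUniqueMLE P f Θ X θhat)
    -- subsample sizes, subsampling probabilities and draws
    (r : ℕ → ℕ) (hr : Tendsto r atTop atTop)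
    (γ : ℝ) (hγ : Tendsto (fun n => (r n : ℝ) / (n : ℝ)) atTop (𝓝 γ))
    (hn₀ : TendstoInMeasure P
      (fun n ω => (CensSub.numFail (CensSub.dataVec n fun i => X n i ω) : ℝ) / (r n : ℝ))
      atTop (fun _ => (0 : ℝ)))
    (π : (n : ℕ) → (Fin n → CensSub.Obs) → ℕ → ℝ) (hπ : CensSub.IsSubsamplingProb π)
    (K : ℕ → ℕ → Ω → ℕ) (hKmeas : ∀ n j, Measurable (K n j))
    (hK : ∀ n, CensSub.IsCensoringDraw P n (r n) (X n) (π n) (K n))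
    -- the censoring subsampling estimator
    (θc : ℕ → Ω → CensSub.Param d) (hθcmeas : ∀ n, AEMeasurable (θc n) P)
    (hθc : ∀ n, ∀ᵐ ω ∂P, θc n ω ∈ Θ ∧
      IsMaxOn (CensSub.subLogLik f n (r n) (fun i => X n i ω)
        (π n (CensSub.dataVec n fun i => X n i ω)) (fun j => K n j ω)) Θ (θc n ω))
    -- the assumptions
    (hlik : CensSub.LikelihoodAssumption f Θ μ)
    (hhess : CensSub.HessianAssumption f Θ μ)
    (hscore : CensSub.ScoreAssumption P f Θ μ θ₀ X θhat)
    (hweight : CensSub.WeightAssumption P X π)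
    (Λ₁ : Matrix (Fin d) (Fin d) ℝ)
    (hΛ₁ : ∀ j k, TendstoInMeasure P
      (fun n ω => CensSub.lambdaC f (CensSub.dataVec n fun i => X n i ω)
        (π n (CensSub.dataVec n fun i => X n i ω)) θ₀ j k)
      atTop (fun _ => Λ₁ j k)) :
    (∀ n, (CensSub.asympCov (CensSub.meanHess f (μ n) θ₀) Λ₁
        (CensSub.meanSqScore f (μ n) θ₀) γ).PosDef) ∧
    TendstoInDistribution
      (fun n ω => Real.sqrt (r n) •
        CensSub.invSqrtMul
          (CensSub.asympCov (CensSub.meanHess f (μ n) θ₀) Λ₁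
            (CensSub.meanSqScore f (μ n) θ₀) γ)
          (θc n ω - θ₀))
      atTop id (fun _ => P) (stdGaussian (CensSub.Param d)) := by
  have R : CensSub.RegularModel f Θ μ θ₀ :=
    ⟨hf.measurable, hθ₀, hreg, hlik, hhess, hscore.posDef, hscore.unifIntegrable⟩
  have S : CensSub.SubsampleScheme P μ X r γ π K :=
    ⟨hX, hr, hγ, hn₀, hπ, hKmeas, hK, hweight⟩
  have h0 : ∀ n (u : CensSub.Param d), ∫ x, inner ℝ u (CensSub.score f x θ₀) ∂(μ n) = 0 :=
    fun n => R.integral_inner_score_eq_zero n (R.isMaxOn_integral_logLik hf htrue n)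
  have hm : ∀ n, AEMeasurable (fun ω => Real.sqrt (r n) • CensSub.invSqrtMul
      (CensSub.asympCov (CensSub.meanHess f (μ n) θ₀) Λ₁ (CensSub.meanSqScore f (μ n) θ₀) γ)
        (θc n ω - θ₀)) P := by
    intro n
    have : Continuous fun v : CensSub.Param d => Real.sqrt (r n) • CensSub.invSqrtMul
        (CensSub.asympCov (CensSub.meanHess f (μ n) θ₀) Λ₁ (CensSub.meanSqScore f (μ n) θ₀) γ)
          (v - θ₀) := by
      unfold CensSub.invSqrtMul
      fun_prop
    exact this.measurable.comp_aemeasurable (hθcmeas n)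
  refine ⟨fun n => CensSub.posDef_asympCov ((hhess.posDef θ₀ R.mem).posDef n)
    (CensSub.posDef_limit_add (CensSub.SubsampleScheme.limit_isSymm hΛ₁)
      (fun u hu => S.inner_limit_pos R h0 hΛ₁ hu) S.gamma_nonneg R n), hm, aemeasurable_id, ?_⟩
  -- Lévy's continuity theorem reduces weak convergence to the limit of characteristic functions at
  -- each t.
  refine ProbabilityMeasure.tendsto_iff_tendsto_charFun.2 fun t => ?_
  have hlim := S.tendsto_charFun_estimator R h0 hΛ₁ hθcmeas hθc t
  simp only [ProbabilityMeasure.coe_mk, Measure.map_id, charFun_stdGaussian]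
  refine hlim.congr fun n => ?_
  rw [charFun_apply, integral_map (hm n) (by fun_prop)]
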